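/- **Model.** Let $\lambda_W>0$, $\lambda_L\ge 0$, $P_W,P_L,\Gamma_{cs},\Gamma_{ed},\mu,\alpha,\lambda_c>0$, and let $l(d)=(4\pi/\lambda_c)^2 d^{\alpha}$ be the path loss. Wi-Fi access points (APs) and LTE eNBs form independent homogeneous Poisson point processes $\Phi_W=\{x_i\}$ and $\Phi_L=\{y_k\}$ on $\mathbb{R}^2$ with intensities $\lambda_W$ and $\lambda_L$. Each AP $x_i$ has a timer $t_i$ uniform on $[0,1]$; the fadings $G^W_{ji}$ (from AP $x_j$ to AP $x_i$) and $G^{LW}_{ki}$ (from eNB $y_k$ to AP $x_i$) are exponential with parameter $\mu$; all timers and fadings are independent, and independent of $(\Phi_W,\Phi_L)$. LTE transmits continuously, and AP $x_i$ transmits ($e_i=1$) if and only if $G^{LW}_{ki}/l(\|y_k-x_i\|)\le \Gamma_{ed}/P_L$ for every $y_k\in\Phi_L$ and, for every $x_j\in\Phi_W\setminus\{x_i\}$, either $t_j\ge t_i$, or $t_j<t_i$ and $G^W_{ji}/l(\|x_j-x_i\|)\le\Gamma_{cs}/P_W$; otherwise $e_i=0$. AP $x_i$ is *tagged* if it is closest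 to the origin, i.e. $\Phi_W(B^o(0,\|x_i\|))=0$, where $B^o(z,\varepsilon)$ and $B(z,\varepsilon)$ are the open and the closed ball. **Functions.** For $y,y_1,y_2\in\mathbb{R}^2$ and $r,\Gamma\ge 0$ let $$N^W_0(y,r,\Gamma)=\lambda_W\int_{\mathbb{R}^2\setminus B(0,r)} e^{-\mu\frac{\Gamma}{P_W}l(\|z-y\|)}\,dz,\qquad N^W_2(r)=N^W_0((r,0),r,\Gamma_{cs}),$$ $$N^L=\lambda_L\int_{\mathbb{R}^2} e^{-\mu\frac{\Gamma_{ed}}{P_L}l(\|z\|)}\,dz,\qquad C^L_2(y)=\lambda_L\int_{\mathbb{R}^2} e^{-\mu\frac{\Gamma_{ed}}{P_L}(l(\|z-y\|)+l(\|z\|))}\,dz,$$ $$C^W_1(y_1,y_2)=\lambda_W\int_{\mathbb{R}^2\setminus B(0,\|y_2\|)} e^{-\mu\frac{\Gamma_{cs}}{P_W}(l(\|z-y_1\|)+l(\|z-y_2\|))}\,dz,$$ $$M(N_1,N_2,N_3)=\frac{1}{N_2-N_3}\left(\frac{1-e^{-N_1}}{N_1}-\frac{1-e^{-N_1-N_2+N_3}}{N_1+N_2-N_3}\right),$$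 $$V(x,s_1,s_2,N_1,N_2,N_3)=(1-e^{-\mu s_1 l(\|x\|)})M(N_1,N_2,N_3)+(1-e^{-\mu s_2 l(\|x\|)})M(N_2,N_1,N_3),$$ $$U(x,s,N_1)=\frac{1-e^{-N_1}}{N_1}-e^{-\mu s\, l(\|x\|)}\left(\frac{1-e^{-N_1}}{N_1^2}-\frac{e^{-N_1}}{N_1}\right).$$ For $x_0,x\in\mathbb{R}^2$ with $r_0=\|x_0\|$ put $$h(x_0,x)=\frac{V\big(x-x_0,\tfrac{\Gamma_{cs}}{P_W},\tfrac{\Gamma_{cs}}{P_W},N^W_2(r_0),N^W_0(x,r_0,\Gamma_{cs}),C^W_1(x,x_0)\big)}{U\big(x-x_0,\tfrac{\Gamma_{cs}}{P_W},N^W_2(r_0)\big)\,\exp\big(N^L-C^L_2(x-x_0)\big)},\qquad h_1(r_0,x)=h((r_0,0),x).$$ **Result.** Conditionally on the tagged AP being at $x_0=(r_0,0)$ and transmitting, another AP at $x\in\mathbb{R}^2\setminus B(0,r_0)$ transmits with (Palm) probability $h_1(r_0,x)$. Precisely, for Borel $S\subseteq\mathbb{R}^2\times\mathbb{R}^2$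 let $$D(S)=\mathbb{E}\sum_{i\ne j}\mathbf 1\{(x_i,x_j)\in S,\ x_i\text{ tagged},\ e_i=1\},\qquad C(S)=\mathbb{E}\sum_{i\ne j}\mathbf 1\{(x_i,x_j)\in S,\ x_i\text{ tagged},\ e_i=1,\ e_j=1\}$$ be the two-point Campbell measures of the respective events; the Palm conditional probability is the density of $C$ with respect to $D$. Then: 1. for all $r_0\ge 0$ and $x\in\mathbb{R}^2\setminus B(0,r_0)$, with $x_0=(r_0,0)$, $$\lim_{\varepsilon\downarrow 0}\frac{C\big(B^o(x_0,\varepsilon)\times B^o(x,\varepsilon)\big)}{D\big(B^o(x_0,\varepsilon)\times B^o(x,\varepsilon)\big)}=h_1(r_0,x);$$ 2. $C(S)=\int_S h(x_0,x)\,D(d(x_0,x))$ for all Borel $S$. -/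

import Mathlib

open MeasureTheory ProbabilityTheory Filter Topology

noncomputable section

namespace Coexistence

/-- The plane `ℝ²` with the Euclidean norm and Lebesgue measure. -/
abbrev Plane : Type := EuclideanSpace ℝ (Fin 2)

/-- System parameters: AP and eNB intensities, transmit powers, carrier sensing and energy
detection thresholds, Rayleigh fading parameter, path loss exponent and wavelength. The LTE
intensity may be zero (no LTE network). -/
structure Params where
  lamW : ℝ
  lamL : ℝ
  PW : ℝ
  PL : ℝ
  Gcs : ℝ
  Ged : ℝ
  mu : ℝ
  alpha : ℝ
  wavelength : ℝ
  lamW_pos : 0 < lamW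
  lamL_nonneg : 0 ≤ lamL
  PW_pos : 0 < PW
  PL_pos : 0 < PL
  Gcs_pos : 0 < Gcs
  Ged_pos : 0 < Ged
  mu_pos : 0 < mu
  alpha_pos : 0 < alpha
  wavelength_pos : 0 < wavelength

namespace Params

variable (p : Params)

/-! ### Path loss and the special functions -/

/-- Path loss in linear scale: `20 log₁₀ (4π/λ_c) + 10 α log₁₀ d` decibel. -/
def pathLoss (d : ℝ) : ℝ := (4 * Real.pi / p.wavelength) ^ 2 * d ^ p.alpha

/-- `N^L_0(y, r, Γ)`; `B(0, r)` is the closed ball. -/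
def NL0 (y : Plane) (r G : ℝ) : ℝ :=
  p.lamL * ∫ x in (Metric.closedBall (0 : Plane) r)ᶜ,
    Real.exp (-p.mu * (G / p.PL) * p.pathLoss ‖x - y‖)

/-- `N^W_0(y, r, Γ)`. -/
def NW0 (y : Plane) (r G : ℝ) : ℝ :=
  p.lamW * ∫ x in (Metric.closedBall (0 : Plane) r)ᶜ,
    Real.exp (-p.mu * (G / p.PW) * p.pathLoss ‖x - y‖)

/-- `N^W_2(r) = N^W_0((r, 0), r, Γ_cs)`. -/
def NW2 (r : ℝ) : ℝ := p.NW0 !₂[r, 0] r p.Gcs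

/-- `N^L = N^L_0(o, 0, Γ_ed)`. -/
def NL : ℝ := p.NL0 0 0 p.Ged

/-- `C^L_0(y₁, Γ₁, y₂, Γ₂)`. -/
def CL0 (y₁ : Plane) (G₁ : ℝ) (y₂ : Plane) (G₂ : ℝ) : ℝ :=
  p.lamL * ∫ x in (Metric.closedBall (0 : Plane) ‖y₂‖)ᶜ,
    Real.exp (-p.mu * (G₁ / p.PL) * p.pathLoss ‖x - y₁‖
      - p.mu * (G₂ / p.PL) * p.pathLoss ‖x - y₂‖)

/-- `C^W_0(y₁, Γ₁, y₂, Γ₂)`. -/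
def CW0 (y₁ : Plane) (G₁ : ℝ) (y₂ : Plane) (G₂ : ℝ) : ℝ :=
  p.lamW * ∫ x in (Metric.closedBall (0 : Plane) ‖y₂‖)ᶜ,
    Real.exp (-p.mu * (G₁ / p.PW) * p.pathLoss ‖x - y₁‖
      - p.mu * (G₂ / p.PW) * p.pathLoss ‖x - y₂‖)

/-- `C^W_1(y₁, y₂) = C^W_0(y₁, Γ_cs, y₂, Γ_cs)`. -/
def CW1 (y₁ y₂ : Plane) : ℝ := p.CW0 y₁ p.Gcs y₂ p.Gcs

/-- `C^L_2(y₁) = C^L_0(y₁, Γ_ed, o, Γ_ed)`. -/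
def CL2 (y₁ : Plane) : ℝ := p.CL0 y₁ p.Ged 0 p.Ged

/-- The function `M(N₁, N₂, N₃)`. -/
def M (N₁ N₂ N₃ : ℝ) : ℝ :=
  ((1 - Real.exp (-N₁)) / N₁ - (1 - Real.exp (-N₁ - N₂ + N₃)) / (N₁ + N₂ - N₃)) / (N₂ - N₃)

/-- The function `V(x, s₁, s₂, N₁, N₂, N₃)`. -/
def V (x : Plane) (s₁ s₂ N₁ N₂ N₃ : ℝ) : ℝ :=
  (1 - Real.exp (-p.mu * s₁ * p.pathLoss ‖x‖)) * M N₁ N₂ N₃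
    + (1 - Real.exp (-p.mu * s₂ * p.pathLoss ‖x‖)) * M N₂ N₁ N₃

/-- The function `U(x, s, N₁)`. -/
def U (x : Plane) (s N₁ : ℝ) : ℝ :=
  (1 - Real.exp (-N₁)) / N₁
    - Real.exp (-p.mu * s * p.pathLoss ‖x‖)
      * ((1 - Real.exp (-N₁)) / N₁ ^ 2 - Real.exp (-N₁) / N₁)

/-- The ratio formula for a tagged AP at `x₀` (whose distance to the origin is `r₀ = ‖x₀‖`) and
another AP at `x`. -/
def hAt (x₀ x : Plane) : ℝ :=
  p.V (x - x₀) (p.Gcs / p.PW) (p.Gcs / p.PW)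
      (p.NW2 ‖x₀‖) (p.NW0 x ‖x₀‖ p.Gcs) (p.CW1 x x₀)
    / (p.U (x - x₀) (p.Gcs / p.PW) (p.NW2 ‖x₀‖) * Real.exp (p.NL - p.CL2 (x - x₀)))

/-- The function `h₁(r₀, x)`; the tagged AP is at `x₀ = (r₀, 0)`. -/
def h1 (r₀ : ℝ) (x : Plane) : ℝ :=
  p.V (x - !₂[r₀, 0]) (p.Gcs / p.PW) (p.Gcs / p.PW)
      (p.NW2 r₀) (p.NW0 x r₀ p.Gcs) (p.CW1 x !₂[r₀, 0])
    / (p.U (x - !₂[r₀, 0]) (p.Gcs / p.PW) (p.NW2 r₀)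
        * Real.exp (p.NL - p.CL2 (x - !₂[r₀, 0])))

end Params

/-! ### Poisson point processes and the network -/

/-- The number of points in `A` of the configuration consisting of the first `k` (possibly
infinitely many) terms of the sequence `x`. -/
def numPoints (k : ℕ∞) (x : ℕ → Plane) (A : Set Plane) : ℕ∞ :=
  Set.encard {i : ℕ | (i : ℕ∞) < k ∧ x i ∈ A}

/-- The random set `{X i ω | i < K ω}`, enumerated without repetition, is a homogeneous Poisson
point process of intensity `lam` on the plane. -/
structure IsPoissonProcess {Ω : Type*} [MeasurableSpace Ω] (P : Measure Ω)
    (K : Ω → ℕ∞) (X : ℕ → Ω → Plane) (lam : ℝ) : Prop where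
  measurable_count : Measurable K
  measurable_point : ∀ i, Measurable (X i)
  distinct : ∀ᵐ ω ∂P, ∀ i j : ℕ, (i : ℕ∞) < K ω → (j : ℕ∞) < K ω → X i ω = X j ω → i = j
  poisson : ∀ A : Set Plane, MeasurableSet A → volume A ≠ ⊤ → ∀ n : ℕ,
    P {ω | numPoints (K ω) (fun i => X i ω) A = n} =
      ENNReal.ofReal (Real.exp (-(lam * volume.real A)) * (lam * volume.real A) ^ n
        / (n.factorial : ℝ))
  indep : ∀ (n : ℕ) (A : Fin n → Set Plane), (∀ m, MeasurableSet (A m)) →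
    Pairwise (fun l m => Disjoint (A l) (A m)) →
    iIndepFun (fun m ω => numPoints (K ω) (fun i => X i ω) (A m)) P

/-- Wi-Fi APs `X i`, `i < KW`, and LTE eNBs `Y k`, `k < KL`, forming independent Poisson point
processes, together with i.i.d. uniform back-off timers `t i` of the APs and i.i.d. exponential
fadings: `GW j i` from AP `j` to AP `i`, and `GLW k i` from eNB `k` to AP `i`. All timers and
fadings are independent, and independent of the locations. -/
structure Network {Ω : Type*} [MeasurableSpace Ω] (P : Measure Ω) (p : Params) where
  KW : Ω → ℕ∞
  X : ℕ → Ω → Plane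
  KL : Ω → ℕ∞
  Y : ℕ → Ω → Plane
  t : ℕ → Ω → ℝ
  GW : ℕ → ℕ → Ω → ℝ
  GLW : ℕ → ℕ → Ω → ℝ
  poissonW : IsPoissonProcess P KW X p.lamW
  poissonL : IsPoissonProcess P KL Y p.lamL
  measurable_t : ∀ i, Measurable (t i)
  measurable_GW : ∀ j i, Measurable (GW j i)
  measurable_GLW : ∀ k i, Measurable (GLW k i)
  law_t : ∀ i, P.map (t i) = volume.restrict (Set.Icc (0 : ℝ) 1)
  law_GW : ∀ j i, P.map (GW j i) = expMeasure p.mu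
  law_GLW : ∀ k i, P.map (GLW k i) = expMeasure p.mu
  indep_locations : IndepFun (fun ω => (KW ω, fun i => X i ω)) (fun ω => (KL ω, fun k => Y k ω)) P
  indep_marks : iIndepFun
    (fun (m : ℕ ⊕ ((ℕ × ℕ) ⊕ (ℕ × ℕ))) (ω : Ω) =>
      m.elim (fun i => t i ω)
        (fun q => q.elim (fun a => GW a.1 a.2 ω) (fun a => GLW a.1 a.2 ω))) P
  indep_locations_marks : IndepFun
    (fun ω => ((KW ω, fun i => X i ω), (KL ω, fun k => Y k ω)))
    (fun ω => ((fun i => t i ω), (fun a : ℕ × ℕ => GW a.1 a.2 ω),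
      (fun a : ℕ × ℕ => GLW a.1 a.2 ω))) P

namespace Network

variable {Ω : Type*} [MeasurableSpace Ω] {P : Measure Ω} {p : Params} (N : Network P p)

/-- AP number `i` exists in the configuration. -/
def present (i : ℕ) : Set Ω := {ω | (i : ℕ∞) < N.KW ω}

/-- The event `e_i^W = 1` when LTE transmits continuously: no eNB is received by AP `i` above the
energy detection threshold, and every other AP either has a timer at least that of AP `i`, or is
received by AP `i` at most at the carrier sensing threshold. -/
def transmits (i : ℕ) : Set Ω :=
  {ω | (∀ k : ℕ, (k : ℕ∞) < N.KL ω →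
          N.GLW k i ω / p.pathLoss ‖N.Y k ω - N.X i ω‖ ≤ p.Ged / p.PL) ∧
       (∀ j : ℕ, (j : ℕ∞) < N.KW ω → j ≠ i →
          N.t i ω ≤ N.t j ω ∨
            (N.t j ω < N.t i ω ∧
              N.GW j i ω / p.pathLoss ‖N.X j ω - N.X i ω‖ ≤ p.Gcs / p.PW))}

/-- AP `i` is the tagged AP, i.e. the AP closest to the typical station, which is located at the
origin: no AP lies in the open ball `B^o(0, ‖X i‖)`. -/
def tagged (i : ℕ) : Set Ω :=
  {ω | ∀ j : ℕ, (j : ℕ∞) < N.KW ω → N.X j ω ∉ Metric.ball (0 : Plane) ‖N.X i ω‖}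

/-- The two-point Campbell measure of a property `A i j` of ordered pairs of distinct APs: the
measure of `S ⊆ ℝ² × ℝ²` is the expected number of pairs of distinct APs `i`, `j` with
`(X i, X j) ∈ S` for which `A i j` occurs. The two-point Palm probability of `A` is, by
definition, the density of this measure with respect to the one of the sure property, so the
Palm conditional probability of a property `A` given a property `B` is the density of the measure
of `A ∩ B` with respect to that of `B`. -/
def campbell (A : ℕ → ℕ → Set Ω) : Measure (Plane × Plane) :=
  Measure.sum fun q : {q : ℕ × ℕ // q.1 ≠ q.2} =>
    (P.restrict (N.present q.1.1 ∩ N.present q.1.2 ∩ A q.1.1 q.1.2)).map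
      (fun ω => (N.X q.1.1 ω, N.X q.1.2 ω))

/-- Campbell measure of: the first AP is the tagged one and transmits. -/
def campbellTagged : Measure (Plane × Plane) :=
  N.campbell fun i _ => N.tagged i ∩ N.transmits i

/-- Campbell measure of: the first AP is the tagged one and transmits, and the second AP
transmits, too. -/
def campbellBoth : Measure (Plane × Plane) :=
  N.campbell fun i j => N.tagged i ∩ N.transmits i ∩ N.transmits j

end Network

end Coexistence

end

/-! ### Factorial moments of Poisson counts -/

namespace Coexistence

open scoped ENNReal

/-! Both Campbell measures have explicit densities with respect to Lebesgue measure on pairs of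
locations, and `hAt` is the quotient of these densities.

Fix the locations of two APs and their marks: the timers s, u and the two fadings between them. Call
any other point bad if it contradicts the event under consideration: a Wi-Fi point closer to the
origin than the first AP, or a point of either network that silences the first AP (for C: or the
second one). The event then says that the two APs form a good pair (they do not silence each other
as far as required, and the second is not closer to the origin) and that no point is bad. Given the
pair, other points are bad independently of each other, so the bad points should form a Poisson
process, and the event should have conditional probability exp(-m), with m the mean number of bad
points.

To obtain this from counts in Borel sets alone, the factorial moment measures of the superposed
networks are shown to be powers of the intensity measure (`Network.momentMeasure_eq_pi`): on
products of dyadic cells they are products of Poisson factorial moments, and such products form a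
generating π-system. Independence of the marks (`Network.lintegral_marks`) then gives the expected
number of pairs together with n distinct bad points as λ_W² ∫ mⁿ. Inclusion and exclusion, written
without subtraction as "even sum = void indicator + odd sum", turns these moments into λ_W² ∫
exp(-m), since cosh m = exp(-m) + sinh m (`Network.tsum_measure_pairEvent_inter_badSet_eq_empty`).

It remains to compute m and to integrate over the marks. A Wi-Fi point outside the ball is bad with
probability sρ₁ + uρ₂ - min(s,u)ρ₁ρ₂, where ρ₁ and ρ₂ are the detection probabilities at the two APs
(for D: sρ₁); an LTE point is treated in the same way without the timer factors. Hence for C, m =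
λ_W|B| + 2N^L - C^L_2 + sN^W_2 + uN^W_0 - min(s,u)C^W_1, and for D, m = λ_W|B| + N^L + sN^W_2.
Integrating the timers over the unit square, with the probability that the pair is good, gives V and
U (`Params.pairDensity_true`, `Params.pairDensity_false`). The factor exp(-λ_W|B| - N^L) cancels in
the quotient, which leaves h. This is the second assertion; the first follows because h is
continuous, D is positive and finite on small balls around the point, and averages of a continuous
function over shrinking balls converge. -/

/-- Colour-respecting injections are the same as families of injections, one for each colour. -/
def colouredInjectionsEquiv {α ι A : Type*} (c : α → A) (J : A → Set ι)
    (hJ : Pairwise fun a b => Disjoint (J a) (J b)) :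
    {f : α → ι | Function.Injective f ∧ ∀ k, f k ∈ J (c k)} ≃ ∀ a, {k // c k = a} ↪ J a where
  toFun f a := ⟨fun k => ⟨f.1 k.1, by have := f.2.2 k.1; rwa [k.2] at this⟩, fun _ _ h =>
    Subtype.ext (f.2.1 (congrArg Subtype.val h))⟩
  invFun g := ⟨fun k => g (c k) ⟨k, rfl⟩, by
    refine ⟨fun k l h => ?_, fun k => (g (c k) ⟨k, rfl⟩).2⟩
    have hc : c k = c l := by
      by_contra hne
      have h1 := (g (c k) ⟨k, rfl⟩).2
      have h2 := (g (c l) ⟨l, rfl⟩).2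
      dsimp only at h
      rw [h] at h1
      exact Set.disjoint_left.1 (hJ hne) h1 h2
    -- The embedding `g a` has a type depending on the colour, so both indices are first transported
    -- to one common colour.
    have key : ∀ (a : A) (hk : c k = a) (hl : c l = a),
        ((g a ⟨k, hk⟩ : J a) : ι) = g a ⟨l, hl⟩ → k = l := fun a hk hl h' =>
      congrArg Subtype.val ((g a).injective (Subtype.ext h'))
    refine key (c l) hc rfl ?_
    rw [← show ((g (c k) ⟨k, rfl⟩ : J (c k)) : ι) = g (c l) ⟨l, rfl⟩ from h]
    have tr : ∀ (a : A) (hk : c k = a),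
        ((g a ⟨k, hk⟩ : J a) : ι) = g (c k) ⟨k, rfl⟩ := by
      rintro a rfl; rfl
    exact tr _ hc⟩
  left_inv f := rfl
  right_inv g := by
    funext a
    ext ⟨k, hk⟩
    subst hk
    rfl

/-- Counts tuples of distinct points with prescribed cells. The descending factorials are what
connects this count with Poisson factorial moments. -/
theorem encard_colouredInjections {α ι A : Type*} [Fintype α] [Fintype A] [DecidableEq A]
    (c : α → A) (J : A → Set ι) (hJ : Pairwise fun a b => Disjoint (J a) (J b))
    (hfin : ∀ a, (J a).Finite) :
    Set.encard {f : α → ι | Function.Injective f ∧ ∀ k, f k ∈ J (c k)} =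
      ((∏ a, (J a).ncard.descFactorial (Fintype.card {k // c k = a}) : ℕ) : ℕ∞) := by
  classical
  have : ∀ a, Fintype (J a) := fun a => (hfin a).fintype
  rw [Set.encard, ENat.card_congr (colouredInjectionsEquiv c J hJ), ENat.card_eq_coe_fintype_card,
    Fintype.card_pi]
  congr 1
  refine Finset.prod_congr rfl fun a _ => ?_
  rw [Fintype.card_embedding_eq, Set.ncard_eq_toFinset_card', Set.toFinset_card]

/-- Factorial moments of the Poisson distribution. -/
theorem tsum_descFactorial_mul_poisson {r : ℝ} (hr : 0 ≤ r) (m : ℕ) :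
    ∑' n : ℕ, (n.descFactorial m : ℝ≥0∞) *
      ENNReal.ofReal (Real.exp (-r) * r ^ n / (n.factorial : ℝ)) = ENNReal.ofReal r ^ m := by
  have h1 : ∀ n : ℕ, (((n + m).descFactorial m : ℕ) : ℝ≥0∞) *
      ENNReal.ofReal (Real.exp (-r) * r ^ (n + m) / ((n + m).factorial : ℝ)) =
      ENNReal.ofReal (Real.exp (-r) * r ^ m * (r ^ n / (n.factorial : ℝ))) := fun n => by
    rw [← ENNReal.ofReal_natCast, ← ENNReal.ofReal_mul (by positivity)]
    congr 1
    have := Nat.factorial_mul_descFactorial (Nat.le_add_left m n)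
    rw [Nat.add_sub_cancel] at this
    rw [← this]
    have h2 : (n.factorial : ℝ) ≠ 0 := by positivity
    have h3 : ((n + m).descFactorial m : ℝ) ≠ 0 := by
      exact_mod_cast (Nat.descFactorial_pos.2 (Nat.le_add_left m n)).ne'
    push_cast
    field_simp
    ring
  -- The terms with n < m vanish; after the shift by m, the descending factorial cancels against the
  -- factorial and an exponential series remains.
  rw [← ENNReal.summable.sum_add_tsum_nat_add' (k := m), Finset.sum_eq_zero, zero_add]
  · simp_rw [h1]
    rw [← ENNReal.ofReal_tsum_of_nonneg (fun n => by positivity)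
      ((Real.summable_pow_div_factorial r).mul_left _), tsum_mul_left,
      (NormedSpace.expSeries_div_hasSum_exp r).tsum_eq, ← Real.exp_eq_exp_ℝ, mul_right_comm, ← Real.exp_add,
      neg_add_cancel, Real.exp_zero, one_mul, ENNReal.ofReal_pow hr]
  · intro n hn
    rw [Nat.descFactorial_of_lt (Finset.mem_range.1 hn)]
    simp

section PoissonCount

variable {Ω : Type*} [MeasurableSpace Ω] {P : Measure Ω} [IsProbabilityMeasure P]
  {N : Ω → ℕ∞} {r : ℝ}

/-- The probabilities of the finite values already sum to one: this is the factorial moment of order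
zero. -/
theorem ae_ne_top_of_poisson (hN : Measurable N) (hr : 0 ≤ r)
    (h : ∀ n : ℕ, P {ω | N ω = n} =
      ENNReal.ofReal (Real.exp (-r) * r ^ n / (n.factorial : ℝ))) : ∀ᵐ ω ∂P, N ω ≠ ⊤ := by
  have hm : MeasurableSet {ω | N ω ≠ ⊤} := hN (MeasurableSet.of_discrete (s := {n : ℕ∞ | n ≠ ⊤}))
  refine (prob_compl_eq_zero_iff hm).2 ?_
  have : {ω | N ω ≠ ⊤} = ⋃ n : ℕ, {ω | N ω = n} := by
    ext ω
    simp [ENat.ne_top_iff_exists, eq_comm]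
  rw [this, measure_iUnion]
  · simp_rw [h]
    simpa using tsum_descFactorial_mul_poisson hr 0
  · intro a b hab
    refine Set.disjoint_left.2 fun ω h1 h2 => hab ?_
    exact_mod_cast (show (a : ℕ∞) = b from (Eq.symm h1).trans h2)
  · exact fun n => hN (measurableSet_singleton (n : ℕ∞))

theorem lintegral_descFactorial_of_poisson (hN : Measurable N) (hr : 0 ≤ r)
    (h : ∀ n : ℕ, P {ω | N ω = n} =
      ENNReal.ofReal (Real.exp (-r) * r ^ n / (n.factorial : ℝ))) (m : ℕ) :
    ∫⁻ ω, ((N ω).toNat.descFactorial m : ℝ≥0∞) ∂P = ENNReal.ofReal r ^ m := by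
  have hT : Measurable fun ω => (N ω).toNat := Measurable.of_discrete.comp hN
  rw [← lintegral_map (μ := P) (g := fun ω => (N ω).toNat)
    (f := fun n : ℕ => (n.descFactorial m : ℝ≥0∞)) Measurable.of_discrete hT, lintegral_countable',
    ← tsum_descFactorial_mul_poisson hr m]
  refine tsum_congr fun n => ?_
  rw [Measure.map_apply hT (measurableSet_singleton _), ← h n]
  congr 1
  refine measure_congr ?_
  filter_upwards [ae_ne_top_of_poisson hN hr h] with ω hω
  refine propext ⟨fun h' => ?_, fun h' => ?_⟩
  · exact (show (N ω).toNat = n from h') ▸ (ENat.natCast_toNat hω).symm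
  · show (N ω).toNat = n
    rw [show N ω = n from h', ENat.toNat_natCast]

end PoissonCount

theorem measurable_numPoints {Ω : Type*} [MeasurableSpace Ω] {K : Ω → ℕ∞} {X : ℕ → Ω → Plane}
    (hK : Measurable K) (hX : ∀ i, Measurable (X i)) {A : Set Plane} (hA : MeasurableSet A) :
    Measurable fun ω => numPoints (K ω) (fun i => X i ω) A := by
  refine measurable_encard.comp (measurable_set_iff.2 fun i => ?_)
  refine measurable_to_prop ?_
  simp only [Set.preimage_singleton_true]
  exact (hK (MeasurableSet.of_discrete (s := {n : ℕ∞ | (i : ℕ∞) < n}))).inter (hX i hA)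

/-- Joint factorial moments of a Poisson process. -/
theorem IsPoissonProcess.lintegral_prod_descFactorial {Ω : Type*} [MeasurableSpace Ω]
    {P : Measure Ω} [IsProbabilityMeasure P] {K : Ω → ℕ∞} {X : ℕ → Ω → Plane} {lam : ℝ}
    (h : IsPoissonProcess P K X lam) (hlam : 0 ≤ lam) {A : Type*} [Fintype A]
    (S : A → Set Plane) (hS : ∀ a, MeasurableSet (S a)) (hv : ∀ a, volume (S a) ≠ ∞)
    (hd : Pairwise fun a b => Disjoint (S a) (S b)) (m : A → ℕ) :
    ∫⁻ ω, ∏ a, ((numPoints (K ω) (fun i => X i ω) (S a)).toNat.descFactorial (m a) : ℝ≥0∞) ∂P =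
      ∏ a, (ENNReal.ofReal lam * volume (S a)) ^ m a := by
  have hN : ∀ a, Measurable fun ω => numPoints (K ω) (fun i => X i ω) (S a) := fun a =>
    measurable_numPoints h.measurable_count h.measurable_point (hS a)
  let e := Fintype.equivFin A
  have hind : iIndepFun (fun a ω => numPoints (K ω) (fun i => X i ω) (S a)) P := by
    have h0 := h.indep (Fintype.card A) (fun k => S (e.symm k)) (fun k => hS _)
      (fun a b hab => hd (e.symm.injective.ne hab))
    have h1 := h0.precomp e.injective
    simpa [Function.comp_def] using h1
  have hind2 := hind.comp (fun a (n : ℕ∞) => (n.toNat.descFactorial (m a) : ℝ≥0∞))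
    (fun a => Measurable.of_discrete)
  have := lintegral_prod_eq_prod_lintegral_of_indepFun Finset.univ _ hind2
    (fun a => Measurable.of_discrete.comp (hN a))
  refine this.trans (Finset.prod_congr rfl fun a _ => ?_)
  have := lintegral_descFactorial_of_poisson (hN a) (by positivity) (h.poisson (S a) (hS a) (hv a))
    (m a)
  refine this.trans ?_
  rw [ENNReal.ofReal_mul hlam, Measure.real, ENNReal.ofReal_toReal (hv a)]

theorem IsPoissonProcess.ae_numPoints_ne_top {Ω : Type*} [MeasurableSpace Ω]
    {P : Measure Ω} [IsProbabilityMeasure P] {K : Ω → ℕ∞} {X : ℕ → Ω → Plane} {lam : ℝ}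
    (h : IsPoissonProcess P K X lam) (hlam : 0 ≤ lam)
    {S : Set Plane} (hS : MeasurableSet S) (hv : volume S ≠ ∞) :
    ∀ᵐ ω ∂P, numPoints (K ω) (fun i => X i ω) S ≠ ⊤ :=
  ae_ne_top_of_poisson (measurable_numPoints h.measurable_count h.measurable_point hS)
    (by positivity) (h.poisson S hS hv)

/-! ### Dyadic squares -/

/-- The dyadic square of side `2⁻ᵐ` containing a point. -/
noncomputable def dyadic (m : ℕ) (z : Plane) : ℤ × ℤ := (⌊(2 : ℝ) ^ m * z 0⌋, ⌊(2 : ℝ) ^ m * z 1⌋)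

theorem measurable_dyadic (m : ℕ) : Measurable (dyadic m) := by
  unfold dyadic; fun_prop

/-- The coarse index is the integer quotient of the fine index by a power of two, so finer cells
refine coarser ones. -/
theorem dyadic_eq_of_le {m n : ℕ} (hmn : m ≤ n) {x y : Plane} (h : dyadic n x = dyadic n y) :
    dyadic m x = dyadic m y := by
  obtain ⟨k, rfl⟩ := Nat.exists_eq_add_of_le hmn
  have key : ∀ a : ℝ, ⌊(2 : ℝ) ^ m * a⌋ = ⌊(2 : ℝ) ^ (m + k) * a⌋ / ((2 ^ k : ℕ) : ℤ) := fun a => by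
    rw [← Int.natCast_mul_floor_div_cancel (n := 2 ^ k) (by positivity) ((2 : ℝ) ^ m * a)]
    congr 2
    push_cast
    ring
  simp only [dyadic, Prod.mk.injEq] at h ⊢
  simp only [key, h, and_self]

theorem volume_dyadic_ne_top (m : ℕ) (c : ℤ × ℤ) : volume (dyadic m ⁻¹' {c}) ≠ ∞ := by
  have hb : dyadic m ⁻¹' {c} ⊆ Metric.closedBall 0 ((|(c.1 : ℝ)| + 1) + (|(c.2 : ℝ)| + 1)) := by
    rintro z rfl
    rw [mem_closedBall_zero_iff, EuclideanSpace.norm_eq, Fin.sum_univ_two]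
    have key : ∀ a : ℝ, ‖a‖ ≤ |(⌊(2 : ℝ) ^ m * a⌋ : ℝ)| + 1 := fun a => by
      have h2 : (1 : ℝ) ≤ 2 ^ m := one_le_pow₀ (by norm_num)
      have h3 : |a| ≤ |(2 : ℝ) ^ m * a| := by
        rw [abs_mul, abs_of_pos (by positivity : (0 : ℝ) < 2 ^ m)]
        exact le_mul_of_one_le_left (abs_nonneg a) h2
      have h4 := Int.floor_le ((2 : ℝ) ^ m * a)
      have h5 := (Int.lt_floor_add_one ((2 : ℝ) ^ m * a)).le
      rw [Real.norm_eq_abs]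
      refine h3.trans ?_
      rw [abs_le]
      constructor
      · linarith [neg_abs_le (⌊(2 : ℝ) ^ m * a⌋ : ℝ)]
      · linarith [le_abs_self (⌊(2 : ℝ) ^ m * a⌋ : ℝ)]
    refine Real.sqrt_le_iff.2 ⟨by positivity, ?_⟩
    have h0 := key (z 0)
    have h1 := key (z 1)
    simp only [dyadic]
    nlinarith [norm_nonneg (z 0), norm_nonneg (z 1), mul_nonneg (norm_nonneg (z 0)) (norm_nonneg (z 1)),
      mul_le_mul h0 h1 (norm_nonneg _) (by positivity), mul_le_mul h0 h0 (norm_nonneg _) (by positivity),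
      mul_le_mul h1 h1 (norm_nonneg _) (by positivity)]
  exact ((measure_mono hb).trans_lt measure_closedBall_lt_top).ne

theorem tendsto_floor_two_pow_mul_div (a : ℝ) :
    Tendsto (fun m : ℕ => (⌊(2 : ℝ) ^ m * a⌋ : ℝ) / 2 ^ m) atTop (𝓝 a) := by
  have h1 : Tendsto (fun m : ℕ => a - ((1 : ℝ) / 2) ^ m) atTop (𝓝 (a - 0)) :=
    tendsto_const_nhds.sub (tendsto_pow_atTop_nhds_zero_of_lt_one (by norm_num) (by norm_num))
  rw [sub_zero] at h1
  refine tendsto_of_tendsto_of_tendsto_of_le_of_le h1 tendsto_const_nhds (fun m => ?_) (fun m => ?_)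
  · have h2 : (0 : ℝ) < 2 ^ m := by positivity
    simp only []
    rw [le_div_iff₀ h2, sub_mul, ← mul_pow]
    norm_num
    linarith [(Int.lt_floor_add_one ((2 : ℝ) ^ m * a)).le]
  · have h2 : (0 : ℝ) < 2 ^ m := by positivity
    simp only []
    rw [div_le_iff₀ h2, mul_comm a]
    exact Int.floor_le _

/-- The dyadic squares generate the Borel sets. -/
theorem measurable_of_measurable_dyadic {α : Type*} [MeasurableSpace α] {f : α → Plane}
    (h : ∀ m, Measurable fun a => dyadic m (f a)) : Measurable f := by
  have hc : ∀ i : Fin 2, Measurable fun a => f a i := by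
    intro i
    refine measurable_of_tendsto_metrizable
      (f := fun (m : ℕ) a => (⌊(2 : ℝ) ^ m * f a i⌋ : ℝ) / 2 ^ m) (fun m => ?_)
      (tendsto_pi_nhds.2 fun a => tendsto_floor_two_pow_mul_div (f a i))
    have h' := h m
    have h0 : Measurable fun a => ⌊(2 : ℝ) ^ m * f a i⌋ := by
      fin_cases i
      · exact measurable_fst.comp h'
      · exact measurable_snd.comp h'
    exact ((Measurable.of_discrete (f := fun n : ℤ => (n : ℝ))).comp h0).div_const _
  have := (MeasurableEquiv.toLp 2 (Fin 2 → ℝ)).measurable.comp (measurable_pi_lambda _ hc)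
  exact this

end Coexistence

/-! ### Factorial moment measures of the superposed networks -/

namespace Coexistence

open scoped ENNReal

/-- The intensity measure of the superposition of both networks; `true` marks Wi-Fi. -/
noncomputable def Params.intensity (p : Params) : Measure (Plane × Bool) :=
  (volume : Measure Plane).prod (ENNReal.ofReal p.lamW • Measure.dirac true
    + ENNReal.ofReal p.lamL • Measure.dirac false)

/-- The dyadic cell and the type of a point. -/
noncomputable def colour (m : ℕ) (z : Plane × Bool) : (ℤ × ℤ) × Bool := (dyadic m z.1, z.2)

theorem measurable_colour (m : ℕ) : Measurable (colour m) :=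
  ((measurable_dyadic m).comp measurable_fst).prodMk measurable_snd

theorem colour_eq_of_le {m n : ℕ} (hmn : m ≤ n) {x y : Plane × Bool}
    (h : colour n x = colour n y) : colour m x = colour m y := by
  simp only [colour, Prod.mk.injEq] at h ⊢
  exact ⟨dyadic_eq_of_le hmn h.1, h.2⟩

theorem Params.lintegral_intensity (p : Params) {f : Plane × Bool → ℝ≥0∞} (hf : Measurable f) :
    ∫⁻ z, f z ∂p.intensity = ENNReal.ofReal p.lamW * (∫⁻ x, f (x, true))
      + ENNReal.ofReal p.lamL * (∫⁻ x, f (x, false)) := by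
  rw [Params.intensity, lintegral_prod_symm' _ hf, lintegral_add_measure, lintegral_smul_measure,
    lintegral_smul_measure, lintegral_dirac, lintegral_dirac, smul_eq_mul, smul_eq_mul]

instance (p : Params) : SigmaFinite p.intensity := by
  have : IsFiniteMeasure (ENNReal.ofReal p.lamW • Measure.dirac true
      + ENNReal.ofReal p.lamL • Measure.dirac false) := ⟨by simp⟩
  unfold Params.intensity
  infer_instance

theorem Params.intensity_colour (p : Params) (m : ℕ) (c : (ℤ × ℤ) × Bool) :
    p.intensity (colour m ⁻¹' {c}) =
      ENNReal.ofReal (if c.2 then p.lamW else p.lamL) * volume (dyadic m ⁻¹' {c.1}) := by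
  have : colour m ⁻¹' {c} = (dyadic m ⁻¹' {c.1}) ×ˢ {c.2} := by
    ext z; simp [colour, Prod.ext_iff]
  rw [this, Params.intensity, Measure.prod_prod, mul_comm]
  rcases c with ⟨c, b⟩
  cases b <;> simp

/-- The boxes of dyadic cells of one level. -/
def box {α : Type*} (m : ℕ) (c : α → (ℤ × ℤ) × Bool) : Set (α → Plane × Bool) :=
  {z | ∀ k, colour m (z k) = c k}

theorem box_eq_pi {α : Type*} (m : ℕ) (c : α → (ℤ × ℤ) × Bool) :
    box m c = Set.univ.pi fun k => colour m ⁻¹' {c k} := by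
  ext z; simp [box]

theorem measurableSet_box {α : Type*} [Countable α] (m : ℕ) (c : α → (ℤ × ℤ) × Bool) :
    MeasurableSet (box m c) := by
  rw [box_eq_pi]
  exact MeasurableSet.univ_pi fun k => measurable_colour m (measurableSet_singleton _)

/-- Two boxes that meet are nested, because the finer colour determines the coarser one. -/
theorem isPiSystem_box (α : Type*) :
    IsPiSystem {s | ∃ m, ∃ c : α → (ℤ × ℤ) × Bool, s = box m c} := by
  have key : ∀ (m n : ℕ) (c d : α → (ℤ × ℤ) × Bool), m ≤ n → (box m c ∩ box n d).Nonempty →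
      box m c ∩ box n d = box n d := by
    rintro m n c d hmn ⟨z, hz1, hz2⟩
    refine Set.inter_eq_right.2 fun y hy k => ?_
    rw [← hz1 k]
    exact colour_eq_of_le hmn ((hy k).trans (hz2 k).symm)
  rintro _ ⟨m, c, rfl⟩ _ ⟨n, d, rfl⟩ hne
  rcases le_total m n with h | h
  · exact ⟨n, d, key m n c d h hne⟩
  · rw [Set.inter_comm] at hne ⊢
    exact ⟨m, c, key n m d c h hne⟩

theorem generateFrom_box (α : Type*) [Finite α] :
    (inferInstance : MeasurableSpace (α → Plane × Bool)) =
      MeasurableSpace.generateFrom {s | ∃ m, ∃ c : α → (ℤ × ℤ) × Bool, s = box m c} := by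
  refine le_antisymm ?_ (MeasurableSpace.generateFrom_le ?_)
  · set G := MeasurableSpace.generateFrom {s | ∃ m, ∃ c : α → (ℤ × ℤ) × Bool, s = box m c} with hG
    have hcol : ∀ m (k : α), Measurable[G] fun z : α → Plane × Bool => colour m (z k) := by
      intro m k
      refine @measurable_to_countable' _ _ _ _ G _ fun c => ?_
      -- Prescribing the colour of one coordinate leaves countably many choices of colours for the
      -- others, hence a countable union of boxes.
      have : (fun z : α → Plane × Bool => colour m (z k)) ⁻¹' {c} =
          ⋃ d : {d : α → (ℤ × ℤ) × Bool // d k = c}, box m d.1 := by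
        ext z
        simp only [Set.mem_preimage, Set.mem_singleton_iff, Set.mem_iUnion, box, Set.mem_ofPred_eq]
        constructor
        · intro h
          exact ⟨⟨fun l => colour m (z l), h⟩, fun l => rfl⟩
        · rintro ⟨d, hd⟩
          rw [hd k, d.2]
      rw [this]
      exact MeasurableSet.iUnion fun d => MeasurableSpace.measurableSet_generateFrom ⟨m, d.1, rfl⟩
    have hid : @Measurable _ _ G MeasurableSpace.pi (id : (α → Plane × Bool) → α → Plane × Bool) := by
      refine @measurable_pi_lambda _ _ _ G _ _ fun k => ?_
      have h1 : Measurable[G] fun z : α → Plane × Bool => (z k).1 :=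
        @measurable_of_measurable_dyadic _ G _ fun m => measurable_fst.comp (hcol m k)
      have h2 : Measurable[G] fun z : α → Plane × Bool => (z k).2 := (measurable_snd (α := ℤ × ℤ)).comp (hcol 0 k)
      exact h1.prodMk h2
    exact fun s hs => hid hs
  · rintro _ ⟨m, c, rfl⟩
    exact measurableSet_box m c

namespace Network

variable {Ω : Type*} [MeasurableSpace Ω] {P : Measure Ω} {p : Params} (N : Network P p)

/-- The point with the given index, of the given type (`true` for Wi-Fi), exists. -/
def here (κ : ℕ × Bool) : Set Ω := {ω | (κ.1 : ℕ∞) < if κ.2 then N.KW ω else N.KL ω}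

/-- The location and the type of a point of either network. -/
def loc (κ : ℕ × Bool) (ω : Ω) : Plane × Bool := (if κ.2 then N.X κ.1 ω else N.Y κ.1 ω, κ.2)

theorem measurableSet_here (κ : ℕ × Bool) : MeasurableSet (N.here κ) := by
  rcases κ with ⟨i, b⟩
  cases b
  · exact N.poissonL.measurable_count (MeasurableSet.of_discrete (s := {n : ℕ∞ | (i : ℕ∞) < n}))
  · exact N.poissonW.measurable_count (MeasurableSet.of_discrete (s := {n : ℕ∞ | (i : ℕ∞) < n}))

theorem measurable_loc (κ : ℕ × Bool) : Measurable (N.loc κ) := by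
  rcases κ with ⟨i, b⟩
  cases b
  · exact (N.poissonL.measurable_point i).prodMk measurable_const
  · exact (N.poissonW.measurable_point i).prodMk measurable_const

/-- The factorial moment measure of the superposition of both networks. -/
noncomputable def momentMeasure (α : Type*) : Measure (α → Plane × Bool) :=
  Measure.sum fun f : α → ℕ × Bool =>
    (P.restrict {ω | Function.Injective f ∧ ∀ k, ω ∈ N.here (f k)}).map fun ω k => N.loc (f k) ω

theorem measurableSet_injective_here {α : Type*} [Countable α] (f : α → ℕ × Bool) :
    MeasurableSet {ω | Function.Injective f ∧ ∀ k, ω ∈ N.here (f k)} := by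
  rw [show {ω | Function.Injective f ∧ ∀ k, ω ∈ N.here (f k)} =
    {_ω | Function.Injective f} ∩ ⋂ k, N.here (f k) by ext; simp]
  exact (MeasurableSet.const _).inter (MeasurableSet.iInter fun k => N.measurableSet_here (f k))

/-- The existing points of a given colour. -/
def coloured (m : ℕ) (ω : Ω) (c : (ℤ × ℤ) × Bool) : Set (ℕ × Bool) :=
  {κ | ω ∈ N.here κ ∧ colour m (N.loc κ ω) = c}

/-- The number of points of a given colour. -/
noncomputable def colourCount (m : ℕ) (c : (ℤ × ℤ) × Bool) (ω : Ω) : ℕ∞ :=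
  if c.2 then numPoints (N.KW ω) (fun i => N.X i ω) (dyadic m ⁻¹' {c.1})
  else numPoints (N.KL ω) (fun i => N.Y i ω) (dyadic m ⁻¹' {c.1})

theorem encard_coloured (m : ℕ) (ω : Ω) (c : (ℤ × ℤ) × Bool) :
    (N.coloured m ω c).encard = N.colourCount m c ω := by
  have hinj : ∀ b : Bool, Function.Injective fun i : ℕ => (i, b) := fun b i j h =>
    congrArg Prod.fst h
  rcases c with ⟨c, b⟩
  cases b
  · simp only [colourCount, Bool.false_eq_true, if_false, numPoints]
    rw [← (hinj false).encard_image]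
    congr 1
    ext ⟨i, b⟩
    simp only [coloured, here, loc, colour, Set.mem_ofPred_eq, Set.mem_image, Prod.mk.injEq,
      Set.mem_preimage, Set.mem_singleton_iff]
    aesop
  · simp only [colourCount, if_true, numPoints]
    rw [← (hinj true).encard_image]
    congr 1
    ext ⟨i, b⟩
    simp only [coloured, here, loc, colour, Set.mem_ofPred_eq, Set.mem_image, Prod.mk.injEq,
      Set.mem_preimage, Set.mem_singleton_iff]
    aesop

variable [IsProbabilityMeasure P]

theorem ae_colourCount_ne_top (m : ℕ) (c : (ℤ × ℤ) × Bool) :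
    ∀ᵐ ω ∂P, N.colourCount m c ω ≠ ⊤ := by
  have hm := measurable_dyadic m (measurableSet_singleton c.1)
  rcases c with ⟨c, b⟩
  cases b
  · exact N.poissonL.ae_numPoints_ne_top p.lamL_nonneg hm (volume_dyadic_ne_top m c)
  · exact N.poissonW.ae_numPoints_ne_top p.lamW_pos.le hm (volume_dyadic_ne_top m c)

/-- Independence of the two networks splits the expectation into a Wi-Fi and an LTE factor; within
each, counts in distinct cells are independent Poisson variables. -/
theorem lintegral_prod_colourCount {A : Type*} [Fintype A] (m : ℕ) (s : A → ℤ × ℤ)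
    (hs : Function.Injective s) (d : A × Bool → ℕ) :
    ∫⁻ ω, ∏ a : A × Bool,
        ((N.colourCount m (s a.1, a.2) ω).toNat.descFactorial (d a) : ℝ≥0∞) ∂P =
      ∏ a : A × Bool, p.intensity (colour m ⁻¹' {(s a.1, a.2)}) ^ d a := by
  have hm : ∀ a, MeasurableSet (dyadic m ⁻¹' {s a}) := fun a =>
    measurable_dyadic m (measurableSet_singleton _)
  have hd : Pairwise fun a b => Disjoint (dyadic m ⁻¹' {s a}) (dyadic m ⁻¹' {s b}) :=
    fun a b hab => (Set.disjoint_singleton.2 (hs.ne hab)).preimage _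
  have hv := fun a => volume_dyadic_ne_top m (s a)
  let g : Bool → ℕ∞ × (ℕ → Plane) → ℝ≥0∞ := fun b y =>
    ∏ a, ((numPoints y.1 (fun i => y.2 i) (dyadic m ⁻¹' {s a})).toNat.descFactorial (d (a, b)) :
      ℝ≥0∞)
  have hg : ∀ b, Measurable (g b) := fun b => Finset.measurable_fun_prod _ fun a _ =>
    (Measurable.of_discrete (f := fun n : ℕ∞ => (n.toNat.descFactorial (d (a, b)) : ℝ≥0∞))).comp
      (measurable_numPoints measurable_fst (fun i => (measurable_pi_apply i).comp measurable_snd)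
        (hm a))
  have hW : Measurable fun ω => (N.KW ω, fun i => N.X i ω) :=
    N.poissonW.measurable_count.prodMk (measurable_pi_lambda _ N.poissonW.measurable_point)
  have hL : Measurable fun ω => (N.KL ω, fun i => N.Y i ω) :=
    N.poissonL.measurable_count.prodMk (measurable_pi_lambda _ N.poissonL.measurable_point)
  have hind := N.indep_locations.comp (hg true) (hg false)
  have hmul := lintegral_mul_eq_lintegral_mul_lintegral_of_indepFun
    ((hg true).comp hW) ((hg false).comp hL) hind
  have h1 := N.poissonW.lintegral_prod_descFactorial p.lamW_pos.le _ hm hv hd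
    fun a => d (a, true)
  have h2 := N.poissonL.lintegral_prod_descFactorial p.lamL_nonneg _ hm hv hd
    fun a => d (a, false)
  simp only [Fintype.prod_prod_type, Fintype.prod_bool, Finset.prod_mul_distrib]
  simp only [colourCount, if_true, Bool.false_eq_true, if_false, Params.intensity_colour]
  rw [← h1, ← h2]
  exact hmul

/-- The factorial moment measures of a Poisson process are the powers of its intensity measure. -/
theorem momentMeasure_eq_pi (α : Type*) [Fintype α] :
    N.momentMeasure α = Measure.pi fun _ => p.intensity := by
  classical
  have hbox : ∀ m (c : α → (ℤ × ℤ) × Bool), (Measure.pi fun _ => p.intensity) (box m c) =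
      ∏ k, p.intensity (colour m ⁻¹' {c k}) := fun m c => by rw [box_eq_pi, Measure.pi_pi]
  have heq : ∀ m (c : α → (ℤ × ℤ) × Bool), N.momentMeasure α (box m c) =
      ∏ k, p.intensity (colour m ⁻¹' {c k}) := by
    intro m c
    have hset : ∀ f : α → ℕ × Bool, MeasurableSet {ω | Function.Injective f ∧
        ∀ k, f k ∈ N.coloured m ω (c k)} := fun f => by
      rw [show {ω | Function.Injective f ∧ ∀ k, f k ∈ N.coloured m ω (c k)} =
        {_ω | Function.Injective f} ∩ ⋂ k, (N.here (f k) ∩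
          (fun ω => colour m (N.loc (f k) ω)) ⁻¹' {c k}) by ext; simp [coloured]]
      exact (MeasurableSet.const _).inter (MeasurableSet.iInter fun k =>
        (N.measurableSet_here (f k)).inter
        ((measurable_colour m).comp (N.measurable_loc (f k)) (measurableSet_singleton (c k))))
    -- The moment measure of a box is the expected number of injective index tuples with the
    -- prescribed colours.
    have h1 : N.momentMeasure α (box m c) = ∫⁻ ω, ({f : α → ℕ × Bool | Function.Injective f ∧
        ∀ k, f k ∈ N.coloured m ω (c k)}.encard : ℝ≥0∞) ∂P := by
      rw [momentMeasure, Measure.sum_apply _ (measurableSet_box m c)]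
      have key : ∀ ω, ({f : α → ℕ × Bool | Function.Injective f ∧
          ∀ k, f k ∈ N.coloured m ω (c k)}.encard : ℝ≥0∞) =
          ∑' f, Set.indicator {f : α → ℕ × Bool | Function.Injective f ∧
          ∀ k, f k ∈ N.coloured m ω (c k)} (fun _ => (1 : ℝ≥0∞)) f := fun ω => by
        rw [← ENNReal.tsum_set_one, ← tsum_subtype]
      simp only [key]
      rw [lintegral_tsum]
      · refine tsum_congr fun f => ?_
        rw [Measure.map_apply (measurable_pi_lambda _ fun k => N.measurable_loc _)
          (measurableSet_box m c), Measure.restrict_apply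
          ((measurable_pi_lambda _ fun k => N.measurable_loc _) (measurableSet_box m c))]
        rw [show (fun ω => Set.indicator {f : α → ℕ × Bool | Function.Injective f ∧
          ∀ k, f k ∈ N.coloured m ω (c k)} (fun _ => (1 : ℝ≥0∞)) f) =
          Set.indicator {ω | Function.Injective f ∧ ∀ k, f k ∈ N.coloured m ω (c k)} 1 by
            ext ω; simp [Set.indicator]]
        rw [lintegral_indicator_one (hset f)]
        congr 1
        ext ω
        simp only [box, coloured, Set.mem_inter_iff, Set.mem_preimage, Set.mem_ofPred_eq]
        rw [forall_and]
        tauto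
      · intro f
        refine Measurable.aemeasurable ?_
        rw [show (fun ω => Set.indicator {f : α → ℕ × Bool | Function.Injective f ∧
          ∀ k, f k ∈ N.coloured m ω (c k)} (fun _ => (1 : ℝ≥0∞)) f) =
          Set.indicator {ω | Function.Injective f ∧ ∀ k, f k ∈ N.coloured m ω (c k)} 1 by
            ext ω; simp [Set.indicator]]
        exact measurable_one.indicator (hset f)
    -- Only the finitely many cells occurring in `c` matter; recolouring by `T × Bool` makes the set
    -- of colours finite.
    let T : Finset (ℤ × ℤ) := Finset.univ.image fun k => (c k).1
    let c' : α → T × Bool := fun k => (⟨(c k).1, Finset.mem_image_of_mem _ (Finset.mem_univ k)⟩,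
      (c k).2)
    have h2 : ∀ᵐ ω ∂P, ({f : α → ℕ × Bool | Function.Injective f ∧
        ∀ k, f k ∈ N.coloured m ω (c k)}.encard : ℝ≥0∞) = ∏ a : T × Bool,
        ((N.colourCount m (a.1.1, a.2) ω).toNat.descFactorial
          (Fintype.card {k // c' k = a}) : ℝ≥0∞) := by
      have hfin : ∀ᵐ ω ∂P, ∀ a : T × Bool, N.colourCount m (a.1.1, a.2) ω ≠ ⊤ :=
        ae_all_iff.2 fun a => N.ae_colourCount_ne_top m _
      filter_upwards [hfin] with ω hω
      have := encard_colouredInjections c' (fun a => N.coloured m ω (a.1.1, a.2))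
        (fun a b hab => Set.disjoint_left.2 fun κ h1 h2 => hab ?_) (fun a => ?_)
      · rw [show {f : α → ℕ × Bool | Function.Injective f ∧ ∀ k, f k ∈ N.coloured m ω (c k)} =
          {f | Function.Injective f ∧ ∀ k, f k ∈ N.coloured m ω ((c' k).1.1, (c' k).2)} from rfl,
          this]
        simp only [Set.ncard_def, encard_coloured]
        exact_mod_cast rfl
      · have := h1.2.symm.trans h2.2
        simp only [Prod.mk.injEq] at this
        exact Prod.ext (Subtype.ext this.1) this.2
      · rw [← Set.encard_ne_top_iff, encard_coloured]
        exact hω a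
    rw [h1, lintegral_congr_ae h2, N.lintegral_prod_colourCount m _ Subtype.val_injective,
      ← Finset.prod_fiberwise' Finset.univ c' (fun a => p.intensity (colour m ⁻¹' {(a.1.1, a.2)}))]
    refine Finset.prod_congr rfl fun a _ => ?_
    rw [Finset.prod_const, Fintype.card_subtype]
  -- The boxes of level 0 form a countable cover by sets of finite measure, as uniqueness on a
  -- π-system requires.
  refine Measure.ext_of_generateFrom_of_cover_subset (T := Set.range (box (α := α) 0))
    (generateFrom_box α) (isPiSystem_box α) ?_ (Set.countable_range _) ?_ ?_ ?_
  · rintro _ ⟨c, rfl⟩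
    exact ⟨0, c, rfl⟩
  · refine Set.eq_univ_of_forall fun z => ?_
    exact ⟨_, ⟨fun k => colour 0 (z k), rfl⟩, fun k => rfl⟩
  · rintro _ ⟨c, rfl⟩
    rw [heq]
    refine ENNReal.prod_ne_top fun k _ => ?_
    rw [Params.intensity_colour]
    exact ENNReal.mul_ne_top ENNReal.ofReal_ne_top (volume_dyadic_ne_top _ _)
  · rintro _ ⟨m, c, rfl⟩
    rw [heq, hbox]

/-- Campbell's formula for tuples of distinct points. -/
theorem tsum_lintegral_loc {α : Type*} [Fintype α] {F : (α → Plane × Bool) → ℝ≥0∞}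
    (hF : Measurable F) :
    ∑' f : α → ℕ × Bool, ∫⁻ ω in {ω | Function.Injective f ∧ ∀ k, ω ∈ N.here (f k)},
      F (fun k => N.loc (f k) ω) ∂P = ∫⁻ z, F z ∂Measure.pi fun _ => p.intensity := by
  rw [← N.momentMeasure_eq_pi, momentMeasure, lintegral_sum_measure]
  exact tsum_congr fun f =>
    (lintegral_map hF (measurable_pi_lambda _ fun k => N.measurable_loc _)).symm

end Network

end Coexistence

/-! ### Independence and laws of the marks -/

namespace Coexistence

open scoped ENNReal

section Independence

variable {Ω : Type*} [MeasurableSpace Ω] {P : Measure Ω}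

/-- Induction on the finite set of factors: the σ-algebra of the new block is independent of the one
generated by the union of the earlier, disjoint blocks. -/
theorem iIndepFun.of_disjoint {J A β γ : Type*} [MeasurableSpace γ] [MeasurableSpace β]
    [IsProbabilityMeasure P] {f : J → Ω → γ} (hf : iIndepFun f P) (hm : ∀ j, Measurable (f j))
    {S : A → Set J} (hS : Pairwise fun a b => Disjoint (S a) (S b)) {η : A → Ω → β}
    (hη : ∀ a, Measurable[⨆ j ∈ S a, MeasurableSpace.comap (f j) inferInstance] (η a)) :
    iIndepFun η P := by
  classical
  rw [iIndepFun_iff_measure_inter_preimage_eq_mul]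
  intro T
  induction T using Finset.induction_on with
  | empty => intro sets _; simp
  | insert a T ha ih =>
    intro sets hsets
    rw [Finset.set_biInter_insert, Finset.prod_insert ha,
      ← ih fun i hi => hsets i (Finset.mem_insert_of_mem hi)]
    have hind := indep_iSup_of_disjoint (fun j => (hm j).comap_le) hf.iIndep
      (S := S a) (T := ⋃ b ∈ T, S b) (Set.disjoint_iUnion₂_right.2 fun b hb =>
        hS (by rintro rfl; exact ha hb))
    refine (Indep_iff _ _ _).1 hind _ _ (hη a (hsets a (Finset.mem_insert_self _ _))) ?_
    refine MeasurableSet.biInter T.countable_toSet fun b hb => ?_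
    refine (iSup₂_le fun j hj => ?_ : (⨆ j ∈ S b, MeasurableSpace.comap (f j) inferInstance) ≤ _) _
      (hη b (hsets b (Finset.mem_insert_of_mem hb)))
    exact le_iSup₂_of_le j (Set.mem_biUnion hb hj) le_rfl

theorem indepFun_of_disjoint {J β β' γ : Type*} [MeasurableSpace γ] [MeasurableSpace β]
    [MeasurableSpace β'] {f : J → Ω → γ} (hf : iIndepFun f P)
    (hm : ∀ j, Measurable (f j)) {S T : Set J} (hS : Disjoint S T) {η : Ω → β} {ξ : Ω → β'}
    (hη : Measurable[⨆ j ∈ S, MeasurableSpace.comap (f j) inferInstance] η)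
    (hξ : Measurable[⨆ j ∈ T, MeasurableSpace.comap (f j) inferInstance] ξ) :
    IndepFun η ξ P :=
  (IndepFun_iff_Indep _ _ _).2 (indep_of_indep_of_le_left (indep_of_indep_of_le_right
    (indep_iSup_of_disjoint (fun j => (hm j).comap_le) hf.iIndep hS) hξ.comap_le) hη.comap_le)

omit [MeasurableSpace Ω] in
theorem measurable_iSup_comap {J γ : Type*} [MeasurableSpace γ] {f : J → Ω → γ} {S : Set J} {j : J}
    (hj : j ∈ S) : Measurable[⨆ j ∈ S, MeasurableSpace.comap (f j) inferInstance] (f j) :=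
  measurable_iff_comap_le.2 (le_iSup₂_of_le j hj le_rfl)

theorem lintegral_comp_of_indepFun {β γ : Type*} [MeasurableSpace β] [MeasurableSpace γ]
    [IsProbabilityMeasure P] {X : Ω → β} {Y : Ω → γ} (h : IndepFun X Y P) (hX : Measurable X)
    (hY : Measurable Y) {F : β × γ → ℝ≥0∞} (hF : Measurable F) :
    ∫⁻ ω, F (X ω, Y ω) ∂P = ∫⁻ x, ∫⁻ ω, F (x, Y ω) ∂P ∂P.map X := by
  have : IsProbabilityMeasure (P.map Y) := Measure.isProbabilityMeasure_map hY.aemeasurable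
  rw [← lintegral_map hF (hX.prodMk hY),
    (indepFun_iff_map_prod_eq_prod_map_map hX.aemeasurable hY.aemeasurable).1 h,
    lintegral_prod _ hF.aemeasurable]
  refine lintegral_congr fun x => ?_
  exact lintegral_map (f := fun y => F (x, y)) (hF.comp measurable_prodMk_left) hY

/-- Integration of a product whose factors are conditionally independent. -/
theorem lintegral_mul_prod_of_indepFun {A β γ : Type*} [MeasurableSpace β] [MeasurableSpace γ]
    [Fintype A] [IsProbabilityMeasure P] {ξ : Ω → β} {η : A → Ω → γ} (hη : iIndepFun η P)
    (hξη : IndepFun ξ (fun ω a => η a ω) P) (hξm : Measurable ξ) (hηm : ∀ a, Measurable (η a))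
    {G : β → ℝ≥0∞} (hG : Measurable G) {H : A → β × γ → ℝ≥0∞} (hH : ∀ a, Measurable (H a)) :
    ∫⁻ ω, G (ξ ω) * ∏ a, H a (ξ ω, η a ω) ∂P =
      ∫⁻ x, G x * ∏ a, ∫⁻ y, H a (x, y) ∂P.map (η a) ∂P.map ξ := by
  have h1 := lintegral_comp_of_indepFun hξη hξm (measurable_pi_lambda _ hηm)
    (F := fun q => G q.1 * ∏ a, H a (q.1, q.2 a)) ((hG.comp measurable_fst).mul
      (Finset.measurable_fun_prod _ fun a _ => (hH a).comp
        (measurable_fst.prodMk ((measurable_pi_apply a).comp measurable_snd))))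
  refine h1.trans (lintegral_congr fun x => ?_)
  have hHx : ∀ a, Measurable fun y => H a (x, y) := fun a => (hH a).comp measurable_prodMk_left
  have hm : ∀ a, Measurable fun ω => H a (x, η a ω) := fun a => (hHx a).comp (hηm a)
  dsimp only
  rw [lintegral_const_mul _ (Finset.measurable_fun_prod _ fun a _ => hm a)]
  congr 1
  refine (lintegral_prod_eq_prod_lintegral_of_indepFun Finset.univ (fun a ω => H a (x, η a ω))
    (hη.comp (fun a y => H a (x, y)) hHx) hm).trans ?_
  exact Finset.prod_congr rfl fun a _ => (lintegral_map (hHx a) (hηm a)).symm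

end Independence

/-- The marks of two distinguished access points `i` and `j`: their timers, and the fadings from
`j` to `i` and from `i` to `j`. -/
abbrev PairMarks : Type := (ℝ × ℝ) × (ℝ × ℝ)

/-- The marks of another point: its timer, and the fadings from it to `i` and to `j`. -/
abbrev PointMarks : Type := ℝ × (ℝ × ℝ)

/-- The uniform distribution of the timers. -/
noncomputable def timerLaw : Measure ℝ := volume.restrict (Set.Icc (0 : ℝ) 1)

instance : IsProbabilityMeasure timerLaw := ⟨by simp [timerLaw]⟩

namespace Params

variable (p : Params)

instance : IsProbabilityMeasure (expMeasure p.mu) := isProbabilityMeasure_expMeasure p.mu_pos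

/-- The law of the marks of two distinguished access points. -/
noncomputable def pairLaw : Measure PairMarks :=
  (timerLaw.prod timerLaw).prod ((expMeasure p.mu).prod (expMeasure p.mu))

/-- The law of the marks of another point; LTE points have no timer. -/
noncomputable def pointLaw (b : Bool) : Measure PointMarks :=
  (if b then timerLaw else Measure.dirac 0).prod ((expMeasure p.mu).prod (expMeasure p.mu))

instance : IsProbabilityMeasure p.pairLaw := by unfold pairLaw; infer_instance

instance (b : Bool) : IsProbabilityMeasure (p.pointLaw b) := by
  unfold pointLaw; cases b <;> simp <;> infer_instance

end Params

namespace Network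

variable {Ω : Type*} [MeasurableSpace Ω] {P : Measure Ω} {p : Params} (N : Network P p)

/-- All marks as one family. -/
def mark (m : ℕ ⊕ ((ℕ × ℕ) ⊕ (ℕ × ℕ))) (ω : Ω) : ℝ :=
  m.elim (fun i => N.t i ω) (fun q => q.elim (fun a => N.GW a.1 a.2 ω) (fun a => N.GLW a.1 a.2 ω))

theorem measurable_mark (m : ℕ ⊕ ((ℕ × ℕ) ⊕ (ℕ × ℕ))) : Measurable (N.mark m) := by
  rcases m with i | a | a
  · exact N.measurable_t i
  · exact N.measurable_GW a.1 a.2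
  · exact N.measurable_GLW a.1 a.2

theorem iIndepFun_mark : iIndepFun N.mark P := N.indep_marks

/-- The marks of the access points `i` and `j`. -/
def pairMarks (i j : ℕ) (ω : Ω) : PairMarks := ((N.t i ω, N.t j ω), (N.GW j i ω, N.GW i j ω))

/-- The marks of another point with respect to the access points `i` and `j`. -/
def pointMarks (i j : ℕ) (κ : ℕ × Bool) (ω : Ω) : PointMarks :=
  if κ.2 then (N.t κ.1 ω, (N.GW κ.1 i ω, N.GW κ.1 j ω))
  else (0, (N.GLW κ.1 i ω, N.GLW κ.1 j ω))

theorem measurable_pairMarks (i j : ℕ) : Measurable (N.pairMarks i j) :=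
  ((N.measurable_t i).prodMk (N.measurable_t j)).prodMk
    ((N.measurable_GW j i).prodMk (N.measurable_GW i j))

theorem measurable_pointMarks (i j : ℕ) (κ : ℕ × Bool) : Measurable (N.pointMarks i j κ) := by
  rcases κ with ⟨k, b⟩
  cases b
  · exact measurable_const.prodMk ((N.measurable_GLW k i).prodMk (N.measurable_GLW k j))
  · exact (N.measurable_t k).prodMk ((N.measurable_GW k i).prodMk (N.measurable_GW k j))

/-- The indices of the marks of two access points. -/
def pairIndices (i j : ℕ) : Set (ℕ ⊕ ((ℕ × ℕ) ⊕ (ℕ × ℕ))) :=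
  {Sum.inl i, Sum.inl j, Sum.inr (Sum.inl (j, i)), Sum.inr (Sum.inl (i, j))}

/-- The indices of the marks of another point. -/
def pointIndices (i j : ℕ) (κ : ℕ × Bool) : Set (ℕ ⊕ ((ℕ × ℕ) ⊕ (ℕ × ℕ))) :=
  if κ.2 then {Sum.inl κ.1, Sum.inr (Sum.inl (κ.1, i)), Sum.inr (Sum.inl (κ.1, j))}
  else {Sum.inr (Sum.inr (κ.1, i)), Sum.inr (Sum.inr (κ.1, j))}

theorem measurable_pairMarks_iSup (i j : ℕ) :
    Measurable[⨆ m ∈ pairIndices i j, MeasurableSpace.comap (N.mark m) inferInstance]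
      (N.pairMarks i j) := by
  have h : ∀ m ∈ pairIndices i j, Measurable[⨆ m ∈ pairIndices i j,
    MeasurableSpace.comap (N.mark m) inferInstance] (N.mark m) := fun m hm =>
    measurable_iSup_comap hm
  exact ((h (Sum.inl i) (by simp [pairIndices])).prodMk
    (h (Sum.inl j) (by simp [pairIndices]))).prodMk
    ((h (Sum.inr (Sum.inl (j, i))) (by simp [pairIndices])).prodMk
      (h (Sum.inr (Sum.inl (i, j))) (by simp [pairIndices])))

theorem measurable_pointMarks_iSup (i j : ℕ) (κ : ℕ × Bool) :
    Measurable[⨆ m ∈ pointIndices i j κ, MeasurableSpace.comap (N.mark m) inferInstance]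
      (N.pointMarks i j κ) := by
  have h : ∀ m ∈ pointIndices i j κ, Measurable[⨆ m ∈ pointIndices i j κ,
    MeasurableSpace.comap (N.mark m) inferInstance] (N.mark m) := fun m hm =>
    measurable_iSup_comap hm
  rcases κ with ⟨k, b⟩
  cases b
  · exact measurable_const.prodMk ((h (Sum.inr (Sum.inr (k, i))) (by simp [pointIndices])).prodMk
      (h (Sum.inr (Sum.inr (k, j))) (by simp [pointIndices])))
  · exact (h (Sum.inl k) (by simp [pointIndices])).prodMk
      ((h (Sum.inr (Sum.inl (k, i))) (by simp [pointIndices])).prodMk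
      (h (Sum.inr (Sum.inl (k, j))) (by simp [pointIndices])))

/-- Each fading is indexed by its transmitter, so distinct points contribute distinct marks even
with respect to the same receivers `i` and `j`. -/
theorem disjoint_pointIndices (i j : ℕ) {κ κ' : ℕ × Bool} (h : κ ≠ κ') :
    Disjoint (pointIndices i j κ) (pointIndices i j κ') := by
  rcases κ with ⟨k, b⟩
  rcases κ' with ⟨k', b'⟩
  rw [Set.disjoint_left]
  cases b <;> cases b' <;> simp [pointIndices] <;> simp_all

theorem disjoint_pairIndices (i j : ℕ) {κ : ℕ × Bool} (hi : κ ≠ (i, true)) (hj : κ ≠ (j, true)) :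
    Disjoint (pairIndices i j) (pointIndices i j κ) := by
  rcases κ with ⟨k, b⟩
  rw [Set.disjoint_left]
  cases b <;> simp [pointIndices, pairIndices] <;> simp_all <;> grind

variable [IsProbabilityMeasure P]

theorem map_pairMarks {i j : ℕ} (hij : i ≠ j) : P.map (N.pairMarks i j) = p.pairLaw := by
  have hm := N.measurable_mark
  have h1 : IndepFun (fun ω => (N.t i ω, N.t j ω)) (fun ω => (N.GW j i ω, N.GW i j ω)) P :=
    N.iIndepFun_mark.indepFun_prodMk_prodMk hm (Sum.inl i) (Sum.inl j)
      (Sum.inr (Sum.inl (j, i))) (Sum.inr (Sum.inl (i, j))) (by simp) (by simp) (by simp) (by simp)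
  have h2 : IndepFun (N.t i) (N.t j) P :=
    N.iIndepFun_mark.indepFun (i := Sum.inl i) (j := Sum.inl j) (by simpa)
  have h3 : IndepFun (N.GW j i) (N.GW i j) P :=
    N.iIndepFun_mark.indepFun (i := Sum.inr (Sum.inl (j, i))) (j := Sum.inr (Sum.inl (i, j)))
      (by simpa using fun h => absurd h.symm hij)
  have e1 := h1.map_prod_eq_prod_map_map ((N.measurable_t i).prodMk (N.measurable_t j)).aemeasurable
    ((N.measurable_GW j i).prodMk (N.measurable_GW i j)).aemeasurable
  have e2 := h2.map_prod_eq_prod_map_map (N.measurable_t i).aemeasurable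
    (N.measurable_t j).aemeasurable
  have e3 := h3.map_prod_eq_prod_map_map (N.measurable_GW j i).aemeasurable
    (N.measurable_GW i j).aemeasurable
  rw [e2, e3, N.law_t, N.law_t, N.law_GW, N.law_GW] at e1
  exact e1

theorem map_pointMarks {i j : ℕ} (hij : i ≠ j) (κ : ℕ × Bool) :
    P.map (N.pointMarks i j κ) = p.pointLaw κ.2 := by
  have hm := N.measurable_mark
  rcases κ with ⟨k, b⟩
  cases b
  · have h3 : IndepFun (N.GLW k i) (N.GLW k j) P :=
      N.iIndepFun_mark.indepFun (i := Sum.inr (Sum.inr (k, i))) (j := Sum.inr (Sum.inr (k, j)))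
        (by simpa)
    have e3 := h3.map_prod_eq_prod_map_map (N.measurable_GLW k i).aemeasurable
      (N.measurable_GLW k j).aemeasurable
    have e1 := (indepFun_const_left (0 : ℝ) (fun ω => (N.GLW k i ω, N.GLW k j ω))
      (μ := P)).map_prod_eq_prod_map_map measurable_const.aemeasurable
      ((N.measurable_GLW k i).prodMk (N.measurable_GLW k j)).aemeasurable
    rw [e3, N.law_GLW, N.law_GLW, Measure.map_const, measure_univ, one_smul] at e1
    exact e1
  · have h1 : IndepFun (N.t k) (fun ω => (N.GW k i ω, N.GW k j ω)) P :=
      (N.iIndepFun_mark.indepFun_prodMk hm (Sum.inr (Sum.inl (k, i))) (Sum.inr (Sum.inl (k, j)))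
        (Sum.inl k) (by simp) (by simp)).symm
    have h3 : IndepFun (N.GW k i) (N.GW k j) P :=
      N.iIndepFun_mark.indepFun (i := Sum.inr (Sum.inl (k, i))) (j := Sum.inr (Sum.inl (k, j)))
        (by simpa)
    have e3 := h3.map_prod_eq_prod_map_map (N.measurable_GW k i).aemeasurable
      (N.measurable_GW k j).aemeasurable
    have e1 := h1.map_prod_eq_prod_map_map (N.measurable_t k).aemeasurable
      ((N.measurable_GW k i).prodMk (N.measurable_GW k j)).aemeasurable
    rw [e3, N.law_GW, N.law_GW, N.law_t] at e1
    exact e1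

/-- Integration over the marks of two access points and of finitely many other points. -/
theorem lintegral_marks {i j : ℕ} (hij : i ≠ j) {A : Type*} [Fintype A] {κ : A → ℕ × Bool}
    (hκ : Function.Injective κ) (hi : ∀ a, κ a ≠ (i, true)) (hj : ∀ a, κ a ≠ (j, true))
    {G : PairMarks → ℝ≥0∞} (hG : Measurable G) {H : A → PairMarks × PointMarks → ℝ≥0∞}
    (hH : ∀ a, Measurable (H a)) :
    ∫⁻ ω, G (N.pairMarks i j ω) * ∏ a, H a (N.pairMarks i j ω, N.pointMarks i j (κ a) ω) ∂P =
      ∫⁻ x, G x * ∏ a, ∫⁻ y, H a (x, y) ∂p.pointLaw (κ a).2 ∂p.pairLaw := by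
  have h1 : iIndepFun (fun a => N.pointMarks i j (κ a)) P :=
    iIndepFun.of_disjoint N.iIndepFun_mark N.measurable_mark
      (fun a b hab => disjoint_pointIndices i j (hκ.ne hab))
      (fun a => N.measurable_pointMarks_iSup i j (κ a))
  have h2 : IndepFun (N.pairMarks i j) (fun ω a => N.pointMarks i j (κ a) ω) P := by
    refine indepFun_of_disjoint N.iIndepFun_mark N.measurable_mark
      (T := ⋃ a, pointIndices i j (κ a))
      (Set.disjoint_iUnion_right.2 fun a => disjoint_pairIndices i j (hi a) (hj a))
      (N.measurable_pairMarks_iSup i j) ?_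
    refine @measurable_pi_lambda _ _ _ (_) _ _ fun a => ?_
    refine (N.measurable_pointMarks_iSup i j (κ a)).mono ?_ le_rfl
    exact iSup₂_le fun m hm => le_iSup₂_of_le m (Set.mem_iUnion_of_mem a hm) le_rfl
  have := lintegral_mul_prod_of_indepFun h1 h2 (N.measurable_pairMarks i j)
    (fun a => N.measurable_pointMarks i j (κ a)) hG hH
  simpa only [N.map_pairMarks hij, N.map_pointMarks hij] using this

end Network

end Coexistence

namespace Coexistence

open scoped ENNReal

/-! ### Inclusion and exclusion in the extended nonnegative reals -/

/-- The vanishing alternating sum of binomial coefficients with the negative terms moved to the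
other side. For n + 1, Pascal's rule makes each of the two sums equal to the full sum of the
coefficients of n. -/
theorem tsum_choose_even (n : ℕ) :
    ∑' k : ℕ, (n.choose (2 * k) : ℝ≥0∞) =
      (if n = 0 then 1 else 0) + ∑' k : ℕ, (n.choose (2 * k + 1) : ℝ≥0∞) := by
  cases n with
  | zero =>
    rw [tsum_eq_single 0 (fun k hk => by
      rw [Nat.choose_eq_zero_of_lt (by omega), Nat.cast_zero])]
    simp
  | succ n =>
    have h1 : ∀ k : ℕ, ((n + 1).choose (2 * (k + 1)) : ℝ≥0∞) =
        n.choose (2 * k + 1) + n.choose (2 * (k + 1)) := fun k => by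
      rw [show 2 * (k + 1) = (2 * k + 1) + 1 by ring, Nat.choose_succ_succ, Nat.cast_add]
    have h2 : ∀ k : ℕ, ((n + 1).choose (2 * k + 1) : ℝ≥0∞) =
        n.choose (2 * k) + n.choose (2 * k + 1) := fun k => by
      rw [Nat.choose_succ_succ, Nat.cast_add]
    rw [tsum_eq_zero_add' (f := fun k => ((n + 1).choose (2 * k) : ℝ≥0∞)) ENNReal.summable,
      tsum_congr h1, tsum_congr h2, ENNReal.tsum_add, ENNReal.tsum_add,
      tsum_eq_zero_add' (f := fun k => (n.choose (2 * k) : ℝ≥0∞)) ENNReal.summable,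
      if_neg n.succ_ne_zero, zero_add, mul_zero, Nat.choose_zero_right, Nat.choose_zero_right,
      add_left_comm, add_comm (∑' k : ℕ, (n.choose (2 * k + 1) : ℝ≥0∞)), add_assoc]

/-- The number of ordered `n`-tuples of distinct elements. -/
noncomputable def tupleCount {ι : Type*} (B : Set ι) (n : ℕ) : ℝ≥0∞ :=
  ({h : Fin n → ι | Function.Injective h ∧ ∀ a, h a ∈ B}.encard : ℝ≥0∞)

theorem tupleCount_of_finite {ι : Type*} {B : Set ι} (hB : B.Finite) (n : ℕ) :
    tupleCount B n = (B.ncard.descFactorial n : ℝ≥0∞) := by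
  have := encard_colouredInjections (fun _ : Fin n => ()) (fun _ => B)
    (fun a b hab => absurd (Subsingleton.elim a b) hab) (fun _ => hB)
  rw [tupleCount, this]
  simp

theorem tupleCount_of_infinite {ι : Type*} {B : Set ι} (hB : B.Infinite) {n : ℕ} (hn : n ≠ 0) :
    tupleCount B n = ⊤ := by
  have : Infinite B := hB.to_subtype
  let e := Infinite.natEmbedding B
  have hinf : {h : Fin n → ι | Function.Injective h ∧ ∀ a, h a ∈ B}.Infinite := by
    -- Consecutive blocks of length n in an infinite sequence of distinct elements provide
    -- infinitely many tuples.
    refine Set.infinite_of_injective_forall_mem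
      (f := fun (m : ℕ) (a : Fin n) => ((e (m * n + a) : B) : ι)) ?_ ?_
    · intro m m' h
      have h0 := congrFun h ⟨0, Nat.pos_of_ne_zero hn⟩
      have h1 := e.injective (Subtype.ext h0)
      simp only [add_zero] at h1
      exact Nat.eq_of_mul_eq_mul_right (Nat.pos_of_ne_zero hn) h1
    · refine fun m => ⟨fun a b h => ?_, fun a => (e _).2⟩
      have h1 := e.injective (Subtype.ext h)
      exact Fin.ext (by omega)
  rw [tupleCount, hinf.encard_eq]
  rfl

open Classical in
/-- Inclusion and exclusion, also for infinite sets. -/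
theorem tsum_tupleCount_even {ι : Type*} (B : Set ι) :
    ∑' k : ℕ, tupleCount B (2 * k) / ((2 * k).factorial : ℝ≥0∞) =
      (if B = ∅ then 1 else 0) + ∑' k : ℕ, tupleCount B (2 * k + 1) / ((2 * k + 1).factorial : ℝ≥0∞) := by
  by_cases hB : B.Finite
  · have key : ∀ n, tupleCount B n / (n.factorial : ℝ≥0∞) = B.ncard.choose n := fun n => by
      rw [tupleCount_of_finite hB, Nat.descFactorial_eq_factorial_mul_choose, Nat.cast_mul,
        mul_comm, ENNReal.mul_div_cancel_right (by exact_mod_cast n.factorial_ne_zero)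
          (ENNReal.natCast_ne_top _)]
    simp_rw [key]
    rw [tsum_choose_even]
    congr 1
    simp only [Set.ncard_eq_zero hB]
  · have key : ∀ n, n ≠ 0 → tupleCount B n / (n.factorial : ℝ≥0∞) = ⊤ := fun n hn => by
      rw [tupleCount_of_infinite hB hn, ENNReal.top_div_of_ne_top (ENNReal.natCast_ne_top _)]
    -- For an infinite set both sides are infinite: pairs make the even sum infinite, singletons the
    -- odd one.
    rw [ENNReal.tsum_eq_top_of_eq_top ⟨1, key _ (by norm_num)⟩,
      ENNReal.tsum_eq_top_of_eq_top ⟨0, key _ (by norm_num)⟩, add_top]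

theorem tsum_pow_div_factorial_even {x : ℝ} (hx : 0 ≤ x) :
    ∑' k : ℕ, ENNReal.ofReal x ^ (2 * k) / ((2 * k).factorial : ℝ≥0∞) =
      ENNReal.ofReal (Real.cosh x) := by
  rw [← (Real.hasSum_cosh x).tsum_eq, ENNReal.ofReal_tsum_of_nonneg (fun n => by positivity)
    (Real.hasSum_cosh x).summable]
  refine tsum_congr fun k => ?_
  rw [ENNReal.ofReal_div_of_pos (by positivity), ENNReal.ofReal_pow hx, ENNReal.ofReal_natCast]

theorem tsum_pow_div_factorial_odd {x : ℝ} (hx : 0 ≤ x) :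
    ∑' k : ℕ, ENNReal.ofReal x ^ (2 * k + 1) / ((2 * k + 1).factorial : ℝ≥0∞) =
      ENNReal.ofReal (Real.sinh x) := by
  rw [← (Real.hasSum_sinh x).tsum_eq, ENNReal.ofReal_tsum_of_nonneg (fun n => by positivity)
    (Real.hasSum_sinh x).summable]
  refine tsum_congr fun k => ?_
  rw [ENNReal.ofReal_div_of_pos (by positivity), ENNReal.ofReal_pow hx, ENNReal.ofReal_natCast]

theorem lintegral_pi_prod_eq_pow {E : Type*} [MeasurableSpace E] (μ : Measure E) [SigmaFinite μ]
    {f : E → ℝ≥0∞} (hf : Measurable f) (n : ℕ) :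
    ∫⁻ z, ∏ a, f (z a) ∂Measure.pi (fun _ : Fin n => μ) = (∫⁻ e, f e ∂μ) ^ n := by
  induction n with
  | zero => simp
  | succ n ih =>
    have hm : ∀ m : ℕ, Measurable fun z : Fin m → E => ∏ a, f (z a) := fun m =>
      Finset.measurable_fun_prod _ fun a _ => hf.comp (measurable_pi_apply a)
    have h := (measurePreserving_piFinSuccAbove (fun _ : Fin (n + 1) => μ) 0).symm.lintegral_comp
      (hm (n + 1))
    rw [← h, lintegral_prod]
    · rw [pow_succ, mul_comm, ← ih, ← lintegral_mul_const _ hf]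
      refine lintegral_congr fun e => ?_
      rw [← lintegral_const_mul _ (hm n)]
      refine lintegral_congr fun z => ?_
      rw [Fin.prod_univ_succ]
      simp [MeasurableEquiv.piFinSuccAbove]
    · exact ((hm (n + 1)).comp
        (MeasurableEquiv.piFinSuccAbove (fun _ => E) 0).symm.measurable).aemeasurable

end Coexistence

/-! ### Pairs of access points together with tuples of bad points -/

namespace Coexistence

open scoped ENNReal

/-- The locations and the marks of two distinguished access points. -/
abbrev PairState : Type := (Plane × Plane) × PairMarks

/-- The location, the type and the marks of another point. -/
abbrev PointState : Type := (Plane × Bool) × PointMarks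

namespace Params

variable (p : Params)

/-- The probability that a point is bad for a given pair. -/
noncomputable def badProb (B : Set (PairState × PointState)) (w : PairState) (e : Plane × Bool) :
    ℝ≥0∞ :=
  p.pointLaw e.2 {y | (w, (e, y)) ∈ B}

/-- The expected number of points that are bad for a given pair. -/
noncomputable def badMass (B : Set (PairState × PointState)) (w : PairState) : ℝ≥0∞ :=
  ∫⁻ e, p.badProb B w e ∂p.intensity

theorem measurable_badProb {B : Set (PairState × PointState)} (hB : MeasurableSet B) :
    Measurable fun q : PairState × (Plane × Bool) => p.badProb B q.1 q.2 := by
  have h : ∀ b, Measurable fun q : PairState × (Plane × Bool) =>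
      p.pointLaw b {y | (q.1, (q.2, y)) ∈ B} := fun b =>
    measurable_measure_prodMk_left (ν := p.pointLaw b) (s := {r : (PairState × (Plane × Bool)) ×
      PointMarks | (r.1.1, (r.1.2, r.2)) ∈ B}) ((measurable_fst.fst.prodMk
        (measurable_fst.snd.prodMk measurable_snd)) hB)
  have : (fun q : PairState × (Plane × Bool) => p.badProb B q.1 q.2) = fun q =>
      if q.2.2 = true then p.pointLaw true {y | (q.1, (q.2, y)) ∈ B}
      else p.pointLaw false {y | (q.1, (q.2, y)) ∈ B} := by
    funext ⟨w, z, b⟩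
    cases b <;> rfl
  rw [this]
  exact Measurable.ite (measurable_snd.snd (measurableSet_singleton true)) (h true) (h false)

theorem measurable_badMass {B : Set (PairState × PointState)} (hB : MeasurableSet B) :
    Measurable (p.badMass B) :=
  (p.measurable_badProb hB).lintegral_prod_right'

/-- The density of the configurations with a pair in `A` and `n` bad points. -/
noncomputable def tupleDensity (A : Set PairState) (B : Set (PairState × PointState)) {n : ℕ}
    (z : Fin 2 ⊕ Fin n → Plane × Bool) : ℝ≥0∞ :=
  if (z (Sum.inl 0)).2 = true ∧ (z (Sum.inl 1)).2 = true then
    ∫⁻ x, A.indicator 1 (((z (Sum.inl 0)).1, (z (Sum.inl 1)).1), x) *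
      ∏ a, p.badProb B (((z (Sum.inl 0)).1, (z (Sum.inl 1)).1), x) (z (Sum.inr a)) ∂p.pairLaw
  else 0

theorem measurable_tupleDensity {A : Set PairState} (hA : MeasurableSet A)
    {B : Set (PairState × PointState)} (hB : MeasurableSet B) (n : ℕ) :
    Measurable (p.tupleDensity A B (n := n)) := by
  refine Measurable.ite ?_ ?_ measurable_const
  · exact ((measurable_pi_apply (Sum.inl 0)).snd (measurableSet_singleton true)).inter
      ((measurable_pi_apply (Sum.inl 1)).snd (measurableSet_singleton true))
  · refine Measurable.lintegral_prod_right' (f := fun q : (Fin 2 ⊕ Fin n → Plane × Bool) ×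
      PairMarks => A.indicator 1 (((q.1 (Sum.inl 0)).1, (q.1 (Sum.inl 1)).1), q.2) *
      ∏ a, p.badProb B (((q.1 (Sum.inl 0)).1, (q.1 (Sum.inl 1)).1), q.2) (q.1 (Sum.inr a))) ?_
    have hw : Measurable fun q : (Fin 2 ⊕ Fin n → Plane × Bool) × PairMarks =>
        (((q.1 (Sum.inl 0)).1, (q.1 (Sum.inl 1)).1), q.2) :=
      (((measurable_pi_apply (Sum.inl 0)).comp measurable_fst).fst.prodMk
        ((measurable_pi_apply (Sum.inl 1)).comp measurable_fst).fst).prodMk measurable_snd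
    refine ((measurable_one.indicator hA).comp hw).mul (Finset.measurable_fun_prod _ fun a _ => ?_)
    exact (p.measurable_badProb hB).comp
      (hw.prodMk ((measurable_pi_apply (Sum.inr a)).comp measurable_fst))

end Params

namespace Network

variable {Ω : Type*} [MeasurableSpace Ω] {P : Measure Ω} {p : Params} (N : Network P p)

/-- The state of a pair of access points. -/
def pairState (g : Fin 2 → ℕ × Bool) (ω : Ω) : PairState :=
  (((N.loc (g 0) ω).1, (N.loc (g 1) ω).1), N.pairMarks (g 0).1 (g 1).1 ω)

/-- The pair consists of two distinct existing access points with state in `A`. -/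
def pairEvent (A : Set PairState) (g : Fin 2 → ℕ × Bool) : Set Ω :=
  {ω | Function.Injective g ∧ ((g 0).2 = true ∧ (g 1).2 = true) ∧
    (∀ k, ω ∈ N.here (g k)) ∧ N.pairState g ω ∈ A}

/-- The existing points which are bad for a pair. -/
def badSet (B : Set (PairState × PointState)) (g : Fin 2 → ℕ × Bool) (ω : Ω) : Set (ℕ × Bool) :=
  {κ | (∀ k, κ ≠ g k) ∧ ω ∈ N.here κ ∧
    (N.pairState g ω, (N.loc κ ω, N.pointMarks (g 0).1 (g 1).1 κ ω)) ∈ B}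

theorem measurable_pairState (g : Fin 2 → ℕ × Bool) : Measurable (N.pairState g) :=
  ((N.measurable_loc _).fst.prodMk (N.measurable_loc _).fst).prodMk (N.measurable_pairMarks _ _)

theorem measurableSet_pairEvent {A : Set PairState} (hA : MeasurableSet A)
    (g : Fin 2 → ℕ × Bool) : MeasurableSet (N.pairEvent A g) := by
  rw [show N.pairEvent A g = {ω | Function.Injective g ∧ ∀ k, ω ∈ N.here (g k)} ∩
    ({_ω | (g 0).2 = true ∧ (g 1).2 = true} ∩ N.pairState g ⁻¹' A) by
      ext ω; simp only [pairEvent, Set.mem_inter_iff, Set.mem_ofPred_eq, Set.mem_preimage]; tauto]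
  exact (N.measurableSet_injective_here g).inter
    ((MeasurableSet.const _).inter (N.measurable_pairState g hA))

theorem measurableSet_mem_badSet {B : Set (PairState × PointState)} (hB : MeasurableSet B)
    (g : Fin 2 → ℕ × Bool) (κ : ℕ × Bool) : MeasurableSet {ω | κ ∈ N.badSet B g ω} :=
  (MeasurableSet.const _).inter ((N.measurableSet_here κ).inter
    (((N.measurable_pairState g).prodMk ((N.measurable_loc κ).prodMk
      (N.measurable_pointMarks _ _ κ))) hB))

theorem measurableSet_badTuple {B : Set (PairState × PointState)} (hB : MeasurableSet B)
    (g : Fin 2 → ℕ × Bool) {n : ℕ} (h : Fin n → ℕ × Bool) :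
    MeasurableSet {ω | Function.Injective h ∧ ∀ a, h a ∈ N.badSet B g ω} := by
  rw [show {ω | Function.Injective h ∧ ∀ a, h a ∈ N.badSet B g ω} =
    {_ω | Function.Injective h} ∩ ⋂ a, {ω | h a ∈ N.badSet B g ω} by ext; simp]
  exact (MeasurableSet.const _).inter
    (MeasurableSet.iInter fun a => N.measurableSet_mem_badSet hB g (h a))

/-- The existence of the points is decided by the random numbers of points, so its indicator stays
on the side of the locations. Both sides are measurable functions of the full location and mark
sequences. -/
theorem indepFun_loc_marks {α : Type*} [Fintype α] (f : α → ℕ × Bool) (i j : ℕ) {n : ℕ}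
    (h : Fin n → ℕ × Bool) :
    IndepFun (fun ω => (({ω | ∀ k, ω ∈ N.here (f k)}.indicator 1 ω : ℝ≥0∞), fun k => N.loc (f k) ω))
      (fun ω => (N.pairMarks i j ω, fun a => N.pointMarks i j (h a) ω)) P := by
  classical
  let φ : (ℕ∞ × (ℕ → Plane)) × (ℕ∞ × (ℕ → Plane)) → ℝ≥0∞ × (α → Plane × Bool) := fun l =>
    (({l | ∀ k, ((f k).1 : ℕ∞) < if (f k).2 then l.1.1 else l.2.1} : Set ((ℕ∞ × (ℕ → Plane)) × (ℕ∞ × (ℕ → Plane)))).indicator 1 l,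
      fun k => (if (f k).2 then l.1.2 (f k).1 else l.2.2 (f k).1, (f k).2))
  let ψ : (ℕ → ℝ) × ((ℕ × ℕ → ℝ) × (ℕ × ℕ → ℝ)) → PairMarks × (Fin n → PointMarks) := fun m =>
    (((m.1 i, m.1 j), (m.2.1 (j, i), m.2.1 (i, j))), fun a =>
      if (h a).2 then (m.1 (h a).1, (m.2.1 ((h a).1, i), m.2.1 ((h a).1, j)))
      else (0, (m.2.2 ((h a).1, i), m.2.2 ((h a).1, j))))
  have hφ : Measurable φ := by
    refine Measurable.prodMk (measurable_one.indicator ?_) (measurable_pi_lambda _ fun k => ?_)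
    · rw [Set.ofPred_forall]
      refine MeasurableSet.iInter fun k => ?_
      split_ifs
      · exact measurable_fst.fst (MeasurableSet.of_discrete (s := {n : ℕ∞ | ((f k).1 : ℕ∞) < n}))
      · exact measurable_snd.fst (MeasurableSet.of_discrete (s := {n : ℕ∞ | ((f k).1 : ℕ∞) < n}))
    · refine Measurable.prodMk ?_ measurable_const
      split_ifs
      · exact (measurable_pi_apply _).comp measurable_fst.snd
      · exact (measurable_pi_apply _).comp measurable_snd.snd
  have hψ : Measurable ψ := by
    refine Measurable.prodMk (by fun_prop) (measurable_pi_lambda _ fun a => ?_)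
    split_ifs <;> fun_prop
  exact N.indep_locations_marks.comp hφ hψ

variable [IsProbabilityMeasure P]

/-- Conditionally on the locations and on the marks of the pair, the listed points are bad
independently. Integrating out the marks leaves a function of the locations alone, ready for
Campbell's formula. -/
theorem measure_pairEvent_inter {A : Set PairState} (hA : MeasurableSet A)
    {B : Set (PairState × PointState)} (hB : MeasurableSet B) (g : Fin 2 → ℕ × Bool) {n : ℕ}
    (h : Fin n → ℕ × Bool) :
    P (N.pairEvent A g ∩ {ω | Function.Injective h ∧ ∀ a, h a ∈ N.badSet B g ω}) =
      ∫⁻ ω in {ω | Function.Injective (Sum.elim g h) ∧ ∀ k, ω ∈ N.here (Sum.elim g h k)},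
        p.tupleDensity A B (fun k => N.loc (Sum.elim g h k) ω) ∂P := by
  classical
  set f := Sum.elim g h with hf
  -- Otherwise both sides vanish: bad points are distinct from each other and from the pair, and the
  -- pair consists of Wi-Fi points.
  by_cases hinj : Function.Injective f ∧ (g 0).2 = true ∧ (g 1).2 = true
  swap
  · have h1 : N.pairEvent A g ∩ {ω | Function.Injective h ∧ ∀ a, h a ∈ N.badSet B g ω} = ∅ := by
      refine Set.eq_empty_of_forall_notMem fun ω hω => hinj ⟨?_, hω.1.2.1⟩
      exact (Sum.elim_injective).2 ⟨hω.1.1, hω.2.1, fun k a => ((hω.2.2 a).1 k).symm⟩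
    rw [h1, measure_empty]
    symm
    by_cases hi : Function.Injective f
    · refine (lintegral_congr fun ω => ?_).trans lintegral_zero
      exact if_neg fun hc => hinj ⟨hi, hc⟩
    · simp [hi]
  obtain ⟨hfi, hg0, hg1⟩ := hinj
  have hfe := Sum.elim_injective.1 hfi
  have hij : (g 0).1 ≠ (g 1).1 := fun h' => by
    have := hfe.1 (Prod.ext h' (hg0.trans hg1.symm) : g 0 = g 1)
    simp at this
  have hgi : ∀ k : Fin 2, g k = ((g k).1, true) := fun k => by
    fin_cases k
    · exact Prod.ext rfl hg0
    · exact Prod.ext rfl hg1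
  set H := {ω | ∀ k, ω ∈ N.here (f k)} with hH
  have hHm : MeasurableSet H := by
    have := N.measurableSet_injective_here f
    simpa only [hfi, true_and] using this
  have hset : {ω | Function.Injective f ∧ ∀ k, ω ∈ N.here (f k)} = H := by
    ext ω; simp [hfi, hH]
  let z' : (Fin 2 ⊕ Fin n → Plane × Bool) → Plane × Plane := fun z =>
    ((z (Sum.inl 0)).1, (z (Sum.inl 1)).1)
  have hz' : Measurable z' :=
    (measurable_pi_apply (Sum.inl 0)).fst.prodMk (measurable_pi_apply (Sum.inl 1)).fst
  let X : Ω → ℝ≥0∞ × (Fin 2 ⊕ Fin n → Plane × Bool) := fun ω =>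
    (H.indicator 1 ω, fun k => N.loc (f k) ω)
  have hX : Measurable X := (measurable_one.indicator hHm).prodMk
    (measurable_pi_lambda _ fun k => N.measurable_loc _)
  let Y : Ω → PairMarks × (Fin n → PointMarks) := fun ω =>
    (N.pairMarks (g 0).1 (g 1).1 ω, fun a => N.pointMarks (g 0).1 (g 1).1 (h a) ω)
  have hY : Measurable Y := (N.measurable_pairMarks _ _).prodMk
    (measurable_pi_lambda _ fun a => N.measurable_pointMarks _ _ _)
  let F : (ℝ≥0∞ × (Fin 2 ⊕ Fin n → Plane × Bool)) × (PairMarks × (Fin n → PointMarks)) → ℝ≥0∞ :=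
    fun q => q.1.1 * (A.indicator 1 (z' q.1.2, q.2.1) *
      ∏ a, B.indicator 1 ((z' q.1.2, q.2.1), (q.1.2 (Sum.inr a), q.2.2 a)))
  have hF : Measurable F := by
    have hw : Measurable fun q : (ℝ≥0∞ × (Fin 2 ⊕ Fin n → Plane × Bool)) ×
        (PairMarks × (Fin n → PointMarks)) => (z' q.1.2, q.2.1) :=
      (hz'.comp measurable_fst.snd).prodMk measurable_snd.fst
    refine measurable_fst.fst.mul (((measurable_one.indicator hA).comp hw).mul
      (Finset.measurable_fun_prod _ fun a _ => (measurable_one.indicator hB).comp (hw.prodMk ?_)))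
    exact ((measurable_pi_apply (Sum.inr a)).comp measurable_fst.snd).prodMk
      ((measurable_pi_apply a).comp measurable_snd.snd)
  have hind : IndepFun X Y P := N.indepFun_loc_marks f _ _ h
  have h1 : P (N.pairEvent A g ∩ {ω | Function.Injective h ∧ ∀ a, h a ∈ N.badSet B g ω}) =
      ∫⁻ ω, F (X ω, Y ω) ∂P := by
    rw [← lintegral_indicator_one ((N.measurableSet_pairEvent hA g).inter
      (N.measurableSet_badTuple hB g h))]
    refine lintegral_congr fun ω => ?_
    have hmem : ω ∈ N.pairEvent A g ∩ {ω | Function.Injective h ∧ ∀ a, h a ∈ N.badSet B g ω} ↔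
        ω ∈ H ∧ (z' (X ω).2, (Y ω).1) ∈ A ∧
          ∀ a, ((z' (X ω).2, (Y ω).1), ((X ω).2 (Sum.inr a), (Y ω).2 a)) ∈ B := by
      constructor
      · rintro ⟨⟨-, -, h3, h4⟩, -, h6⟩
        refine ⟨?_, h4, fun a => (h6 a).2.2⟩
        rintro (k | a)
        · exact h3 k
        · exact (h6 a).2.1
      · rintro ⟨h3, h4, h5⟩
        exact ⟨⟨hfe.1, ⟨hg0, hg1⟩, fun k => h3 (Sum.inl k), h4⟩, hfe.2.1, fun a =>
          ⟨fun k => (hfe.2.2 k a).symm, h3 (Sum.inr a), h5 a⟩⟩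
    by_cases hω : ω ∈ N.pairEvent A g ∩ {ω | Function.Injective h ∧ ∀ a, h a ∈ N.badSet B g ω}
    · rw [Set.indicator_of_mem hω]
      obtain ⟨h3, h4, h5⟩ := hmem.1 hω
      simp only [F, Set.indicator_of_mem h4, Set.indicator_of_mem (h5 _), X,
        Set.indicator_of_mem h3, Pi.one_apply, Finset.prod_const_one, mul_one]
    · rw [Set.indicator_of_notMem hω]
      symm
      by_cases h3 : ω ∈ H
      · by_cases h4 : (z' (X ω).2, (Y ω).1) ∈ A
        · obtain ⟨a, ha⟩ : ∃ a, ((z' (X ω).2, (Y ω).1), ((X ω).2 (Sum.inr a), (Y ω).2 a)) ∉ B := by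
            by_contra hcon
            push Not at hcon
            exact hω (hmem.2 ⟨h3, h4, hcon⟩)
          simp only [F]
          rw [Finset.prod_eq_zero (Finset.mem_univ a) (Set.indicator_of_notMem ha 1), mul_zero,
            mul_zero]
        · simp only [F, Set.indicator_of_notMem h4, zero_mul, mul_zero]
      · simp only [F, X, Set.indicator_of_notMem h3, zero_mul]
  rw [h1, lintegral_comp_of_indepFun hind hX hY hF, hset]
  -- With the locations frozen, only the marks are random, and their joint law factorizes given the
  -- marks of the pair.
  have h2 : ∀ x : ℝ≥0∞ × (Fin 2 ⊕ Fin n → Plane × Bool), ∫⁻ ω, F (x, Y ω) ∂P =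
      x.1 * ∫⁻ y, A.indicator 1 (z' x.2, y) * ∏ a, ∫⁻ y', B.indicator 1
        ((z' x.2, y), (x.2 (Sum.inr a), y')) ∂p.pointLaw (h a).2 ∂p.pairLaw := by
    intro x
    have hw : Measurable fun y : PairMarks => (z' x.2, y) := measurable_prodMk_left
    have hBm : ∀ a, Measurable fun q : PairMarks × PointMarks => (B.indicator 1
        ((z' x.2, q.1), (x.2 (Sum.inr a), q.2)) : ℝ≥0∞) := fun a =>
      (measurable_one.indicator hB).comp ((hw.comp measurable_fst).prodMk
        (measurable_prodMk_left.comp measurable_snd))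
    have hAm : Measurable fun y : PairMarks => (A.indicator 1 (z' x.2, y) : ℝ≥0∞) :=
      (measurable_one.indicator hA).comp hw
    rw [← N.lintegral_marks hij hfe.2.1 (fun a => by rw [← hgi]; exact (hfe.2.2 0 a).symm)
      (fun a => by rw [← hgi]; exact (hfe.2.2 1 a).symm) hAm hBm, ← lintegral_const_mul]
    · exact (hAm.comp (N.measurable_pairMarks _ _)).mul (Finset.measurable_fun_prod _ fun a _ =>
        (hBm a).comp ((N.measurable_pairMarks _ _).prodMk (N.measurable_pointMarks _ _ _)))
  have h3 : ∀ (ω : Ω), ∫⁻ y, A.indicator 1 (z' (X ω).2, y) * ∏ a, ∫⁻ y', B.indicator 1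
        ((z' (X ω).2, y), ((X ω).2 (Sum.inr a), y')) ∂p.pointLaw (h a).2 ∂p.pairLaw =
      p.tupleDensity A B (fun k => N.loc (f k) ω) := by
    intro ω
    rw [Params.tupleDensity, if_pos ⟨hg0, hg1⟩]
    refine lintegral_congr fun y => ?_
    congr 1
    refine Finset.prod_congr rfl fun a _ => ?_
    have hBs : MeasurableSet {y' | ((z' (X ω).2, y), ((X ω).2 (Sum.inr a), y')) ∈ B} :=
      (measurable_prodMk_left.comp measurable_prodMk_left) hB
    exact lintegral_indicator_one hBs
  have h4 : ∫⁻ x, ∫⁻ ω, F (x, Y ω) ∂P ∂P.map X = ∫⁻ ω, ∫⁻ ω', F (X ω, Y ω') ∂P ∂P :=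
    lintegral_map (f := fun x => ∫⁻ ω, F (x, Y ω) ∂P) ((hF.comp (measurable_fst.prodMk
      (hY.comp measurable_snd))).lintegral_prod_right') hX
  rw [h4, ← lintegral_indicator hHm]
  refine lintegral_congr fun ω => ?_
  rw [h2, h3]
  by_cases hω : ω ∈ H
  · simp [X, hω]
  · simp [X, hω]

end Network

end Coexistence

/-! ### The probability that no point is bad -/

namespace Coexistence

open scoped ENNReal

namespace Params

variable (p : Params)

/-- The law of the state of a pair of access points, relative to the intensity. -/
noncomputable def pairMeasure : Measure PairState :=
  ((volume : Measure Plane).prod (volume : Measure Plane)).prod p.pairLaw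

/-- Given the state of the pair, the n further coordinates separate, and each integrates to the
expected number of bad points. The two factors λ_W come from the pair, which must be of Wi-Fi type.
-/
theorem lintegral_tupleDensity {A : Set PairState} (hA : MeasurableSet A)
    {B : Set (PairState × PointState)} (hB : MeasurableSet B) (n : ℕ) :
    ∫⁻ z, p.tupleDensity A B (n := n) z ∂Measure.pi (fun _ => p.intensity) =
      ENNReal.ofReal p.lamW ^ 2 * ∫⁻ w in A, p.badMass B w ^ n ∂p.pairMeasure := by
  have hT := p.measurable_tupleDensity hA hB n
  have hM := p.measurable_badMass hB
  have hAi : Measurable (A.indicator (1 : PairState → ℝ≥0∞)) := measurable_one.indicator hA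
  let Ψ : (Plane × Bool) × (Plane × Bool) → ℝ≥0∞ := fun e =>
    if e.1.2 = true ∧ e.2.2 = true then
      ∫⁻ x, A.indicator 1 ((e.1.1, e.2.1), x) * p.badMass B ((e.1.1, e.2.1), x) ^ n ∂p.pairLaw
    else 0
  have hΨ1 : Measurable fun q : Plane × Plane =>
      ∫⁻ x, A.indicator 1 (q, x) * p.badMass B (q, x) ^ n ∂p.pairLaw :=
    (hAi.mul (hM.pow_const n)).lintegral_prod_right'
  have hΨ : Measurable Ψ := by
    refine Measurable.ite ?_ (hΨ1.comp (measurable_fst.fst.prodMk measurable_snd.fst))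
      measurable_const
    exact (measurable_fst.snd (measurableSet_singleton true)).inter
      (measurable_snd.snd (measurableSet_singleton true))
  have h1 := (measurePreserving_sumPiEquivProdPi_symm
    (fun _ : Fin 2 ⊕ Fin n => p.intensity)).lintegral_comp hT
  rw [← h1, lintegral_prod]
  swap
  · exact (hT.comp (MeasurableEquiv.measurable _)).aemeasurable
  have h2 : ∀ z0 : Fin 2 → Plane × Bool, ∫⁻ z1, p.tupleDensity A B (n := n)
      ((MeasurableEquiv.sumPiEquivProdPi fun _ => Plane × Bool).symm (z0, z1))
        ∂Measure.pi (fun _ => p.intensity) = Ψ (MeasurableEquiv.finTwoArrow z0) := by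
    intro z0
    show ∫⁻ z1 : Fin n → Plane × Bool, (if (z0 0).2 = true ∧ (z0 1).2 = true then
      ∫⁻ x, A.indicator 1 (((z0 0).1, (z0 1).1), x) *
        ∏ a, p.badProb B (((z0 0).1, (z0 1).1), x) (z1 a) ∂p.pairLaw else 0)
      ∂Measure.pi (fun _ => p.intensity) = if (z0 0).2 = true ∧ (z0 1).2 = true then
      ∫⁻ x, A.indicator 1 (((z0 0).1, (z0 1).1), x) *
        p.badMass B (((z0 0).1, (z0 1).1), x) ^ n ∂p.pairLaw else 0
    split_ifs with hc
    · have hb := p.measurable_badProb hB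
      have hw : Measurable fun x : PairMarks => (((z0 0).1, (z0 1).1), x) := measurable_prodMk_left
      have hpr : ∀ x : PairMarks, Measurable fun z1 : Fin n → Plane × Bool =>
          ∏ a, p.badProb B (((z0 0).1, (z0 1).1), x) (z1 a) := fun x =>
        Finset.measurable_fun_prod _ fun a _ =>
          (hb.comp measurable_prodMk_left).comp (measurable_pi_apply a)
      rw [lintegral_lintegral_swap]
      · refine lintegral_congr fun x => ?_
        rw [lintegral_const_mul _ (hpr x), lintegral_pi_prod_eq_pow p.intensity
          (f := p.badProb B (((z0 0).1, (z0 1).1), x)) (hb.comp measurable_prodMk_left)]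
        rfl
      · refine Measurable.aemeasurable ?_
        refine (hAi.comp (hw.comp measurable_snd)).mul (Finset.measurable_fun_prod _ fun a _ => ?_)
        exact hb.comp ((hw.comp measurable_snd).prodMk
          ((measurable_pi_apply a).comp measurable_fst))
    · exact lintegral_zero
  have h3 : ∫⁻ z0, ∫⁻ z1, p.tupleDensity A B (n := n)
      ((MeasurableEquiv.sumPiEquivProdPi fun _ => Plane × Bool).symm (z0, z1))
        ∂Measure.pi (fun _ => p.intensity) ∂Measure.pi (fun _ => p.intensity) =
      ∫⁻ e, Ψ e ∂p.intensity.prod p.intensity := by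
    simp_rw [h2]
    exact (measurePreserving_finTwoArrow p.intensity).lintegral_comp hΨ
  refine h3.trans ?_
  rw [lintegral_prod _ hΨ.aemeasurable, p.lintegral_intensity hΨ.lintegral_prod_right']
  have h4 : ∀ b (x : Plane), ∫⁻ e', Ψ ((x, b), e') ∂p.intensity = if b = true then
      ENNReal.ofReal p.lamW * ∫⁻ y : Plane, ∫⁻ x', A.indicator 1 ((x, y), x') *
        p.badMass B ((x, y), x') ^ n ∂p.pairLaw else 0 := by
    intro b x
    rw [p.lintegral_intensity (f := fun e' => Ψ ((x, b), e')) (hΨ.comp measurable_prodMk_left)]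
    cases b <;> simp [Ψ]
  simp_rw [h4]
  simp only [if_true, Bool.false_eq_true, if_false, lintegral_zero, mul_zero, add_zero]
  rw [lintegral_const_mul _ hΨ1.lintegral_prod_right', ← mul_assoc, ← sq, ← lintegral_indicator hA,
    pairMeasure, lintegral_prod, lintegral_prod]
  · congr 1
    refine lintegral_congr fun x => lintegral_congr fun y => lintegral_congr fun x' => ?_
    by_cases h : ((x, y), x') ∈ A <;> simp [h]
  · exact (((hM.pow_const n).indicator hA).lintegral_prod_right').aemeasurable
  · exact ((hM.pow_const n).indicator hA).aemeasurable

end Params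

namespace Network

variable {Ω : Type*} [MeasurableSpace Ω] {P : Measure Ω} {p : Params} (N : Network P p)

theorem tupleCount_badSet_eq_tsum (B : Set (PairState × PointState)) (g : Fin 2 → ℕ × Bool)
    (n : ℕ) (ω : Ω) : tupleCount (N.badSet B g ω) n = ∑' h : Fin n → ℕ × Bool,
      {ω | Function.Injective h ∧ ∀ a, h a ∈ N.badSet B g ω}.indicator 1 ω := by
  rw [tupleCount, ← ENNReal.tsum_set_one,
    tsum_subtype {h : Fin n → ℕ × Bool | Function.Injective h ∧ ∀ a, h a ∈ N.badSet B g ω} fun _ => 1]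
  refine tsum_congr fun h => ?_
  by_cases hh : Function.Injective h ∧ ∀ a, h a ∈ N.badSet B g ω <;> simp [Set.indicator, hh]

theorem measurable_tupleCount_badSet {B : Set (PairState × PointState)} (hB : MeasurableSet B)
    (g : Fin 2 → ℕ × Bool) (n : ℕ) : Measurable fun ω => tupleCount (N.badSet B g ω) n := by
  simp_rw [N.tupleCount_badSet_eq_tsum]
  exact Measurable.tsum fun h => measurable_one.indicator (N.measurableSet_badTuple hB g h)

theorem lintegral_tupleCount_badSet (A : Set PairState) {B : Set (PairState × PointState)} (hB : MeasurableSet B)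
    (g : Fin 2 → ℕ × Bool) (n : ℕ) :
    ∫⁻ ω in N.pairEvent A g, tupleCount (N.badSet B g ω) n ∂P = ∑' h : Fin n → ℕ × Bool,
      P (N.pairEvent A g ∩ {ω | Function.Injective h ∧ ∀ a, h a ∈ N.badSet B g ω}) := by
  simp_rw [N.tupleCount_badSet_eq_tsum]
  rw [lintegral_tsum fun h =>
    (measurable_one.indicator (N.measurableSet_badTuple hB g h)).aemeasurable]
  refine tsum_congr fun h => ?_
  rw [lintegral_indicator_one (N.measurableSet_badTuple hB g h),
    Measure.restrict_apply (N.measurableSet_badTuple hB g h), Set.inter_comm]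

theorem measurableSet_badSet_eq_empty {B : Set (PairState × PointState)} (hB : MeasurableSet B)
    (g : Fin 2 → ℕ × Bool) : MeasurableSet {ω | N.badSet B g ω = ∅} := by
  rw [show {ω | N.badSet B g ω = ∅} = ⋂ κ, {ω | κ ∈ N.badSet B g ω}ᶜ by
    ext; simp [Set.eq_empty_iff_forall_notMem]]
  exact MeasurableSet.iInter fun κ => (N.measurableSet_mem_badSet hB g κ).compl

variable [IsProbabilityMeasure P]

/-- A sum over the pair and a sum over n further indices amount to one sum over index tuples, to
which `tsum_lintegral_loc` applies. -/
theorem tsum_lintegral_tupleCount {A : Set PairState} (hA : MeasurableSet A)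
    {B : Set (PairState × PointState)} (hB : MeasurableSet B) (n : ℕ) :
    ∑' g, ∫⁻ ω in N.pairEvent A g, tupleCount (N.badSet B g ω) n ∂P =
      ENNReal.ofReal p.lamW ^ 2 * ∫⁻ w in A, p.badMass B w ^ n ∂p.pairMeasure := by
  rw [← p.lintegral_tupleDensity hA hB, ← N.tsum_lintegral_loc (p.measurable_tupleDensity hA hB n)]
  simp_rw [N.lintegral_tupleCount_badSet A hB, N.measure_pairEvent_inter hA hB]
  rw [← ENNReal.tsum_prod (f := fun g h => ∫⁻ ω in {ω | Function.Injective (Sum.elim g h) ∧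
    ∀ k, ω ∈ N.here (Sum.elim g h k)}, p.tupleDensity A B (fun k => N.loc (Sum.elim g h k) ω) ∂P)]
  exact (Equiv.sumArrowEquivProdArrow (Fin 2) (Fin n) (ℕ × Bool)).symm.tsum_eq
    (fun f : Fin 2 ⊕ Fin n → ℕ × Bool => ∫⁻ ω in {ω | Function.Injective f ∧ ∀ k, ω ∈ N.here (f k)},
      p.tupleDensity A B (fun k => N.loc (f k) ω) ∂P)

/-- The expected number of pairs with a given property for which no other point is bad. -/
theorem tsum_measure_pairEvent_inter_badSet_eq_empty {A : Set PairState} (hA : MeasurableSet A)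
    {B : Set (PairState × PointState)} (hB : MeasurableSet B) (hfin : p.pairMeasure A ≠ ∞)
    {c : ℝ} (hc : ∀ᵐ w ∂p.pairMeasure.restrict A, p.badMass B w ≤ ENNReal.ofReal c) :
    ∑' g, P (N.pairEvent A g ∩ {ω | N.badSet B g ω = ∅}) =
      ENNReal.ofReal p.lamW ^ 2 *
        ∫⁻ w in A, ENNReal.ofReal (Real.exp (-(p.badMass B w).toReal)) ∂p.pairMeasure := by
  classical
  have hM := p.measurable_badMass hB
  have hdiv : ∀ n : ℕ, ∑' g, ∫⁻ ω in N.pairEvent A g,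
      tupleCount (N.badSet B g ω) n / (n.factorial : ℝ≥0∞) ∂P = ENNReal.ofReal p.lamW ^ 2 *
        ∫⁻ w in A, p.badMass B w ^ n / (n.factorial : ℝ≥0∞) ∂p.pairMeasure := fun n => by
    simp_rw [div_eq_mul_inv]
    rw [lintegral_mul_const _ (hM.pow_const n), ← mul_assoc, ← N.tsum_lintegral_tupleCount hA hB,
      ← ENNReal.tsum_mul_right]
    exact tsum_congr fun g => lintegral_mul_const _ (N.measurable_tupleCount_badSet hB g n)
  have hTm : ∀ g n, Measurable fun ω => tupleCount (N.badSet B g ω) n / (n.factorial : ℝ≥0∞) :=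
    fun g n => (N.measurable_tupleCount_badSet hB g n).div_const _
  have hsum : ∀ s : ℕ → ℕ, ∑' g, ∫⁻ ω in N.pairEvent A g,
      ∑' k, tupleCount (N.badSet B g ω) (s k) / ((s k).factorial : ℝ≥0∞) ∂P =
      ENNReal.ofReal p.lamW ^ 2 * ∫⁻ w in A,
        ∑' k, p.badMass B w ^ (s k) / ((s k).factorial : ℝ≥0∞) ∂p.pairMeasure := fun s => by
    rw [lintegral_tsum fun k => ((hM.pow_const _).div_const _).aemeasurable,
      ← ENNReal.tsum_mul_left]
    simp_rw [← hdiv]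
    rw [ENNReal.tsum_comm]
    exact tsum_congr fun g => lintegral_tsum fun k => (hTm g _).aemeasurable
  have heven := hsum fun k => 2 * k
  have hodd := hsum fun k => 2 * k + 1
  -- Inclusion and exclusion pointwise: the even and the odd sum differ by the indicator that no
  -- point is bad.
  have hpair : ∀ g, ∫⁻ ω in N.pairEvent A g,
      ∑' k, tupleCount (N.badSet B g ω) (2 * k) / ((2 * k).factorial : ℝ≥0∞) ∂P =
      P (N.pairEvent A g ∩ {ω | N.badSet B g ω = ∅}) + ∫⁻ ω in N.pairEvent A g,
      ∑' k, tupleCount (N.badSet B g ω) (2 * k + 1) / ((2 * k + 1).factorial : ℝ≥0∞) ∂P := by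
    intro g
    have hm := N.measurableSet_badSet_eq_empty hB g
    have hi : Measurable ({ω | N.badSet B g ω = ∅}.indicator (1 : Ω → ℝ≥0∞)) :=
      measurable_one.indicator hm
    rw [Set.inter_comm, ← Measure.restrict_apply hm, ← lintegral_indicator_one hm,
      ← lintegral_add_left hi]
    refine lintegral_congr fun ω => ?_
    rw [tsum_tupleCount_even]
    rfl
  have hmass : ∀ᵐ w ∂p.pairMeasure.restrict A,
      ∃ x : ℝ, 0 ≤ x ∧ x ≤ max c 0 ∧ p.badMass B w = ENNReal.ofReal x := by
    filter_upwards [hc] with w hw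
    have hlt : p.badMass B w ≠ ∞ := (hw.trans_lt ENNReal.ofReal_lt_top).ne
    refine ⟨(p.badMass B w).toReal, ENNReal.toReal_nonneg, ?_, (ENNReal.ofReal_toReal hlt).symm⟩
    refine ENNReal.toReal_le_of_le_ofReal (le_max_right _ _) (hw.trans ?_)
    exact ENNReal.ofReal_le_ofReal (le_max_left _ _)
  -- The odd sum must be finite to be cancelled. It is at most sinh of the bound for the bad mass,
  -- times the finite measure of `A`; `max c 0` is needed since `c` may be negative.
  have hodd_ne : ENNReal.ofReal p.lamW ^ 2 * ∫⁻ w in A,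
      ∑' k, p.badMass B w ^ (2 * k + 1) / ((2 * k + 1).factorial : ℝ≥0∞) ∂p.pairMeasure ≠ ∞ := by
    refine ENNReal.mul_ne_top (ENNReal.pow_ne_top ENNReal.ofReal_ne_top) ?_
    have hle : ∫⁻ w in A,
        ∑' k, p.badMass B w ^ (2 * k + 1) / ((2 * k + 1).factorial : ℝ≥0∞) ∂p.pairMeasure ≤
        ∫⁻ _ in A, ENNReal.ofReal (Real.sinh (max c 0)) ∂p.pairMeasure := by
      refine lintegral_mono_ae ?_
      filter_upwards [hmass] with w ⟨x, hx0, hxc, hx⟩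
      rw [hx, tsum_pow_div_factorial_odd hx0]
      exact ENNReal.ofReal_le_ofReal (Real.sinh_le_sinh.2 hxc)
    refine (hle.trans_lt ?_).ne
    rw [setLIntegral_const]
    exact ENNReal.mul_lt_top ENNReal.ofReal_lt_top hfin.lt_top
  -- This is cosh x = exp(-x) + sinh x, integrated.
  have hexp : ∫⁻ w in A, ∑' k, p.badMass B w ^ (2 * k) / ((2 * k).factorial : ℝ≥0∞) ∂p.pairMeasure =
      ∫⁻ w in A, ENNReal.ofReal (Real.exp (-(p.badMass B w).toReal)) ∂p.pairMeasure + ∫⁻ w in A,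
        ∑' k, p.badMass B w ^ (2 * k + 1) / ((2 * k + 1).factorial : ℝ≥0∞) ∂p.pairMeasure := by
    rw [← lintegral_add_left (by fun_prop)]
    refine lintegral_congr_ae ?_
    filter_upwards [hmass] with w ⟨x, hx0, hxc, hx⟩
    simp only [hx]
    rw [tsum_pow_div_factorial_odd hx0, tsum_pow_div_factorial_even hx0,
      ENNReal.toReal_ofReal hx0, ← ENNReal.ofReal_add (Real.exp_nonneg _)
        (Real.sinh_nonneg_iff.2 hx0), ← Real.cosh_sub_sinh, sub_add_cancel]
  simp_rw [hpair] at heven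
  rw [ENNReal.tsum_add, hodd, hexp, mul_add] at heven
  exact (ENNReal.add_left_inj hodd_ne).1 heven

end Network

end Coexistence

/-! ### The Campbell events expressed by good pairs and bad points -/

namespace Coexistence

open scoped ENNReal

namespace Params

variable (p : Params)

/-- A transmitter of the given type (`true` for Wi-Fi) at `z` with fading `g` is received at `x`
above the detection threshold. -/
def Detects (b : Bool) (x z : Plane) (g : ℝ) : Prop :=
  (if b then p.Gcs / p.PW else p.Ged / p.PL) < g / p.pathLoss ‖z - x‖

/-- A transmitter silences the access point at `x` with timer `t`. -/
def Blocks (b : Bool) (x z : Plane) (t τ g : ℝ) : Prop :=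
  (b = true → τ < t) ∧ p.Detects b x z g

/-- The pairs, located in `S`, whose second access point is not closer to the origin, and which do
not silence the first access point (nor, if `both`, the second one). -/
def goodPairs (both : Bool) (S : Set (Plane × Plane)) : Set PairState :=
  {w | w.1 ∈ S ∧ w.1.2 ∉ Metric.ball (0 : Plane) ‖w.1.1‖ ∧
    ¬ p.Blocks true w.1.1 w.1.2 w.2.1.1 w.2.1.2 w.2.2.1 ∧
    (both = true → ¬ p.Blocks true w.1.2 w.1.1 w.2.1.2 w.2.1.1 w.2.2.2)}

/-- The points which are closer to the origin than the first access point, or silence it, or (if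
`both`) silence the second access point. -/
def badPoints (both : Bool) : Set (PairState × PointState) :=
  {v | (v.2.1.2 = true ∧ v.2.1.1 ∈ Metric.ball (0 : Plane) ‖v.1.1.1‖) ∨
    p.Blocks v.2.1.2 v.1.1.1 v.2.1.1 v.1.2.1.1 v.2.2.1 v.2.2.2.1 ∨
    (both = true ∧ p.Blocks v.2.1.2 v.1.1.2 v.2.1.1 v.1.2.1.2 v.2.2.1 v.2.2.2.2)}

theorem measurable_pathLoss : Measurable p.pathLoss := by unfold pathLoss; fun_prop

theorem measurableSet_blocks {α : Type*} [MeasurableSpace α] {b : α → Bool} {x z : α → Plane}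
    {t τ g : α → ℝ} (hb : Measurable b) (hx : Measurable x) (hz : Measurable z) (ht : Measurable t)
    (hτ : Measurable τ) (hg : Measurable g) :
    MeasurableSet {a | p.Blocks (b a) (x a) (z a) (t a) (τ a) (g a)} := by
  have hbs : MeasurableSet {a | b a = true} := hb (measurableSet_singleton true)
  have h1 : MeasurableSet {a | b a = true → τ a < t a} := by
    rw [show {a | b a = true → τ a < t a} = {a | b a = true}ᶜ ∪ {a | τ a < t a} by
      ext a; simp only [Set.mem_ofPred_eq, Set.mem_union, Set.mem_compl_iff]; tauto]
    exact hbs.compl.union (measurableSet_lt hτ ht)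
  have hl : Measurable fun a => g a / p.pathLoss ‖z a - x a‖ :=
    hg.div (p.measurable_pathLoss.comp (hz.sub hx).norm)
  have h2 : MeasurableSet {a | p.Detects (b a) (x a) (z a) (g a)} :=
    measurableSet_lt (Measurable.ite hbs measurable_const measurable_const) hl
  exact h1.inter h2

theorem measurableSet_badPoints (both : Bool) : MeasurableSet (p.badPoints both) := by
  refine MeasurableSet.union ?_ (MeasurableSet.union ?_ ((MeasurableSet.const _).inter ?_))
  · have h : MeasurableSet {v : PairState × PointState |
        v.2.1.1 ∈ Metric.ball (0 : Plane) ‖v.1.1.1‖} := by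
      simp only [Metric.mem_ball, dist_zero_right]
      exact measurableSet_lt measurable_snd.fst.fst.norm measurable_fst.fst.fst.norm
    exact (measurable_snd.fst.snd (measurableSet_singleton true)).inter h
  · exact p.measurableSet_blocks measurable_snd.fst.snd measurable_fst.fst.fst measurable_snd.fst.fst
      measurable_fst.snd.fst.fst measurable_snd.snd.fst measurable_snd.snd.snd.fst
  · exact p.measurableSet_blocks measurable_snd.fst.snd measurable_fst.fst.snd measurable_snd.fst.fst
      measurable_fst.snd.fst.snd measurable_snd.snd.fst measurable_snd.snd.snd.snd

theorem measurableSet_goodPairs (both : Bool) {S : Set (Plane × Plane)} (hS : MeasurableSet S) :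
    MeasurableSet (p.goodPairs both S) := by
  have h2 : MeasurableSet {w : PairState |
      ¬ p.Blocks true w.1.2 w.1.1 w.2.1.2 w.2.1.1 w.2.2.2} :=
    (p.measurableSet_blocks measurable_const measurable_fst.snd measurable_fst.fst
      measurable_snd.fst.snd measurable_snd.fst.fst measurable_snd.snd.snd).compl
  have h1 : MeasurableSet {w : PairState | w.1.2 ∈ Metric.ball (0 : Plane) ‖w.1.1‖} := by
    simp only [Metric.mem_ball, dist_zero_right]
    exact measurableSet_lt measurable_fst.snd.norm measurable_fst.fst.norm
  have h3 : MeasurableSet {w : PairState |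
      both = true → ¬ p.Blocks true w.1.2 w.1.1 w.2.1.2 w.2.1.1 w.2.2.2} := by
    cases both
    · simp
    · simpa only [true_imp_iff] using h2
  exact (measurable_fst hS).inter (h1.compl.inter ((p.measurableSet_blocks measurable_const
    measurable_fst.fst measurable_fst.snd measurable_snd.fst.fst measurable_snd.fst.snd
    measurable_snd.snd.fst).compl.inter h3))

end Params

namespace Network

variable {Ω : Type*} [MeasurableSpace Ω] {P : Measure Ω} {p : Params} (N : Network P p)

/-- The first access point is tagged and transmits, and, if `both`, the second one transmits. -/
def jointEvent (both : Bool) (i j : ℕ) : Set Ω :=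
  N.tagged i ∩ N.transmits i ∩ {ω | both = true → ω ∈ N.transmits j}

theorem mem_transmits_iff (i : ℕ) (ω : Ω) : ω ∈ N.transmits i ↔
    (∀ k : ℕ, (k : ℕ∞) < N.KL ω →
      ¬ p.Detects false (N.X i ω) (N.Y k ω) (N.GLW k i ω)) ∧
    ∀ k : ℕ, (k : ℕ∞) < N.KW ω → k ≠ i →
      ¬ p.Blocks true (N.X i ω) (N.X k ω) (N.t i ω) (N.t k ω) (N.GW k i ω) := by
  simp only [transmits, Params.Blocks, Params.Detects, Set.mem_ofPred_eq, not_lt, if_true,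
    Bool.false_eq_true, if_false, true_imp_iff, not_and]
  refine and_congr Iff.rfl (forall_congr' fun k => imp_congr_right fun _ => imp_congr_right fun _ => ?_)
  constructor
  · rintro (h | h) hlt
    · exact absurd hlt (not_lt.2 h)
    · exact h.2
  · intro h
    rcases le_or_gt (N.t i ω) (N.t k ω) with hle | hlt
    · exact Or.inl hle
    · exact Or.inr ⟨hlt, h hlt⟩

/-- The pair of access points with given indices. -/
def wifiPair (i j : ℕ) : Fin 2 → ℕ × Bool := ![(i, true), (j, true)]

/-- The quantifier over all APs in the events is split: the two members of the pair give the
conditions in `goodPairs`, all other points those in `badPoints`. -/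
theorem pairEvent_inter_badSet_eq_empty (both : Bool) (S : Set (Plane × Plane)) {i j : ℕ}
    (hij : i ≠ j) :
    N.pairEvent (p.goodPairs both S) (wifiPair i j) ∩
        {ω | N.badSet (p.badPoints both) (wifiPair i j) ω = ∅} =
      (fun ω => (N.X i ω, N.X j ω)) ⁻¹' S ∩
        (N.present i ∩ N.present j ∩ N.jointEvent both i j) := by
  have hinj : Function.Injective (wifiPair i j) := by
    intro a b h
    fin_cases a <;> fin_cases b <;> simp_all [wifiPair]
  ext ω
  have hbad : N.badSet (p.badPoints both) (wifiPair i j) ω = ∅ ↔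
      (∀ k : ℕ, (k : ℕ∞) < N.KW ω → k ≠ i → k ≠ j →
        N.X k ω ∉ Metric.ball (0 : Plane) ‖N.X i ω‖ ∧
        ¬ p.Blocks true (N.X i ω) (N.X k ω) (N.t i ω) (N.t k ω) (N.GW k i ω) ∧
        (both = true → ¬ p.Blocks true (N.X j ω) (N.X k ω) (N.t j ω) (N.t k ω) (N.GW k j ω))) ∧
      (∀ k : ℕ, (k : ℕ∞) < N.KL ω → ¬ p.Detects false (N.X i ω) (N.Y k ω) (N.GLW k i ω) ∧
        (both = true → ¬ p.Detects false (N.X j ω) (N.Y k ω) (N.GLW k j ω))) := by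
    rw [Set.eq_empty_iff_forall_notMem]
    constructor
    · refine fun h => ⟨fun k hk hki hkj => ?_, fun k hk => ?_⟩
      · have := h (k, true)
        simp [badSet, Params.badPoints, here, hk, hki, hkj, pairState, loc, wifiPair, pairMarks,
          pointMarks] at this ⊢
        tauto
      · have := h (k, false)
        simp [badSet, Params.badPoints, here, hk, pairState, loc, wifiPair, pairMarks,
          pointMarks, Params.Blocks] at this ⊢
        tauto
    · rintro ⟨hW, hL⟩ ⟨k, b⟩
      cases b
      · have := hL k
        simp [badSet, Params.badPoints, here, pairState, loc, wifiPair, pairMarks,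
          pointMarks, Params.Blocks] at this ⊢
        tauto
      · have := hW k
        simp [badSet, Params.badPoints, here, pairState, loc, wifiPair, pairMarks,
          pointMarks] at this ⊢
        tauto
  have hpair : ω ∈ N.pairEvent (p.goodPairs both S) (wifiPair i j) ↔
      ((i : ℕ∞) < N.KW ω ∧ (j : ℕ∞) < N.KW ω) ∧ (N.X i ω, N.X j ω) ∈ S ∧
      N.X j ω ∉ Metric.ball (0 : Plane) ‖N.X i ω‖ ∧
      ¬ p.Blocks true (N.X i ω) (N.X j ω) (N.t i ω) (N.t j ω) (N.GW j i ω) ∧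
      (both = true → ¬ p.Blocks true (N.X j ω) (N.X i ω) (N.t j ω) (N.t i ω) (N.GW i j ω)) := by
    simp only [pairEvent, Set.mem_ofPred_eq, hinj, true_and, Fin.forall_fin_two]
    simp [wifiPair, here, Params.goodPairs, pairState, loc, pairMarks]
  rw [Set.mem_inter_iff, hpair, Set.mem_ofPred_eq, hbad]
  simp only [Set.mem_inter_iff, Set.mem_preimage, present, jointEvent, Set.mem_ofPred_eq, tagged,
    mem_transmits_iff]
  constructor
  · rintro ⟨⟨⟨hi, hj⟩, hS, h1, h2, h3⟩, hW, hL⟩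
    refine ⟨hS, ⟨hi, hj⟩, ⟨fun k hk => ?_, fun k hk => (hL k hk).1, fun k hk hki => ?_⟩,
      fun hb => ⟨fun k hk => (hL k hk).2 hb, fun k hk hkj => ?_⟩⟩
    · by_cases hki : k = i
      -- The tagged AP does not lie in its own open ball.
      · subst hki; simp
      · by_cases hkj : k = j
        · subst hkj; exact h1
        · exact (hW k hk hki hkj).1
    · by_cases hkj : k = j
      · subst hkj; exact h2
      · exact (hW k hk hki hkj).2.1
    · by_cases hki : k = i
      · subst hki; exact h3 hb
      · exact (hW k hk hki hkj).2.2 hb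
  · rintro ⟨hS, ⟨hi, hj⟩, ⟨ht, hL, hW⟩, hb⟩
    exact ⟨⟨⟨hi, hj⟩, hS, ht j hj, hW j hj hij.symm, fun h => (hb h).2 i hi hij⟩,
      fun k hk hki hkj => ⟨ht k hk, hW k hk hki, fun h => (hb h).2 k hk hkj⟩,
      fun k hk => ⟨hL k hk, fun h => (hb h).1 k hk⟩⟩

theorem campbell_jointEvent_apply (both : Bool) {S : Set (Plane × Plane)} (hS : MeasurableSet S) :
    N.campbell (N.jointEvent both) S = ∑' g, P (N.pairEvent (p.goodPairs both S) g ∩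
      {ω | N.badSet (p.badPoints both) g ω = ∅}) := by
  rw [campbell, Measure.sum_apply _ hS]
  have hinj : Function.Injective fun q : {q : ℕ × ℕ // q.1 ≠ q.2} => wifiPair q.1.1 q.1.2 := by
    intro q r h
    have h0 := congrFun h 0
    have h1 := congrFun h 1
    simp only [wifiPair, Matrix.cons_val_zero, Matrix.cons_val_one, Prod.mk.injEq, and_true]
      at h0 h1
    exact Subtype.ext (Prod.ext h0 h1)
  rw [← hinj.tsum_eq]
  · refine tsum_congr fun q => ?_
    have hm : Measurable fun ω => (N.X q.1.1 ω, N.X q.1.2 ω) :=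
      (N.poissonW.measurable_point _).prodMk (N.poissonW.measurable_point _)
    rw [Measure.map_apply hm hS, Measure.restrict_apply (hm hS),
      N.pairEvent_inter_badSet_eq_empty both S q.2]
  -- Index pairs which do not consist of two distinct Wi-Fi indices contribute nothing, so the sum
  -- may range over all functions on `Fin 2`.
  · intro g hg
    rw [Function.mem_support] at hg
    obtain ⟨ω, hω, -⟩ := nonempty_of_measure_ne_zero hg
    have hg' : ∀ k : Fin 2, g k = ((g k).1, true) := fun k => by
      fin_cases k
      · exact Prod.ext rfl hω.2.1.1
      · exact Prod.ext rfl hω.2.1.2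
    refine ⟨⟨((g 0).1, (g 1).1), fun h => ?_⟩, ?_⟩
    · have := hω.1 ((hg' 0).trans ((congrArg (fun n => (n, true)) h).trans (hg' 1).symm))
      simp at this
    · funext k
      fin_cases k
      · exact (hg' 0).symm
      · exact (hg' 1).symm

theorem campbellTagged_eq : N.campbellTagged = N.campbell (N.jointEvent false) := by
  have : N.jointEvent false = fun i _ => N.tagged i ∩ N.transmits i := by
    funext i j; simp [jointEvent]
  rw [this, campbellTagged]

theorem campbellBoth_eq : N.campbellBoth = N.campbell (N.jointEvent true) := by
  have : N.jointEvent true = fun i j => N.tagged i ∩ N.transmits i ∩ N.transmits j := by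
    funext i j; simp [jointEvent]
  rw [this, campbellBoth]

end Network

end Coexistence

/-! ### The mean number of bad points -/

namespace Coexistence

open scoped ENNReal

/-- The probability that the timer constraint of a blocking point of the given type holds. -/
def timerProb (b : Bool) (t : ℝ) : ℝ := if b then t else 1

theorem timerProb_nonneg (b : Bool) {t : ℝ} (ht : 0 ≤ t) : 0 ≤ timerProb b t := by
  cases b <;> simp [timerProb, ht]

namespace Params

variable (p : Params)

theorem continuous_pathLoss : Continuous p.pathLoss := by
  unfold pathLoss
  exact continuous_const.mul (Real.continuous_rpow_const p.alpha_pos.le)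

theorem pathLoss_pos {d : ℝ} (hd : 0 < d) : 0 < p.pathLoss d := by
  have := p.wavelength_pos
  have := Real.pi_pos
  unfold pathLoss
  positivity

theorem pathLoss_nonneg {d : ℝ} (hd : 0 ≤ d) : 0 ≤ p.pathLoss d := by
  unfold pathLoss
  positivity

/-- The detection threshold, relative to the transmit power. -/
noncomputable def threshold (b : Bool) : ℝ := if b then p.Gcs / p.PW else p.Ged / p.PL

theorem threshold_pos (b : Bool) : 0 < p.threshold b := by
  cases b
  · exact div_pos p.Ged_pos p.PL_pos
  · exact div_pos p.Gcs_pos p.PW_pos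

/-- The probability that a transmitter at `z` is detected at `x`. -/
noncomputable def rx (b : Bool) (x z : Plane) : ℝ :=
  Real.exp (-p.mu * p.threshold b * p.pathLoss ‖z - x‖)

theorem rx_pos (b : Bool) (x z : Plane) : 0 < p.rx b x z := Real.exp_pos _

theorem rx_le_one (b : Bool) (x z : Plane) : p.rx b x z ≤ 1 := by
  have h1 := mul_nonneg (mul_nonneg p.mu_pos.le (p.threshold_pos b).le)
    (p.pathLoss_nonneg (norm_nonneg (z - x)))
  refine Real.exp_le_one_iff.2 ?_
  linarith

theorem rx_lt_one (b : Bool) {x z : Plane} (h : z ≠ x) : p.rx b x z < 1 := by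
  have h1 := mul_pos (mul_pos p.mu_pos (p.threshold_pos b))
    (p.pathLoss_pos (norm_pos_iff.2 (sub_ne_zero.2 h)))
  refine Real.exp_lt_one_iff.2 ?_
  linarith

theorem continuous_rx (b : Bool) : Continuous fun q : Plane × Plane => p.rx b q.1 q.2 := by
  have := p.continuous_pathLoss
  unfold rx
  fun_prop

theorem measurable_rx (b : Bool) (x : Plane) : Measurable (p.rx b x) :=
  ((p.measurable_pathLoss.comp (measurable_id.sub_const x).norm).const_mul _).exp

/-- After centring at x the function is radial; in polar coordinates it becomes r exp(-c r^α), which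
is integrable because α > 0. -/
theorem integrable_rx (b : Bool) (x : Plane) : Integrable (p.rx b x) := by
  have hc : 0 < p.mu * p.threshold b * (4 * Real.pi / p.wavelength) ^ 2 := by
    have h1 := p.mu_pos
    have h2 := p.threshold_pos b
    have h3 := p.wavelength_pos
    have := Real.pi_pos
    positivity
  have h0 : Integrable fun z : Plane => p.rx b 0 z := by
    have h := (integrable_fun_norm_addHaar (volume : Measure Plane) (F := ℝ)
      (f := fun r => Real.exp (-(p.mu * p.threshold b * (4 * Real.pi / p.wavelength) ^ 2)
        * r ^ p.alpha))).2 ?_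
    · refine h.congr (Eventually.of_forall fun z => ?_)
      simp only [rx, pathLoss, sub_zero]
      congr 1
      ring
    · simpa using integrableOn_rpow_mul_exp_neg_mul_rpow (p := p.alpha) (s := 1) (by norm_num)
        p.alpha_pos hc
  have e : (fun z => p.rx b 0 (z - x)) = p.rx b x := by
    funext z
    simp only [rx, sub_zero]
  exact e ▸ h0.comp_sub_right x

theorem integrable_rx_mul_rx (b : Bool) (x y : Plane) :
    Integrable fun z => p.rx b x z * p.rx b y z :=
  (p.integrable_rx b x).mul_bdd (c := 1) (p.measurable_rx b y).aestronglyMeasurable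
    (Eventually.of_forall fun z => by
      rw [Real.norm_of_nonneg (p.rx_pos b y z).le]; exact p.rx_le_one b y z)

theorem expMeasure_Ioi {c : ℝ} (hc : 0 ≤ c) :
    (expMeasure p.mu).real (Set.Ioi c) = Real.exp (-(p.mu * c)) := by
  have h := cdf_expMeasure_eq p.mu_pos c
  rw [cdf_eq_real, if_pos hc] at h
  rw [← Set.compl_Iic, probReal_compl_eq_one_sub measurableSet_Iic, h]
  ring

theorem setOf_detects (b : Bool) {x z : Plane} (h : z ≠ x) :
    {g | p.Detects b x z g} = Set.Ioi (p.threshold b * p.pathLoss ‖z - x‖) := by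
  ext g
  exact lt_div_iff₀ (p.pathLoss_pos (norm_pos_iff.2 (sub_ne_zero.2 h)))

theorem expMeasure_detects (b : Bool) {x z : Plane} (h : z ≠ x) :
    (expMeasure p.mu).real {g | p.Detects b x z g} = p.rx b x z := by
  rw [p.setOf_detects b h, p.expMeasure_Ioi (mul_nonneg (p.threshold_pos b).le
    (p.pathLoss_nonneg (norm_nonneg _))), rx]
  congr 1
  ring

theorem measurableSet_detects (b : Bool) (x z : Plane) : MeasurableSet {g | p.Detects b x z g} :=
  measurableSet_lt measurable_const (measurable_id.div_const _)

/-- The law of the timer of a point of the given type. -/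
noncomputable def pointTimerLaw (b : Bool) : Measure ℝ := if b then timerLaw else Measure.dirac 0

instance (b : Bool) : IsProbabilityMeasure (pointTimerLaw b) := by
  unfold pointTimerLaw; cases b <;> simp <;> infer_instance

theorem pointTimerLaw_setOf (b : Bool) {t : ℝ} (ht : t ∈ Set.Icc (0 : ℝ) 1) :
    (pointTimerLaw b).real {τ | b = true → τ < t} = timerProb b t := by
  cases b
  · simp [timerProb]
  · simp only [pointTimerLaw, if_true, timerProb, true_imp_iff, timerLaw]
    rw [show {τ : ℝ | τ < t} = Set.Iio t from rfl, measureReal_restrict_apply measurableSet_Iio,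
      show Set.Iio t ∩ Set.Icc 0 1 = Set.Ico 0 t by
        ext τ
        simp only [Set.mem_inter_iff, Set.mem_Iio, Set.mem_Icc, Set.mem_Ico]
        exact ⟨fun h => ⟨h.2.1, h.1⟩, fun h => ⟨h.2, h.1, h.2.le.trans ht.2⟩⟩,
      Real.volume_real_Ico_of_le ht.1, sub_zero]

/-- The probability that a point silences one of the access points (only the first one, unless
`both`). -/
noncomputable def blockProb (both b : Bool) (q : Plane × Plane) (t : ℝ × ℝ) (z : Plane) : ℝ :=
  timerProb b t.1 * p.rx b q.1 z + if both then timerProb b t.2 * p.rx b q.2 z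
    - timerProb b (min t.1 t.2) * (p.rx b q.1 z * p.rx b q.2 z) else 0

/-- Inclusion and exclusion for two events. The fadings towards the two APs are independent, but the
timer of the point is shared, so both timer constraints hold exactly when it is below the minimum.
-/
theorem pointLaw_blocks (both b : Bool) {q : Plane × Plane} {t : ℝ × ℝ} {z : Plane}
    (h1 : t.1 ∈ Set.Icc (0 : ℝ) 1) (h2 : t.2 ∈ Set.Icc (0 : ℝ) 1) (hz1 : z ≠ q.1) (hz2 : z ≠ q.2) :
    (p.pointLaw b).real {y | p.Blocks b q.1 z t.1 y.1 y.2.1 ∨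
      (both = true ∧ p.Blocks b q.2 z t.2 y.1 y.2.2)} = p.blockProb both b q t z := by
  let T : ℝ → Set ℝ := fun s => {τ | b = true → τ < s}
  let D : Plane → Set ℝ := fun x => {g | p.Detects b x z g}
  have hT : ∀ s, MeasurableSet (T s) := fun s => by
    cases b
    · simp [T]
    · simp only [T, true_imp_iff]
      exact measurableSet_Iio
  have hD : ∀ x, MeasurableSet (D x) := fun x => p.measurableSet_detects b x z
  have hlaw : p.pointLaw b = (pointTimerLaw b).prod ((expMeasure p.mu).prod (expMeasure p.mu)) := rfl
  have e1 : {y : PointMarks | p.Blocks b q.1 z t.1 y.1 y.2.1} = T t.1 ×ˢ (D q.1 ×ˢ Set.univ) := by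
    ext y; simp [Blocks, T, D]
  have e2 : {y : PointMarks | p.Blocks b q.2 z t.2 y.1 y.2.2} = T t.2 ×ˢ (Set.univ ×ˢ D q.2) := by
    ext y; simp [Blocks, T, D]
  have m1 : (p.pointLaw b).real (T t.1 ×ˢ (D q.1 ×ˢ Set.univ)) =
      timerProb b t.1 * p.rx b q.1 z := by
    rw [hlaw, measureReal_prod_prod, measureReal_prod_prod, pointTimerLaw_setOf b h1,
      p.expMeasure_detects b hz1, probReal_univ, mul_one]
  cases both
  · simp only [Bool.false_eq_true, false_and, or_false, blockProb, if_false, add_zero]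
    rw [e1, m1]
  · have m2 : (p.pointLaw b).real (T t.2 ×ˢ (Set.univ ×ˢ D q.2)) =
        timerProb b t.2 * p.rx b q.2 z := by
      rw [hlaw, measureReal_prod_prod, measureReal_prod_prod, pointTimerLaw_setOf b h2,
        p.expMeasure_detects b hz2, probReal_univ, one_mul]
    have hTT : T t.1 ∩ T t.2 = T (min t.1 t.2) := by
      ext τ
      simp only [T, Set.mem_inter_iff, Set.mem_ofPred_eq, lt_min_iff, ← imp_and]
    have m12 : (p.pointLaw b).real (T t.1 ×ˢ (D q.1 ×ˢ Set.univ) ∩ T t.2 ×ˢ (Set.univ ×ˢ D q.2)) =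
        timerProb b (min t.1 t.2) * (p.rx b q.1 z * p.rx b q.2 z) := by
      rw [Set.prod_inter_prod, Set.prod_inter_prod, Set.inter_univ, Set.univ_inter,
        hTT,
        hlaw, measureReal_prod_prod, measureReal_prod_prod, pointTimerLaw_setOf b
          ⟨le_min h1.1 h2.1, (min_le_left _ _).trans h1.2⟩, p.expMeasure_detects b hz1,
        p.expMeasure_detects b hz2]
    have hu := measureReal_union_add_inter (μ := p.pointLaw b)
      (s := T t.1 ×ˢ (D q.1 ×ˢ Set.univ)) ((hT t.2).prod (MeasurableSet.univ.prod (hD q.2)))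
    rw [m1, m2, m12] at hu
    simp only [true_and, blockProb, if_true]
    rw [Set.ofPred_or, e1, e2]
    linarith

theorem blockProb_nonneg (both b : Bool) (q : Plane × Plane) {t : ℝ × ℝ} (z : Plane)
    (h1 : 0 ≤ t.1) (h2 : 0 ≤ t.2) : 0 ≤ p.blockProb both b q t z := by
  have a1 := timerProb_nonneg b h1
  have hx := p.rx_pos b q.1 z
  refine add_nonneg (mul_nonneg a1 hx.le) ?_
  split_ifs
  · have hm : timerProb b (min t.1 t.2) ≤ timerProb b t.2 := by
      cases b
      · exact le_rfl
      · exact min_le_right _ _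
    have hy := p.rx_pos b q.2 z
    have h3 := p.rx_le_one b q.1 z
    -- The subtracted joint term is dominated by the term of the second access point.
    have h4 : p.rx b q.1 z * p.rx b q.2 z ≤ p.rx b q.2 z := mul_le_of_le_one_left hy.le h3
    have := mul_le_mul hm h4 (by positivity) (timerProb_nonneg b h2)
    linarith
  · exact le_rfl

theorem integrable_blockProb (both b : Bool) (q : Plane × Plane) (t : ℝ × ℝ) :
    Integrable (p.blockProb both b q t) := by
  unfold blockProb
  refine ((p.integrable_rx b q.1).const_mul _).add ?_
  cases both
  · simp
  · simp only [if_true]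
    exact ((p.integrable_rx b q.2).const_mul _).sub ((p.integrable_rx_mul_rx b q.1 q.2).const_mul _)

open Classical in
theorem badProb_badPoints (both b : Bool) {w : PairState} {z : Plane}
    (h1 : w.2.1.1 ∈ Set.Icc (0 : ℝ) 1) (h2 : w.2.1.2 ∈ Set.Icc (0 : ℝ) 1) (hz1 : z ≠ w.1.1)
    (hz2 : z ≠ w.1.2) :
    p.badProb (p.badPoints both) w (z, b) =
      if b = true ∧ z ∈ Metric.ball (0 : Plane) ‖w.1.1‖ then 1
      else ENNReal.ofReal (p.blockProb both b w.1 w.2.1 z) := by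
  rw [badProb]
  split_ifs with h
  · rw [show {y | (w, ((z, b), y)) ∈ p.badPoints both} = Set.univ from
      Set.eq_univ_of_forall fun y => Or.inl h, measure_univ]
  · rw [← p.pointLaw_blocks both b h1 h2 hz1 hz2, ofReal_measureReal]
    congr 1
    ext y
    exact or_iff_right h

/-- The expected number of bad points. -/
noncomputable def meanBad (both : Bool) (q : Plane × Plane) (t : ℝ × ℝ) : ℝ :=
  p.lamW * (volume.real (Metric.ball (0 : Plane) ‖q.1‖) +
    ∫ z in (Metric.closedBall (0 : Plane) ‖q.1‖)ᶜ, p.blockProb both true q t z) +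
  p.lamL * ∫ z, p.blockProb both false q t z

theorem badMass_badPoints (both : Bool) {w : PairState}
    (h1 : w.2.1.1 ∈ Set.Icc (0 : ℝ) 1) (h2 : w.2.1.2 ∈ Set.Icc (0 : ℝ) 1) :
    p.badMass (p.badPoints both) w = ENNReal.ofReal (p.meanBad both w.1 w.2.1) := by
  -- Points at the location of a receiver are excluded because the path loss vanishes there; they
  -- form a null set.
  have hne : ∀ x : Plane, ∀ᵐ z : Plane, z ≠ x := fun x => by
    rw [ae_iff]; simp
  have hb : ∀ b, Measurable fun z => p.badProb (p.badPoints both) w (z, b) := fun b =>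
    (p.measurable_badProb (p.measurableSet_badPoints both)).comp
      (measurable_const.prodMk measurable_prodMk_right)
  have hnn : ∀ b z, 0 ≤ p.blockProb both b w.1 w.2.1 z := fun b z =>
    p.blockProb_nonneg both b _ z h1.1 h2.1
  have hint := fun b => p.integrable_blockProb both b w.1 w.2.1
  rw [badMass, p.lintegral_intensity (f := p.badProb (p.badPoints both) w)
    ((p.measurable_badProb (p.measurableSet_badPoints both)).comp measurable_prodMk_left)]
  have hL : ∫⁻ z, p.badProb (p.badPoints both) w (z, false) =
      ENNReal.ofReal (∫ z, p.blockProb both false w.1 w.2.1 z) := by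
    rw [ofReal_integral_eq_lintegral_ofReal (hint false) (Eventually.of_forall (hnn false))]
    refine lintegral_congr_ae ?_
    filter_upwards [hne w.1.1, hne w.1.2] with z hz1 hz2
    rw [p.badProb_badPoints both false h1 h2 hz1 hz2]
    simp
  have hW : ∫⁻ z, p.badProb (p.badPoints both) w (z, true) =
      ENNReal.ofReal (volume.real (Metric.ball (0 : Plane) ‖w.1.1‖) +
    ∫ z in (Metric.closedBall (0 : Plane) ‖w.1.1‖)ᶜ, p.blockProb both true w.1 w.2.1 z) := by
    rw [ENNReal.ofReal_add measureReal_nonneg (integral_nonneg (hnn true)), ofReal_measureReal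
      measure_ball_lt_top.ne, ofReal_integral_eq_lintegral_ofReal (hint true).integrableOn
      (Eventually.of_forall (hnn true)),
      ← lintegral_add_compl _ (measurableSet_ball (x := (0 : Plane)) (ε := ‖w.1.1‖))]
    congr 1
    · rw [← setLIntegral_one]
      refine lintegral_congr_ae ?_
      filter_upwards [ae_restrict_of_ae (hne w.1.1), ae_restrict_of_ae (hne w.1.2),
        ae_restrict_mem measurableSet_ball] with z hz1 hz2 hz
      rw [p.badProb_badPoints both true h1 h2 hz1 hz2, if_pos ⟨rfl, hz⟩]
    -- The tagging condition involves the open ball, while the functions N and C use the closed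
    -- ball; the sphere between them is null.
    · have hae : (Metric.ball (0 : Plane) ‖w.1.1‖)ᶜ =ᵐ[volume]
          (Metric.closedBall (0 : Plane) ‖w.1.1‖)ᶜ := by
        refine ae_eq_set_compl_compl.2 ?_
        refine (ae_eq_of_subset_of_measure_ge Metric.ball_subset_closedBall ?_
          measurableSet_ball.nullMeasurableSet measure_closedBall_lt_top.ne)
        rw [Measure.addHaar_closedBall_eq_addHaar_ball]
      refine Eq.trans ?_ (setLIntegral_congr hae)
      refine lintegral_congr_ae ?_
      filter_upwards [ae_restrict_of_ae (hne w.1.1), ae_restrict_of_ae (hne w.1.2),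
        ae_restrict_mem measurableSet_ball.compl] with z hz1 hz2 hz
      rw [p.badProb_badPoints both true h1 h2 hz1 hz2, if_neg fun h => hz h.2]
  rw [hL, hW]
  rw [← ENNReal.ofReal_mul p.lamW_pos.le, ← ENNReal.ofReal_mul p.lamL_nonneg, ← ENNReal.ofReal_add]
  · rfl
  · exact mul_nonneg p.lamW_pos.le (add_nonneg measureReal_nonneg (integral_nonneg (hnn true)))
  · exact mul_nonneg p.lamL_nonneg (integral_nonneg (hnn false))

end Params

end Coexistence

/-! ### Identification with the functions N and C, positivity and continuity -/

namespace Coexistence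

open scoped ENNReal

namespace Params

variable (p : Params)

theorem NW0_eq (y : Plane) (r : ℝ) : p.NW0 y r p.Gcs =
    p.lamW * ∫ z in (Metric.closedBall (0 : Plane) r)ᶜ, p.rx true y z := by
  simp only [NW0, rx, threshold, if_true]

theorem NL_eq (x : Plane) : p.NL = p.lamL * ∫ z, p.rx false x z := by
  have hae : ((Metric.closedBall (0 : Plane) 0)ᶜ : Set Plane) =ᵐ[volume] Set.univ := by
    rw [Metric.closedBall_zero, ae_eq_univ, compl_compl, measure_singleton]
  rw [NL, NL0, setIntegral_congr_set hae, setIntegral_univ]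
  simp only [rx, threshold, Bool.false_eq_true, if_false, sub_zero]
  rw [integral_sub_right_eq_self
    (fun z : Plane => Real.exp (-p.mu * (p.Ged / p.PL) * p.pathLoss ‖z‖)) x]

theorem CW1_eq (x y : Plane) : p.CW1 x y =
    p.lamW * ∫ z in (Metric.closedBall (0 : Plane) ‖y‖)ᶜ, p.rx true y z * p.rx true x z := by
  simp only [CW1, CW0, rx, threshold, if_true, ← Real.exp_add]
  congr 2
  funext z
  congr 1
  ring

theorem CL2_eq_set (y : Plane) : p.CL2 y =
    p.lamL * ∫ z in (Metric.closedBall (0 : Plane) 0)ᶜ, p.rx false y z * p.rx false 0 z := by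
  simp only [CL2, CL0, rx, threshold, Bool.false_eq_true, if_false, ← Real.exp_add, norm_zero]
  congr 2
  funext z
  congr 1
  ring

/-- Translation invariance, after discarding the null set formed by the closed ball of radius 0. -/
theorem CL2_eq (x y : Plane) : p.CL2 (y - x) =
    p.lamL * ∫ z, p.rx false x z * p.rx false y z := by
  have hae : ((Metric.closedBall (0 : Plane) 0)ᶜ : Set Plane) =ᵐ[volume] Set.univ := by
    rw [Metric.closedBall_zero, ae_eq_univ, compl_compl, measure_singleton]
  rw [CL2_eq_set, setIntegral_congr_set hae, setIntegral_univ, ← integral_sub_right_eq_self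
    (fun z : Plane => p.rx false (y - x) z * p.rx false 0 z) x]
  simp only [rx, sub_zero, sub_sub_sub_cancel_right]
  congr 2
  funext z
  ring

/-- The part of the mean number of bad points which does not depend on the timers, for the first
access point alone. -/
noncomputable def baseMass (q : Plane × Plane) : ℝ :=
  p.lamW * volume.real (Metric.ball (0 : Plane) ‖q.1‖) + p.NL

theorem meanBad_false (q : Plane × Plane) (t : ℝ × ℝ) :
    p.meanBad false q t = p.baseMass q + t.1 * p.NW0 q.1 ‖q.1‖ p.Gcs := by
  have h1 : ∀ b z, p.blockProb false b q t z = timerProb b t.1 * p.rx b q.1 z := fun b z => by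
    simp [blockProb]
  simp only [meanBad, h1, integral_const_mul, baseMass, p.NL_eq q.1, p.NW0_eq]
  simp only [timerProb, if_true, Bool.false_eq_true, if_false]
  ring

theorem meanBad_true (q : Plane × Plane) (t : ℝ × ℝ) :
    p.meanBad true q t = p.baseMass q + (p.NL - p.CL2 (q.2 - q.1)) +
      (t.1 * p.NW0 q.1 ‖q.1‖ p.Gcs + t.2 * p.NW0 q.2 ‖q.1‖ p.Gcs -
        min t.1 t.2 * p.CW1 q.2 q.1) := by
  have h1 : ∀ b, p.blockProb true b q t = fun z => timerProb b t.1 * p.rx b q.1 z +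
      (timerProb b t.2 * p.rx b q.2 z -
      timerProb b (min t.1 t.2) * (p.rx b q.1 z * p.rx b q.2 z)) := fun b => by
    funext z; simp [blockProb]
  have h2 : ∀ b (μ : Measure Plane), μ ≤ volume → ∫ z, p.blockProb true b q t z ∂μ =
      timerProb b t.1 * (∫ z, p.rx b q.1 z ∂μ) + (timerProb b t.2 * (∫ z, p.rx b q.2 z ∂μ) -
        timerProb b (min t.1 t.2) * ∫ z, p.rx b q.1 z * p.rx b q.2 z ∂μ) := fun b μ hμ => by
    have i1 := ((p.integrable_rx b q.1).mono_measure hμ).const_mul (timerProb b t.1)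
    have i2 := ((p.integrable_rx b q.2).mono_measure hμ).const_mul (timerProb b t.2)
    have i3 := ((p.integrable_rx_mul_rx b q.1 q.2).mono_measure hμ).const_mul
      (timerProb b (min t.1 t.2))
    have i23 : Integrable (fun z => timerProb b t.2 * p.rx b q.2 z -
        timerProb b (min t.1 t.2) * (p.rx b q.1 z * p.rx b q.2 z)) μ := i2.sub i3
    simp only [h1]
    rw [integral_add i1 i23, integral_sub i2 i3, integral_const_mul, integral_const_mul,
      integral_const_mul]
  rw [meanBad, h2 true _ Measure.restrict_le_self, h2 false _ le_rfl]
  have e1 := p.NL_eq q.1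
  have e2 := p.NL_eq q.2
  simp only [baseMass, p.NW0_eq, p.CW1_eq, p.CL2_eq]
  simp only [timerProb, if_true, Bool.false_eq_true, if_false]
  -- Each of the two APs contributes one N^L: one is contained in `baseMass`, the other in N^L -
  -- C^L_2.
  linear_combination (-1 : ℝ) * e1 - e2

theorem setIntegral_compl_closedBall_pos {f : Plane → ℝ} (hf : Integrable f) (r : ℝ) (y : Plane)
    (h0 : ∀ z, 0 ≤ f z) (hpos : ∀ z, z ≠ y → 0 < f z) :
    0 < ∫ z in (Metric.closedBall (0 : Plane) r)ᶜ, f z := by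
  rw [integral_pos_iff_support_of_nonneg h0 hf.integrableOn]
  have hopen : IsOpen ((Metric.closedBall (0 : Plane) r)ᶜ ∩ {y}ᶜ) :=
    Metric.isClosed_closedBall.isOpen_compl.inter isOpen_compl_singleton
  have hne : ((Metric.closedBall (0 : Plane) r)ᶜ ∩ {y}ᶜ).Nonempty := by
    obtain ⟨v, hv⟩ := NormedSpace.exists_lt_norm ℝ Plane (max r ‖y‖)
    refine ⟨v, fun h => ?_, fun h => ?_⟩
    · exact absurd (mem_closedBall_zero_iff.1 h) (not_le.2 ((le_max_left _ _).trans_lt hv))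
    · rw [Set.mem_singleton_iff.1 h] at hv
      exact absurd hv (not_lt.2 (le_max_right _ _))
  rw [Measure.restrict_apply' measurableSet_closedBall.compl]
  refine (hopen.measure_pos volume hne).trans_le (measure_mono fun z hz => ⟨?_, hz.1⟩)
  exact (hpos z hz.2).ne'

theorem NW0_pos (y : Plane) (r : ℝ) : 0 < p.NW0 y r p.Gcs := by
  rw [NW0_eq]
  exact mul_pos p.lamW_pos (setIntegral_compl_closedBall_pos (p.integrable_rx _ _) r y
    (fun z => (p.rx_pos _ _ z).le) fun z _ => p.rx_pos _ _ z)

/-- The difference of the integrands is positive except at y, as detection at any positive distance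
has probability less than one. This strictness keeps the denominators of `M` away from zero. -/
theorem setIntegral_rx_mul_rx_lt (x y : Plane) (r : ℝ) :
    ∫ z in (Metric.closedBall (0 : Plane) r)ᶜ, p.rx true x z * p.rx true y z <
      ∫ z in (Metric.closedBall (0 : Plane) r)ᶜ, p.rx true x z := by
  rw [← sub_pos, ← integral_sub (p.integrable_rx _ _).integrableOn
    (p.integrable_rx_mul_rx _ _ _).integrableOn]
  refine setIntegral_compl_closedBall_pos
    ((p.integrable_rx _ _).sub (p.integrable_rx_mul_rx _ _ _)) r y (fun z => ?_) fun z hz => ?_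
  · have h1 := p.rx_pos true x z
    have h2 := p.rx_le_one true y z
    simp only [Pi.sub_apply]
    nlinarith
  · have h1 := p.rx_pos true x z
    have h2 := p.rx_lt_one true hz
    simp only [Pi.sub_apply]
    nlinarith

theorem CW1_lt_left (x y : Plane) : p.CW1 x y < p.NW0 y ‖y‖ p.Gcs := by
  rw [CW1_eq, NW0_eq]
  exact mul_lt_mul_of_pos_left (p.setIntegral_rx_mul_rx_lt y x _) p.lamW_pos

theorem CW1_lt_right (x y : Plane) : p.CW1 x y < p.NW0 x ‖y‖ p.Gcs := by
  rw [CW1_eq, NW0_eq]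
  simp_rw [mul_comm (p.rx true y _)]
  exact mul_lt_mul_of_pos_left (p.setIntegral_rx_mul_rx_lt x y _) p.lamW_pos

/-- Rotation invariance. -/
theorem NW2_norm (x : Plane) : p.NW2 ‖x‖ = p.NW0 x ‖x‖ p.Gcs := by
  have hn : ‖(!₂[‖x‖, 0] : Plane)‖ = ‖x‖ := by simp [EuclideanSpace.norm_eq]
  rw [NW2, NW0_eq, NW0_eq]
  -- The reflection in the bisector of x and (‖x‖, 0) exchanges these two points and preserves
  -- centred balls and Lebesgue measure.
  let e : Plane ≃ₗᵢ[ℝ] Plane := (Submodule.span ℝ {x - !₂[‖x‖, 0]})ᗮ.reflection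
  have he : e x = !₂[‖x‖, 0] := Submodule.reflection_sub hn.symm
  have hpre : e ⁻¹' (Metric.closedBall (0 : Plane) ‖x‖)ᶜ = (Metric.closedBall (0 : Plane) ‖x‖)ᶜ := by
    ext z; simp
  have h := e.measurePreserving.setIntegral_preimage_emb e.toHomeomorph.measurableEmbedding
    (p.rx true !₂[‖x‖, 0]) (Metric.closedBall (0 : Plane) ‖x‖)ᶜ
  rw [← h, hpre]
  congr 2
  funext z
  rw [rx, rx, ← he, ← map_sub, e.norm_map]

/-! ### Continuity -/

/-- Shifting by `a x` moves the dependence on the centre from the kernel to the domain, so that the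
fixed integrable function `rx b 0` dominates. For a fixed parameter, the indicator of the shifted
domain is locally constant in the parameter unless z lies on a sphere, which is null. -/
theorem continuous_integral_indicator {X : Type*} [TopologicalSpace X] [FirstCountableTopology X]
    (b : Bool) {φ : X × Plane → ℝ} (hφ : Continuous φ) (h0 : ∀ q, 0 ≤ φ q) (h1 : ∀ q, φ q ≤ 1)
    {a : X → Plane} (ha : Continuous a) {r : X → ℝ} (hr : Continuous r) :
    Continuous fun x => ∫ z in (Metric.closedBall (0 : Plane) (r x))ᶜ,
      φ (x, z - a x) * p.rx b (a x) z := by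
  have hshift : ∀ x, ∫ z in (Metric.closedBall (0 : Plane) (r x))ᶜ,
      φ (x, z - a x) * p.rx b (a x) z = ∫ z, {z | r x < ‖z + a x‖}.indicator
        (fun z => φ (x, z) * p.rx b 0 z) z := by
    intro x
    rw [← integral_indicator measurableSet_closedBall.compl, ← integral_add_right_eq_self
      ((Metric.closedBall (0 : Plane) (r x))ᶜ.indicator
        fun z => φ (x, z - a x) * p.rx b (a x) z) (a x)]
    refine integral_congr_ae (Eventually.of_forall fun z => ?_)
    simp only [Set.indicator, Set.mem_compl_iff, mem_closedBall_zero_iff, not_le,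
      Set.mem_ofPred_eq, add_sub_cancel_right, rx, sub_zero]
  simp_rw [hshift]
  refine continuous_iff_continuousAt.2 fun x => ?_
  refine continuousAt_of_dominated (bound := p.rx b 0) ?_ ?_ (p.integrable_rx b 0) ?_
  · refine Eventually.of_forall fun y => Measurable.aestronglyMeasurable ?_
    refine Measurable.indicator ?_ (measurableSet_lt measurable_const (by fun_prop))
    exact (hφ.comp (by fun_prop : Continuous fun z : Plane => (y, z))).measurable.mul
      (p.measurable_rx b 0)
  · refine Eventually.of_forall fun y => Eventually.of_forall fun z => ?_
    have hz := p.rx_pos b 0 z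
    refine (norm_indicator_le_norm_self _ _).trans ?_
    rw [Real.norm_of_nonneg (mul_nonneg (h0 _) hz.le)]
    exact mul_le_of_le_one_left hz.le (h1 _)
  · have hnull : ∀ᵐ z : Plane, z ∉ Metric.sphere (-a x) (r x) :=
      measure_eq_zero_iff_ae_notMem.1 (Measure.addHaar_sphere volume _ _)
    filter_upwards [hnull] with z hz
    have hne : ‖z + a x‖ ≠ r x := fun h => hz (by
      rw [mem_sphere_iff_norm, sub_neg_eq_add]; exact h)
    have hcont : Continuous fun y => φ (y, z) * p.rx b 0 z :=
      (hφ.comp (by fun_prop)).mul continuous_const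
    have hc1 : Continuous fun y => ‖z + a y‖ := (continuous_const.add ha).norm
    rcases lt_or_gt_of_ne hne with hlt | hgt
    · have hev : ∀ᶠ y in 𝓝 x, ‖z + a y‖ < r y :=
        (hc1.tendsto x).eventually_lt (hr.tendsto x) hlt
      refine (continuousAt_const (y := (0 : ℝ))).congr ?_
      filter_upwards [hev] with y hy
      rw [Set.indicator_of_notMem]
      exact not_lt.2 hy.le
    · have hev : ∀ᶠ y in 𝓝 x, r y < ‖z + a y‖ :=
        (hr.tendsto x).eventually_lt (hc1.tendsto x) hgt
      refine hcont.continuousAt.congr ?_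
      filter_upwards [hev] with y hy
      rw [Set.indicator_of_mem]
      exact hy

theorem continuous_NW0 : Continuous fun q : Plane × Plane => p.NW0 q.2 ‖q.1‖ p.Gcs := by
  have h := p.continuous_integral_indicator true (X := Plane × Plane) (φ := fun _ => 1)
    continuous_const (fun _ => zero_le_one) (fun _ => le_rfl) continuous_snd continuous_fst.norm
  simp only [one_mul] at h
  simp_rw [NW0_eq]
  exact continuous_const.mul h

theorem continuous_NW2_norm : Continuous fun x : Plane => p.NW2 ‖x‖ := by
  have h : Continuous fun x : Plane => (x, x) := by fun_prop
  have h2 := Continuous.comp p.continuous_NW0 h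
  rw [show (fun x : Plane => p.NW2 ‖x‖) = _ from funext p.NW2_norm]
  exact h2

theorem continuous_CW1 : Continuous fun q : Plane × Plane => p.CW1 q.2 q.1 := by
  have h1 : Continuous fun v : (Plane × Plane) × Plane => (v.1.2, v.2 + v.1.1) := by fun_prop
  have h2 := Continuous.comp (p.continuous_rx true) h1
  have h := p.continuous_integral_indicator true h2 (fun _ => (p.rx_pos _ _ _).le)
    (fun _ => p.rx_le_one _ _ _) continuous_fst continuous_fst.norm
  simp only [Function.comp_apply, sub_add_cancel] at h
  simp_rw [CW1_eq, mul_comm (p.rx true (Prod.fst _) _)]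
  exact continuous_const.mul h

theorem continuous_CL2 : Continuous p.CL2 := by
  have h := p.continuous_integral_indicator false (X := Plane)
    (φ := fun v => p.rx false v.1 v.2) (p.continuous_rx false) (fun _ => (p.rx_pos _ _ _).le)
    (fun _ => p.rx_le_one _ _ _) (a := fun _ => 0) continuous_const (r := fun _ => 0)
    continuous_const
  simp only [sub_zero] at h
  have : p.CL2 = fun y => p.lamL * ∫ z in (Metric.closedBall (0 : Plane) 0)ᶜ,
    p.rx false y z * p.rx false 0 z := funext p.CL2_eq_set
  rw [this]
  exact continuous_const.mul h

end Params

end Coexistence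

namespace Coexistence

open scoped ENNReal

/-! ### Integration over the timers -/

theorem integral_exp_neg_mul {c : ℝ} (hc : c ≠ 0) (a b : ℝ) :
    ∫ u in a..b, Real.exp (-(c * u)) = (Real.exp (-(c * a)) - Real.exp (-(c * b))) / c := by
  have hd : ∀ u ∈ Set.uIcc a b,
      HasDerivAt (fun u => -Real.exp (-(c * u)) / c) (Real.exp (-(c * u))) u := fun u _ => by
    have h : HasDerivAt (fun u => -Real.exp (-(c * u)) / c)
        (-(Real.exp (-(c * u)) * -(c * 1)) / c) u :=
      ((((hasDerivAt_id u).const_mul c).neg).exp.neg).div_const c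
    refine h.congr_deriv ?_
    field_simp
  rw [intervalIntegral.integral_eq_sub_of_hasDerivAt hd
    (Continuous.intervalIntegrable (by fun_prop) _ _)]
  ring

theorem integral_one_sub_mul_exp_neg_mul {c : ℝ} (hc : c ≠ 0) (e : ℝ) :
    ∫ u in (0 : ℝ)..1, (1 - u * e) * Real.exp (-(c * u)) = (1 - Real.exp (-c)) / c -
      e * ((1 - Real.exp (-c)) / c ^ 2 - Real.exp (-c) / c) := by
  have hd : ∀ u ∈ Set.uIcc (0 : ℝ) 1, HasDerivAt
      (fun u => -((1 - u * e) / c - e / c ^ 2) * Real.exp (-(c * u)))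
      ((1 - u * e) * Real.exp (-(c * u))) u := fun u _ => by
    have h1 : HasDerivAt (fun u => Real.exp (-(c * u))) (Real.exp (-(c * u)) * -(c * 1)) u :=
      (((hasDerivAt_id u).const_mul c).neg).exp
    have h2 : HasDerivAt (fun u => -((1 - u * e) / c - e / c ^ 2)) (-(-(1 * e) / c)) u :=
      (((((hasDerivAt_id u).mul_const e).const_sub 1).div_const c).sub_const (e / c ^ 2)).neg
    refine (h2.mul h1).congr_deriv ?_
    field_simp
    ring
  rw [intervalIntegral.integral_eq_sub_of_hasDerivAt hd
    (Continuous.intervalIntegrable (by fun_prop) _ _)]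
  simp only [mul_one, mul_zero, neg_zero, Real.exp_zero, zero_mul, one_mul, sub_zero]
  field_simp
  ring

/-- The unit square is split along the diagonal, where min(s,u) changes its form; each triangle
yields one value of `M`. The hypotheses make all exponents that are divided by nonzero. -/
theorem integral_exp_neg_timers {a b c : ℝ} (ha : 0 < a) (hca : c < a) (hcb : c < b) (hb : 0 < b) :
    ∫ s in (0 : ℝ)..1, ((∫ u in (0 : ℝ)..s, Real.exp (-(s * a + u * b - u * c))) +
      ∫ u in s..1, Real.exp (-(s * a + u * b - s * c))) =
    Params.M a b c + Params.M b a c := by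
  have ha' := ha.ne'
  have hb' := hb.ne'
  have h1 : b - c ≠ 0 := (sub_pos.2 hcb).ne'
  have h2 : a - c ≠ 0 := (sub_pos.2 hca).ne'
  have h3 : a + b - c ≠ 0 := by linarith [sub_pos.2 hcb]
  have h3' : b + a - c ≠ 0 := by linarith [sub_pos.2 hcb]
  have e1 : ∀ s, ∫ u in (0 : ℝ)..s, Real.exp (-(s * a + u * b - u * c)) =
      (Real.exp (-(a * s)) - Real.exp (-((a + b - c) * s))) / (b - c) := fun s => by
    have : ∀ u, Real.exp (-(s * a + u * b - u * c)) =
        Real.exp (-(a * s)) * Real.exp (-((b - c) * u)) := fun u => by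
      rw [← Real.exp_add]; congr 1; ring
    simp_rw [this]
    rw [intervalIntegral.integral_const_mul, integral_exp_neg_mul h1, mul_zero, neg_zero,
      Real.exp_zero, mul_div_assoc', mul_sub, mul_one, ← Real.exp_add]
    congr 4
    ring
  have e2 : ∀ s, ∫ u in s..1, Real.exp (-(s * a + u * b - s * c)) =
      (Real.exp (-((a + b - c) * s)) - Real.exp (-b) * Real.exp (-((a - c) * s))) / b :=
      fun s => by
    have : ∀ u, Real.exp (-(s * a + u * b - s * c)) =
        Real.exp (-((a - c) * s)) * Real.exp (-(b * u)) := fun u => by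
      rw [← Real.exp_add]; congr 1; ring
    simp_rw [this]
    rw [intervalIntegral.integral_const_mul, integral_exp_neg_mul hb', mul_one, mul_div_assoc',
      mul_sub, ← Real.exp_add, mul_comm (Real.exp (-b))]
    congr 4
    ring
  have hint : ∀ k : ℝ, IntervalIntegrable (fun s => Real.exp (-(k * s))) volume 0 1 := fun k =>
    Continuous.intervalIntegrable (by fun_prop) _ _
  simp_rw [e1, e2]
  rw [intervalIntegral.integral_add (((hint _).sub (hint _)).div_const _)
    (((hint _).sub ((hint _).const_mul _)).div_const _), intervalIntegral.integral_div,
    intervalIntegral.integral_div, intervalIntegral.integral_sub (hint _) (hint _),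
    intervalIntegral.integral_sub (hint _) ((hint _).const_mul _),
    intervalIntegral.integral_const_mul, integral_exp_neg_mul ha', integral_exp_neg_mul h3,
    integral_exp_neg_mul h2, Params.M, Params.M,
    show Real.exp (-a - b + c) = Real.exp (-((a + b - c) * 1)) by congr 1; ring,
    show Real.exp (-b - a + c) = Real.exp (-((a + b - c) * 1)) by congr 1; ring,
    show Real.exp (-((a + b - c) * 1)) = Real.exp (-b) * Real.exp (-((a - c) * 1)) by
      rw [← Real.exp_add]; congr 1; ring]
  simp only [mul_zero, neg_zero, Real.exp_zero, mul_one]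
  congr 1
  rw [show b + a - c = a + b - c by ring]
  field_simp
  ring

theorem integral_timerLaw_ite {f g : ℝ → ℝ} (hf : Continuous f) (hg : Continuous g) {s : ℝ}
    (hs : s ∈ Set.Icc (0 : ℝ) 1) :
    ∫ u, (if u < s then f u else g u) ∂timerLaw = (∫ u in (0 : ℝ)..s, f u) + ∫ u in s..1, g u := by
  have e1 : ∫ u in (0 : ℝ)..s, (if u < s then f u else g u) = ∫ u in (0 : ℝ)..s, f u := by
    rw [intervalIntegral.integral_of_le hs.1, intervalIntegral.integral_of_le hs.1,
      integral_Ioc_eq_integral_Ioo, integral_Ioc_eq_integral_Ioo]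
    exact setIntegral_congr_fun measurableSet_Ioo fun u hu => if_pos hu.2
  have e2 : ∫ u in s..1, (if u < s then f u else g u) = ∫ u in s..1, g u :=
    intervalIntegral.integral_congr fun u hu => if_neg (by
      rw [Set.uIcc_of_le hs.2] at hu; exact not_lt.2 hu.1)
  have hint : ∀ x y, IntervalIntegrable (fun u => if u < s then f u else g u) volume x y :=
    fun x y => by
    rw [intervalIntegrable_iff]
    exact Integrable.piecewise (s := {u | u < s}) measurableSet_Iio
      (hf.intervalIntegrable x y).def'.integrableOn (hg.intervalIntegrable x y).def'.integrableOn
  rw [timerLaw, integral_Icc_eq_integral_Ioc, ← intervalIntegral.integral_of_le zero_le_one,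
    ← e1, ← e2, intervalIntegral.integral_add_adjacent_intervals (hint _ _) (hint _ _)]

theorem ae_timerLaw_prod_mem : ∀ᵐ t ∂timerLaw.prod timerLaw,
    t.1 ∈ Set.Icc (0 : ℝ) 1 ∧ t.2 ∈ Set.Icc (0 : ℝ) 1 := by
  rw [timerLaw, Measure.prod_restrict]
  exact ae_restrict_mem (measurableSet_Icc.prod measurableSet_Icc)

theorem ae_timerLaw_prod_ne : ∀ᵐ t ∂timerLaw.prod timerLaw, t.1 ≠ t.2 := by
  have hm : MeasurableSet {t : ℝ × ℝ | t.1 = t.2} := measurableSet_eq_fun measurable_fst measurable_snd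
  rw [ae_iff]
  simp only [not_not]
  rw [Measure.measure_prod_null hm]
  refine Eventually.of_forall fun s => ?_
  have : (Prod.mk s ⁻¹' {t : ℝ × ℝ | t.1 = t.2}) = {s} := by ext; simp [eq_comm]
  simp only [this, timerLaw, Pi.zero_apply]
  exact le_antisymm ((Measure.restrict_apply_le _ _).trans (by simp)) bot_le

/-! ### Integration over the marks of the pair: the functions U and V -/

namespace Params

variable (p : Params)

/-- The probability, given different timers, that the second access point does not silence the
first one (nor, if `both`, conversely), if each is received by the other one with probability
`e`. -/
noncomputable def pairProb (both : Bool) (e : ℝ) (t : ℝ × ℝ) : ℝ :=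
  if both = true ∨ t.2 < t.1 then 1 - e else 1

/-- Only the AP with the later timer can be silenced by the other one, so exactly one of the two
fadings is relevant; by symmetry of the distance both have the same detection probability. -/
theorem fading_pair (both : Bool) {q : Plane × Plane} (hq : q.1 ≠ q.2) {t : ℝ × ℝ}
    (ht : t.1 ≠ t.2) :
    ((expMeasure p.mu).prod (expMeasure p.mu)) {g | ¬ p.Blocks true q.1 q.2 t.1 t.2 g.1 ∧
      (both = true → ¬ p.Blocks true q.2 q.1 t.2 t.1 g.2)} =
      ENNReal.ofReal (pairProb both (p.rx true q.1 q.2) t) := by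
  have hsymm : p.rx true q.2 q.1 = p.rx true q.1 q.2 := by rw [rx, rx, norm_sub_rev]
  have hc : ∀ {x z : Plane}, z ≠ x →
      (expMeasure p.mu) {g | p.Detects true x z g}ᶜ = ENNReal.ofReal (1 - p.rx true x z) :=
    fun {x z} h => by
    rw [← ofReal_measureReal, probReal_compl_eq_one_sub (p.measurableSet_detects _ _ _),
      p.expMeasure_detects true h]
  rcases lt_or_gt_of_ne ht with h | h
  · cases both
    · simp [pairProb, Blocks, not_lt.2 h.le]
    · have : {g : ℝ × ℝ | ¬ p.Blocks true q.1 q.2 t.1 t.2 g.1 ∧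
          (true = true → ¬ p.Blocks true q.2 q.1 t.2 t.1 g.2)} =
          Set.univ ×ˢ {g | p.Detects true q.2 q.1 g}ᶜ := by
        ext g; simp [Blocks, not_lt.2 h.le, h]
      rw [this, Measure.prod_prod, measure_univ, one_mul, hc hq, hsymm]
      simp [pairProb]
  · have : {g : ℝ × ℝ | ¬ p.Blocks true q.1 q.2 t.1 t.2 g.1 ∧
        (both = true → ¬ p.Blocks true q.2 q.1 t.2 t.1 g.2)} =
        {g | p.Detects true q.1 q.2 g}ᶜ ×ˢ Set.univ := by
      ext g; simp [Blocks, not_lt.2 h.le, h]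
    rw [this, Measure.prod_prod, measure_univ, mul_one, hc hq.symm]
    simp [pairProb, h]

theorem meanBad_nonneg (both : Bool) (q : Plane × Plane) {t : ℝ × ℝ} (h1 : 0 ≤ t.1)
    (h2 : 0 ≤ t.2) : 0 ≤ p.meanBad both q t := by
  have h := fun b z => p.blockProb_nonneg both b q z h1 h2
  exact add_nonneg (mul_nonneg p.lamW_pos.le (add_nonneg measureReal_nonneg
    (integral_nonneg (h true)))) (mul_nonneg p.lamL_nonneg (integral_nonneg (h false)))

theorem continuous_meanBad (both : Bool) (q : Plane × Plane) : Continuous (p.meanBad both q) := by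
  cases both
  · rw [show p.meanBad false q = _ from funext (p.meanBad_false q)]
    fun_prop
  · rw [show p.meanBad true q = _ from funext (p.meanBad_true q)]
    fun_prop

/-- The probability, given the locations, of a good pair without bad points. -/
noncomputable def pairDensity (both : Bool) (q : Plane × Plane) : ℝ :=
  ∫ t, pairProb both (p.rx true q.1 q.2) t * Real.exp (-p.meanBad both q t) ∂timerLaw.prod timerLaw

theorem pairProb_mem (both : Bool) (q : Plane × Plane) (t : ℝ × ℝ) :
    0 ≤ pairProb both (p.rx true q.1 q.2) t ∧ pairProb both (p.rx true q.1 q.2) t ≤ 1 := by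
  have h1 := p.rx_pos true q.1 q.2
  have h2 := p.rx_le_one true q.1 q.2
  unfold pairProb
  split_ifs <;> constructor <;> linarith

theorem measurable_pairProb (both : Bool) (e : ℝ) : Measurable (pairProb both e) :=
  Measurable.ite ((MeasurableSet.const _).union (measurableSet_lt measurable_snd measurable_fst))
    measurable_const measurable_const

theorem integrable_pairProb_mul_exp (both : Bool) (q : Plane × Plane) :
    Integrable (fun t => pairProb both (p.rx true q.1 q.2) t * Real.exp (-p.meanBad both q t))
      (timerLaw.prod timerLaw) := by
  refine (integrable_const (1 : ℝ)).mono' ((measurable_pairProb _ _).mul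
    ((p.continuous_meanBad both q).measurable.neg.exp)).aestronglyMeasurable ?_
  filter_upwards [ae_timerLaw_prod_mem] with t ht
  obtain ⟨h0, h1⟩ := p.pairProb_mem both q t
  rw [Real.norm_of_nonneg (mul_nonneg h0 (Real.exp_nonneg _))]
  exact mul_le_one₀ h1 (Real.exp_nonneg _) (Real.exp_le_one_iff.2
    (neg_nonpos.2 (p.meanBad_nonneg both q ht.1.1 ht.2.1)))

theorem lintegral_pairProb_mul_exp (both : Bool) (q : Plane × Plane) :
    ∫⁻ t, ENNReal.ofReal (pairProb both (p.rx true q.1 q.2) t * Real.exp (-p.meanBad both q t))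
      ∂timerLaw.prod timerLaw = ENNReal.ofReal (p.pairDensity both q) :=
  (ofReal_integral_eq_lintegral_ofReal (p.integrable_pairProb_mul_exp both q)
    (Eventually.of_forall fun t => mul_nonneg (p.pairProb_mem both q t).1 (Real.exp_nonneg _))).symm

theorem pairDensity_eq_integral_integral (both : Bool) (q : Plane × Plane) :
    p.pairDensity both q = ∫ s in (0 : ℝ)..1, ∫ u, pairProb both (p.rx true q.1 q.2) (s, u) *
      Real.exp (-p.meanBad both q (s, u)) ∂timerLaw := by
  rw [pairDensity, integral_prod _ (p.integrable_pairProb_mul_exp both q),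
    intervalIntegral.integral_of_le zero_le_one, ← integral_Icc_eq_integral_Ioc]
  rfl

theorem rx_true_eq (q : Plane × Plane) :
    p.rx true q.1 q.2 = Real.exp (-p.mu * (p.Gcs / p.PW) * p.pathLoss ‖q.2 - q.1‖) := by
  simp [rx, threshold]

theorem U_eq_integral (q : Plane × Plane) {n : ℝ} (hn : n ≠ 0) :
    p.U (q.2 - q.1) (p.Gcs / p.PW) n =
      ∫ u in (0 : ℝ)..1, (1 - u * p.rx true q.1 q.2) * Real.exp (-(n * u)) := by
  rw [integral_one_sub_mul_exp_neg_mul hn, U, rx_true_eq]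

/-- In the integral representation the factor 1 - ue is positive for u < 1, even when e = 1, that
is, when the two locations coincide. -/
theorem U_pos (q : Plane × Plane) {n : ℝ} (hn : n ≠ 0) :
    0 < p.U (q.2 - q.1) (p.Gcs / p.PW) n := by
  rw [p.U_eq_integral q hn]
  refine intervalIntegral.intervalIntegral_pos_of_pos_on
    (Continuous.intervalIntegrable (by fun_prop) _ _) (fun u hu => ?_) zero_lt_one
  have h1 := p.rx_pos true q.1 q.2
  have h2 := p.rx_le_one true q.1 q.2
  have : 0 < 1 - u * p.rx true q.1 q.2 := by nlinarith [hu.1, hu.2]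
  positivity

/-- The mean number of bad points does not involve the second timer. Integrating that timer out
replaces the good-pair probability by its average s(1 - e) + (1 - s) = 1 - se. -/
theorem pairDensity_false (q : Plane × Plane) : p.pairDensity false q =
    Real.exp (-p.baseMass q) * p.U (q.2 - q.1) (p.Gcs / p.PW) (p.NW2 ‖q.1‖) := by
  rw [pairDensity_eq_integral_integral, NW2_norm, p.U_eq_integral q (p.NW0_pos _ _).ne',
    ← intervalIntegral.integral_const_mul]
  refine intervalIntegral.integral_congr fun s hs => ?_
  rw [Set.uIcc_of_le zero_le_one] at hs
  simp only [meanBad_false, integral_mul_const, pairProb, Bool.false_eq_true, false_or]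
  rw [integral_timerLaw_ite continuous_const continuous_const hs,
    intervalIntegral.integral_const, intervalIntegral.integral_const, neg_add, Real.exp_add,
    mul_comm s (p.NW0 _ _ _)]
  simp only [smul_eq_mul]
  ring

/-- The good-pair probability is 1 - e for either order of the timers and factors out; the rest is
`integral_exp_neg_timers`. -/
theorem pairDensity_true (q : Plane × Plane) : p.pairDensity true q =
    Real.exp (-p.baseMass q - (p.NL - p.CL2 (q.2 - q.1))) *
      p.V (q.2 - q.1) (p.Gcs / p.PW) (p.Gcs / p.PW) (p.NW2 ‖q.1‖) (p.NW0 q.2 ‖q.1‖ p.Gcs)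
        (p.CW1 q.2 q.1) := by
  rw [pairDensity_eq_integral_integral, NW2_norm, V, ← rx_true_eq, ← mul_add,
    ← integral_exp_neg_timers (p.NW0_pos _ _) (p.CW1_lt_left q.2 q.1) (p.CW1_lt_right q.2 q.1)
      (p.NW0_pos _ _),
    ← intervalIntegral.integral_const_mul, ← intervalIntegral.integral_const_mul]
  refine intervalIntegral.integral_congr fun s hs => ?_
  rw [Set.uIcc_of_le zero_le_one] at hs
  simp only [pairProb, true_or, if_true]
  rw [← integral_timerLaw_ite (by fun_prop) (by fun_prop) hs, ← integral_const_mul,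
    ← integral_const_mul]
  refine integral_congr_ae (Eventually.of_forall fun u => ?_)
  simp only [meanBad_true]
  rw [neg_add, Real.exp_add, ← mul_assoc, mul_comm (1 - _), mul_assoc, neg_add']
  congr 2
  split_ifs with h
  · rw [min_eq_right h.le]
  · rw [min_eq_left (not_lt.1 h)]

end Params

end Coexistence

/-! ### Lebesgue densities of the Campbell measures -/

namespace Coexistence

open scoped ENNReal

namespace Params

variable (p : Params)

/-- The pairs of locations whose second member is not closer to the origin. -/
def orderedPairs : Set (Plane × Plane) := {q | q.2 ∉ Metric.ball (0 : Plane) ‖q.1‖}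

theorem measurableSet_orderedPairs : MeasurableSet orderedPairs := by
  simp only [orderedPairs, Metric.mem_ball, dist_zero_right, not_lt]
  exact measurableSet_le measurable_fst.norm measurable_snd.norm

theorem ae_ne : ∀ᵐ q ∂(volume : Measure Plane).prod (volume : Measure Plane), q.1 ≠ q.2 := by
  have hm : MeasurableSet {q : Plane × Plane | q.1 = q.2} :=
    measurableSet_eq_fun measurable_fst measurable_snd
  rw [ae_iff]
  simp only [not_not]
  rw [Measure.measure_prod_null hm]
  refine Eventually.of_forall fun s => ?_
  have : (Prod.mk s ⁻¹' {q : Plane × Plane | q.1 = q.2}) = {s} := by ext; simp [eq_comm]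
  simp only [this, measure_singleton, Pi.zero_apply]

/-- The mean number of bad points depends on the locations and timers only, so integrating the two
fadings gives just the probability that the pair is good. Equal timers have probability zero. -/
theorem lintegral_pairLaw_goodPairs (both : Bool) {S : Set (Plane × Plane)} (hS : MeasurableSet S)
    {q : Plane × Plane} (hq : q.1 ≠ q.2) :
    ∫⁻ m, (p.goodPairs both S).indicator
      (fun w => ENNReal.ofReal (Real.exp (-(p.badMass (p.badPoints both) w).toReal))) (q, m)
      ∂p.pairLaw =
    (S ∩ orderedPairs).indicator (fun q => ENNReal.ofReal (p.pairDensity both q)) q := by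
  by_cases hqS : q ∈ S ∩ orderedPairs
  swap
  · rw [Set.indicator_of_notMem hqS]
    refine (lintegral_congr fun m => Set.indicator_of_notMem (fun h => hqS ?_) _).trans
      lintegral_zero
    exact ⟨h.1, h.2.1⟩
  rw [Set.indicator_of_mem hqS, ← lintegral_pairProb_mul_exp, pairLaw,
    lintegral_prod _ (Measurable.aemeasurable ?_)]
  swap
  · have h : Measurable fun m : PairMarks => ((q, m) : PairState) := measurable_prodMk_left
    exact (Measurable.indicator (p.measurable_badMass
      (p.measurableSet_badPoints both)).ennreal_toReal.neg.exp.ennreal_ofReal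
      (p.measurableSet_goodPairs both hS)).comp h
  refine lintegral_congr_ae ?_
  filter_upwards [ae_timerLaw_prod_mem, ae_timerLaw_prod_ne] with t ht hne
  have hle : ‖q.1‖ ≤ ‖q.2‖ := by simpa [orderedPairs] using hqS.2
  let G : Set (ℝ × ℝ) := {g | ¬ p.Blocks true q.1 q.2 t.1 t.2 g.1 ∧
    (both = true → ¬ p.Blocks true q.2 q.1 t.2 t.1 g.2)}
  have hG : MeasurableSet G := by
    have h := p.measurableSet_goodPairs both MeasurableSet.univ
    have h2 : Measurable fun g : ℝ × ℝ => ((q, (t, g)) : PairState) :=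
      measurable_const.prodMk (measurable_const.prodMk measurable_id)
    convert h2 h using 1
    ext g
    simp [G, goodPairs, hle]
  have hind : ∀ g, (p.goodPairs both S).indicator
      (fun w => ENNReal.ofReal (Real.exp (-(p.badMass (p.badPoints both) w).toReal))) (q, (t, g)) =
      G.indicator (fun _ => ENNReal.ofReal (Real.exp (-p.meanBad both q t))) g := fun g => by
    have hiff : ((q, (t, g)) : PairState) ∈ p.goodPairs both S ↔ g ∈ G := by
      simp [G, goodPairs, hqS.1, hle]
    by_cases hg : g ∈ G
    · rw [Set.indicator_of_mem hg, Set.indicator_of_mem (hiff.2 hg),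
        p.badMass_badPoints both ht.1 ht.2,
        ENNReal.toReal_ofReal (p.meanBad_nonneg both q ht.1.1 ht.2.1)]
    · rw [Set.indicator_of_notMem hg, Set.indicator_of_notMem (fun h => hg (hiff.1 h))]
  simp only [hind]
  rw [lintegral_indicator_const hG, p.fading_pair both hq hne,
    mul_comm, ← ENNReal.ofReal_mul (p.pairProb_mem both q t).1]

/-- A uniform bound on bounded sets of locations, needed for inclusion and exclusion. It is a union
bound combined with translation invariance. -/
theorem meanBad_le (both : Bool) {q : Plane × Plane} {t : ℝ × ℝ} {R : ℝ} (hR : ‖q.1‖ ≤ R)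
    (h1 : t.1 ∈ Set.Icc (0 : ℝ) 1) (h2 : t.2 ∈ Set.Icc (0 : ℝ) 1) :
    p.meanBad both q t ≤ p.lamW * (volume.real (Metric.ball (0 : Plane) R) +
      2 * ∫ z, p.rx true 0 z) + p.lamL * (2 * ∫ z, p.rx false 0 z) := by
  have hshift : ∀ b (x : Plane), ∫ z, p.rx b x z = ∫ z, p.rx b 0 z := fun b x => by
    simp only [rx, sub_zero]
    exact integral_sub_right_eq_self
      (fun z : Plane => Real.exp (-p.mu * p.threshold b * p.pathLoss ‖z‖)) x
  have hT : ∀ b, ∀ s ∈ Set.Icc (0 : ℝ) 1, timerProb b s ≤ 1 := fun b s hs => by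
    cases b
    · exact le_rfl
    · exact hs.2
  have hblock : ∀ b z, p.blockProb both b q t z ≤ p.rx b q.1 z + p.rx b q.2 z := fun b z => by
    have a1 := (p.rx_pos b q.1 z).le
    have a2 := (p.rx_pos b q.2 z).le
    have b1 := mul_le_of_le_one_left a1 (hT b t.1 h1)
    have b2 := mul_le_of_le_one_left a2 (hT b t.2 h2)
    have b3 := mul_nonneg (timerProb_nonneg b (le_min h1.1 h2.1)) (mul_nonneg a1 a2)
    unfold blockProb
    split_ifs <;> linarith
  have hint : ∀ b, ∫ z, p.blockProb both b q t z ≤ 2 * ∫ z, p.rx b 0 z := fun b => by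
    have hi := (p.integrable_rx b q.1).add (p.integrable_rx b q.2)
    refine (integral_mono (p.integrable_blockProb both b q t) hi (hblock b)).trans_eq ?_
    rw [integral_add' (p.integrable_rx b q.1) (p.integrable_rx b q.2), hshift b q.1, hshift b q.2,
      two_mul]
  have hnn := fun b z => p.blockProb_nonneg both b q z h1.1 h2.1
  have hball : volume.real (Metric.ball (0 : Plane) ‖q.1‖) ≤ volume.real (Metric.ball (0 : Plane) R) :=
    measureReal_mono (Metric.ball_subset_ball hR) measure_ball_lt_top.ne
  exact add_le_add (mul_le_mul_of_nonneg_left (add_le_add hball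
    ((setIntegral_le_integral (p.integrable_blockProb both true q t)
      (Eventually.of_forall (hnn true))).trans (hint true))) p.lamW_pos.le)
    (mul_le_mul_of_nonneg_left (hint false) p.lamL_nonneg)

theorem ae_pairMeasure_timers : ∀ᵐ w ∂p.pairMeasure,
    w.2.1.1 ∈ Set.Icc (0 : ℝ) 1 ∧ w.2.1.2 ∈ Set.Icc (0 : ℝ) 1 := by
  have h1 : ∀ᵐ m ∂p.pairLaw, m.1.1 ∈ Set.Icc (0 : ℝ) 1 ∧ m.1.2 ∈ Set.Icc (0 : ℝ) 1 :=
    Measure.quasiMeasurePreserving_fst.ae ae_timerLaw_prod_mem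
  exact Measure.quasiMeasurePreserving_snd.ae h1

end Params

namespace Network

variable {Ω : Type*} [MeasurableSpace Ω] {P : Measure Ω} [IsProbabilityMeasure P] {p : Params}
  (N : Network P p)

/-- Boundedness gives the good pairs finite measure and bounds their bad mass, the two finiteness
conditions of the void formula. -/
theorem campbell_jointEvent_of_isBounded (both : Bool) {S : Set (Plane × Plane)}
    (hS : MeasurableSet S) (hb : Bornology.IsBounded S) :
    N.campbell (N.jointEvent both) S = ENNReal.ofReal p.lamW ^ 2 *
      ∫⁻ q in S ∩ Params.orderedPairs, ENNReal.ofReal (p.pairDensity both q)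
        ∂(volume : Measure Plane).prod (volume : Measure Plane) := by
  have hA := p.measurableSet_goodPairs both hS
  have hB := p.measurableSet_badPoints both
  have hfin : p.pairMeasure (p.goodPairs both S) ≠ ∞ := by
    refine ((measure_mono (t := S ×ˢ Set.univ) fun w hw => ⟨hw.1, trivial⟩).trans_lt ?_).ne
    rw [Params.pairMeasure, Measure.prod_prod, measure_univ, mul_one]
    exact hb.measure_lt_top
  obtain ⟨R, hR⟩ := hb.exists_norm_le
  rw [N.campbell_jointEvent_apply both hS, N.tsum_measure_pairEvent_inter_badSet_eq_empty hA hB hfin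
    (c := p.lamW * (volume.real (Metric.ball (0 : Plane) R) +
      2 * ∫ z, p.rx true 0 z) + p.lamL * (2 * ∫ z, p.rx false 0 z)) ?_]
  · congr 1
    have hm : Measurable fun w => ENNReal.ofReal
        (Real.exp (-(p.badMass (p.badPoints both) w).toReal)) :=
      (p.measurable_badMass hB).ennreal_toReal.neg.exp.ennreal_ofReal
    rw [← lintegral_indicator hA, Params.pairMeasure,
      lintegral_prod _ (hm.indicator hA).aemeasurable,
      ← lintegral_indicator (hS.inter Params.measurableSet_orderedPairs)]
    refine lintegral_congr_ae ?_
    filter_upwards [Params.ae_ne] with q hq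
    exact p.lintegral_pairLaw_goodPairs both hS hq
  · filter_upwards [ae_restrict_of_ae p.ae_pairMeasure_timers, ae_restrict_mem hA] with w ht hw
    rw [p.badMass_badPoints both ht.1 ht.2]
    exact ENNReal.ofReal_le_ofReal
      (p.meanBad_le both ((norm_fst_le _).trans (hR _ hw.1)) ht.1 ht.2)

/-- The density of the Campbell measures with respect to Lebesgue measure. -/
theorem campbell_jointEvent_eq_withDensity (both : Bool) :
    N.campbell (N.jointEvent both) =
      ((volume : Measure Plane).prod (volume : Measure Plane)).withDensity fun q =>
        ENNReal.ofReal p.lamW ^ 2 *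
          Params.orderedPairs.indicator (fun q => ENNReal.ofReal (p.pairDensity both q)) q := by
  refine Measure.ext_of_iUnion_eq_univ
    (s := fun n : ℕ => Metric.closedBall (0 : Plane × Plane) n) (Metric.iUnion_closedBall_nat 0)
    fun n => Measure.ext fun S hS => ?_
  have hS' : MeasurableSet (S ∩ Metric.closedBall (0 : Plane × Plane) n) :=
    hS.inter measurableSet_closedBall
  rw [Measure.restrict_apply hS, Measure.restrict_apply hS, N.campbell_jointEvent_of_isBounded both
    hS' (Metric.isBounded_closedBall.subset Set.inter_subset_right), withDensity_apply _ hS',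
    lintegral_const_mul' _ _ (ENNReal.pow_ne_top ENNReal.ofReal_ne_top),
    setLIntegral_indicator Params.measurableSet_orderedPairs, Set.inter_comm]

end Network

end Coexistence

/-! ### The quotient of the densities and the limit over shrinking balls -/

namespace Coexistence

open scoped ENNReal

namespace Params

variable (p : Params)

theorem hAt_mul_pairDensity (q : Plane × Plane) :
    p.hAt q.1 q.2 * p.pairDensity false q = p.pairDensity true q := by
  have hU := (p.U_pos q (p.NW2_norm q.1 ▸ (p.NW0_pos q.1 ‖q.1‖).ne' : p.NW2 ‖q.1‖ ≠ 0)).ne'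
  have hE := (Real.exp_pos (p.NL - p.CL2 (q.2 - q.1))).ne'
  rw [pairDensity_true, pairDensity_false, hAt, sub_eq_add_neg (-p.baseMass q), Real.exp_add,
    Real.exp_neg (p.NL - _)]
  field_simp

theorem pairDensity_nonneg (both : Bool) (q : Plane × Plane) : 0 ≤ p.pairDensity both q :=
  integral_nonneg fun t => mul_nonneg (p.pairProb_mem both q t).1 (Real.exp_nonneg _)

theorem pairDensity_false_pos (q : Plane × Plane) : 0 < p.pairDensity false q := by
  rw [pairDensity_false]
  exact mul_pos (Real.exp_pos _)
    (p.U_pos q (p.NW2_norm q.1 ▸ (p.NW0_pos q.1 ‖q.1‖).ne' : p.NW2 ‖q.1‖ ≠ 0))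

theorem pairDensity_le_one (both : Bool) (q : Plane × Plane) : p.pairDensity both q ≤ 1 := by
  have h : p.pairDensity both q ≤ ∫ _, (1 : ℝ) ∂timerLaw.prod timerLaw := by
    refine integral_mono_ae (p.integrable_pairProb_mul_exp both q) (integrable_const 1) ?_
    filter_upwards [ae_timerLaw_prod_mem] with t ht
    exact mul_le_one₀ (p.pairProb_mem both q t).2 (Real.exp_nonneg _) (Real.exp_le_one_iff.2
      (neg_nonpos.2 (p.meanBad_nonneg both q ht.1.1 ht.2.1)))
  simpa using h

/-- The sign is not visible in the formula; it is read off from the quotient of the two densities.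
-/
theorem hAt_nonneg (q : Plane × Plane) : 0 ≤ p.hAt q.1 q.2 :=
  nonneg_of_mul_nonneg_left (p.hAt_mul_pairDensity q ▸ p.pairDensity_nonneg true q)
    (p.pairDensity_false_pos q)

theorem continuous_hAt : Continuous fun q : Plane × Plane => p.hAt q.1 q.2 := by
  have c1 : Continuous fun q : Plane × Plane => p.NW2 ‖q.1‖ :=
    p.continuous_NW2_norm.comp continuous_fst
  have c2 := p.continuous_NW0
  have c3 := p.continuous_CW1
  have c4 : Continuous fun q : Plane × Plane => p.CL2 (q.2 - q.1) :=
    p.continuous_CL2.comp (continuous_snd.sub continuous_fst)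
  have c5 : Continuous fun q : Plane × Plane =>
      Real.exp (-p.mu * (p.Gcs / p.PW) * p.pathLoss ‖q.2 - q.1‖) :=
    (continuous_const.mul
      (p.continuous_pathLoss.comp (continuous_snd.sub continuous_fst).norm)).rexp
  have n1 : ∀ q : Plane × Plane, p.NW2 ‖q.1‖ ≠ 0 := fun q => by
    rw [NW2_norm]; exact (p.NW0_pos _ _).ne'
  have n2 : ∀ q : Plane × Plane, p.NW0 q.2 ‖q.1‖ p.Gcs ≠ 0 := fun q => (p.NW0_pos _ _).ne'
  have n3 : ∀ q : Plane × Plane, p.NW0 q.2 ‖q.1‖ p.Gcs - p.CW1 q.2 q.1 ≠ 0 := fun q =>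
    (sub_pos.2 (p.CW1_lt_right _ _)).ne'
  have n4 : ∀ q : Plane × Plane, p.NW2 ‖q.1‖ - p.CW1 q.2 q.1 ≠ 0 := fun q => by
    rw [NW2_norm]; exact (sub_pos.2 (p.CW1_lt_left _ _)).ne'
  have n5 : ∀ q : Plane × Plane,
      p.NW2 ‖q.1‖ + p.NW0 q.2 ‖q.1‖ p.Gcs - p.CW1 q.2 q.1 ≠ 0 := fun q => by
    rw [NW2_norm]
    linarith [sub_pos.2 (p.CW1_lt_left q.2 q.1), p.NW0_pos q.2 ‖q.1‖]
  have n6 : ∀ q : Plane × Plane,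
      p.NW0 q.2 ‖q.1‖ p.Gcs + p.NW2 ‖q.1‖ - p.CW1 q.2 q.1 ≠ 0 := fun q => by
    rw [add_comm]; exact n5 q
  have n7 : ∀ q : Plane × Plane, p.U (q.2 - q.1) (p.Gcs / p.PW) (p.NW2 ‖q.1‖) *
      Real.exp (p.NL - p.CL2 (q.2 - q.1)) ≠ 0 := fun q =>
    (mul_pos (p.U_pos q (n1 q)) (Real.exp_pos _)).ne'
  unfold hAt
  refine Continuous.div ?_ ?_ n7
  · unfold V M
    refine ((continuous_const.sub c5).mul ?_).add ((continuous_const.sub c5).mul ?_)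
    · exact (((continuous_const.sub c1.neg.rexp).div c1 n1).sub
        ((continuous_const.sub ((c1.neg.sub c2).add c3).rexp).div ((c1.add c2).sub c3) n5)).div
        (c2.sub c3) n3
    · exact (((continuous_const.sub c2.neg.rexp).div c2 n2).sub
        ((continuous_const.sub ((c2.neg.sub c1).add c3).rexp).div ((c2.add c1).sub c3) n6)).div
        (c1.sub c3) n4
  · unfold U
    exact (((continuous_const.sub c1.neg.rexp).div c1 n1).sub (c5.mul
      (((continuous_const.sub c1.neg.rexp).div (c1.pow 2) fun q => pow_ne_zero 2 (n1 q)).sub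
        (c1.neg.rexp.div c1 n1)))).mul (continuous_const.sub c4).rexp

end Params

namespace Network

variable {Ω : Type*} [MeasurableSpace Ω] {P : Measure Ω} [IsProbabilityMeasure P] {p : Params}
  (N : Network P p)

theorem measurable_density (both : Bool) : Measurable fun q => ENNReal.ofReal p.lamW ^ 2 *
    Params.orderedPairs.indicator (fun q => ENNReal.ofReal (p.pairDensity both q)) q := by
  have h : Measurable (p.pairDensity both) := by
    have hf : Measurable fun q : Plane × Plane => p.pairDensity false q := by
      have h1 : Measurable fun q : Plane × Plane => p.NW2 ‖q.1‖ :=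
        p.continuous_NW2_norm.measurable.comp measurable_fst
      have h2 : Measurable fun q : Plane × Plane => p.rx true q.1 q.2 :=
        (p.continuous_rx true).measurable
      have h3 : Measurable p.baseMass := by
        have : Measurable fun q : Plane × Plane => volume.real (Metric.ball (0 : Plane) ‖q.1‖) := by
          simp_rw [Measure.real, EuclideanSpace.volume_ball]
          fun_prop
        exact (this.const_mul _).add_const _
      simp_rw [Params.pairDensity_false, Params.U, ← Params.rx_true_eq]
      fun_prop
    cases both
    · exact hf
    -- This density is the continuous function `hAt` times the measurable density of the other case.
    · rw [show p.pairDensity true = _ from funext fun q => (p.hAt_mul_pairDensity q).symm]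
      exact p.continuous_hAt.measurable.mul hf
  exact (h.ennreal_ofReal.indicator Params.measurableSet_orderedPairs).const_mul _

theorem campbellBoth_eq_withDensity : N.campbellBoth =
    N.campbellTagged.withDensity fun q => ENNReal.ofReal (p.hAt q.1 q.2) := by
  have hh : Measurable fun q : Plane × Plane => ENNReal.ofReal (p.hAt q.1 q.2) :=
    p.continuous_hAt.measurable.ennreal_ofReal
  rw [campbellBoth_eq, campbellTagged_eq, campbell_jointEvent_eq_withDensity,
    campbell_jointEvent_eq_withDensity, ← withDensity_mul _ (measurable_density false) hh]
  congr 1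
  funext q
  simp only [Pi.mul_apply]
  by_cases hq : q ∈ Params.orderedPairs
  · rw [Set.indicator_of_mem hq, Set.indicator_of_mem hq, ← p.hAt_mul_pairDensity,
      ENNReal.ofReal_mul (p.hAt_nonneg q)]
    ring
  · rw [Set.indicator_of_notMem hq, Set.indicator_of_notMem hq, mul_zero, zero_mul]

theorem campbellTagged_lt_top {S : Set (Plane × Plane)} (hS : MeasurableSet S)
    (hb : Bornology.IsBounded S) : N.campbellTagged S < ∞ := by
  rw [campbellTagged_eq, N.campbell_jointEvent_of_isBounded false hS hb]
  refine ENNReal.mul_lt_top (ENNReal.pow_lt_top ENNReal.ofReal_lt_top) ?_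
  refine (setLIntegral_mono_ae' (g := fun _ => 1)
    (hS.inter Params.measurableSet_orderedPairs) (Eventually.of_forall fun q _ => ?_)).trans_lt ?_
  · rw [← ENNReal.ofReal_one]
    exact ENNReal.ofReal_le_ofReal (p.pairDensity_le_one false q)
  · rw [setLIntegral_one]
    exact (hb.subset Set.inter_subset_left).measure_lt_top

/-- The density is strictly positive on ordered pairs, so the denominators in the limit do not
vanish. -/
theorem campbellTagged_pos {S : Set (Plane × Plane)} (hS : IsOpen S)
    (hne : S.Nonempty) (hsub : S ⊆ Params.orderedPairs) : 0 < N.campbellTagged S := by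
  rw [campbellTagged_eq, campbell_jointEvent_eq_withDensity, withDensity_apply _ hS.measurableSet,
    lintegral_pos_iff_support (measurable_density false),
    Measure.restrict_apply' hS.measurableSet]
  refine (hS.measure_pos _ hne).trans_le (measure_mono fun q hq => ⟨?_, hq⟩)
  rw [Function.mem_support, Set.indicator_of_mem (hsub hq)]
  exact mul_ne_zero (pow_ne_zero _ (ENNReal.ofReal_pos.2 p.lamW_pos).ne')
    (ENNReal.ofReal_pos.2 (p.pairDensity_false_pos q)).ne'

/-- The quotient is the average of `hAt` over the ball with respect to the Campbell measure of the
tagged AP, and `hAt` is continuous. The strict inequality of the norms keeps small balls inside the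
ordered pairs. -/
theorem tendsto_campbell_div (x₀ x : Plane) (hx : ‖x₀‖ < ‖x‖) :
    Tendsto (fun ε : ℝ => N.campbellBoth.real (Metric.ball x₀ ε ×ˢ Metric.ball x ε) /
      N.campbellTagged.real (Metric.ball x₀ ε ×ˢ Metric.ball x ε)) (𝓝[>] 0)
      (𝓝 (p.hAt x₀ x)) := by
  have hopen : IsOpen {q : Plane × Plane | ‖q.1‖ < ‖q.2‖} :=
    isOpen_lt continuous_fst.norm continuous_snd.norm
  rw [Metric.tendsto_nhds]
  intro δ hδ
  obtain ⟨η, hη, hηδ⟩ := Metric.continuous_iff.1 p.continuous_hAt (x₀, x) (δ / 2) (half_pos hδ)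
  obtain ⟨ρ, hρ, hball⟩ := Metric.isOpen_iff.1 hopen (x₀, x) hx
  filter_upwards [Ioo_mem_nhdsGT (lt_min hη hρ)] with ε hε
  have hεη := hε.2.trans_le (min_le_left _ _)
  have hερ := hε.2.trans_le (min_le_right _ _)
  -- With the maximum metric on the product, a product of balls of equal radius is a ball.
  rw [ball_prod_same]
  have hfin := N.campbellTagged_lt_top (S := Metric.ball (x₀, x) ε) measurableSet_ball
    Metric.isBounded_ball
  have hpos := N.campbellTagged_pos (S := Metric.ball (x₀, x) ε) Metric.isOpen_ball
    ⟨_, Metric.mem_ball_self hε.1⟩ fun q hq => by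
      have := hball (Metric.ball_subset_ball hερ.le hq)
      simpa [Params.orderedPairs] using this.le
  have hD : 0 < N.campbellTagged.real (Metric.ball (x₀, x) ε) := ENNReal.toReal_pos hpos.ne' hfin.ne
  have : IsFiniteMeasure (N.campbellTagged.restrict (Metric.ball (x₀, x) ε)) :=
    ⟨by rwa [Measure.restrict_apply_univ]⟩
  have hclose : ∀ q ∈ Metric.ball (x₀, x) ε, |p.hAt q.1 q.2 - p.hAt x₀ x| ≤ δ / 2 := fun q hq =>
    (hηδ q ((Metric.mem_ball.1 hq).trans hεη)).le
  have hint : IntegrableOn (fun q : Plane × Plane => p.hAt q.1 q.2) (Metric.ball (x₀, x) ε)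
      N.campbellTagged := by
    refine (integrable_const (p.hAt x₀ x + δ / 2)).mono'
      p.continuous_hAt.measurable.aestronglyMeasurable ?_
    filter_upwards [ae_restrict_mem measurableSet_ball] with q hq
    rw [Real.norm_of_nonneg (p.hAt_nonneg q)]
    linarith [(abs_le.1 (hclose q hq)).2]
  have hC : N.campbellBoth.real (Metric.ball (x₀, x) ε) =
      ∫ q in Metric.ball (x₀, x) ε, p.hAt q.1 q.2 ∂N.campbellTagged := by
    rw [Measure.real, campbellBoth_eq_withDensity, withDensity_apply _ measurableSet_ball,
      integral_eq_lintegral_of_nonneg_ae (Eventually.of_forall fun q => p.hAt_nonneg q)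
        hint.aestronglyMeasurable]
  have hdiff : |N.campbellBoth.real (Metric.ball (x₀, x) ε) -
      p.hAt x₀ x * N.campbellTagged.real (Metric.ball (x₀, x) ε)| ≤
      δ / 2 * N.campbellTagged.real (Metric.ball (x₀, x) ε) := by
    have h1 : N.campbellBoth.real (Metric.ball (x₀, x) ε) -
        p.hAt x₀ x * N.campbellTagged.real (Metric.ball (x₀, x) ε) =
        ∫ q in Metric.ball (x₀, x) ε, (p.hAt q.1 q.2 - p.hAt x₀ x) ∂N.campbellTagged := by
      rw [integral_sub hint (integrable_const _), hC, setIntegral_const, smul_eq_mul, mul_comm]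
    rw [h1]
    exact norm_setIntegral_le_of_norm_le_const
      (f := fun q : Plane × Plane => p.hAt q.1 q.2 - p.hAt x₀ x) hfin hclose
  rw [Real.dist_eq, div_sub' hD.ne', abs_div, abs_of_pos hD, div_lt_iff₀ hD, mul_comm _ (p.hAt _ _)]
  nlinarith

end Network

end Coexistence

theorem mainTheorem3 {Ω : Type*} [MeasurableSpace Ω] (P : MeasureTheory.Measure Ω)
    [MeasureTheory.IsProbabilityMeasure P] (p : Coexistence.Params)
    (N : Coexistence.Network P p) :
    (∀ (r₀ : ℝ) (x : Coexistence.Plane), 0 ≤ r₀ →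
      x ∈ (Metric.closedBall (0 : Coexistence.Plane) r₀)ᶜ →
      Filter.Tendsto
        (fun ε : ℝ =>
          N.campbellBoth.real (Metric.ball !₂[r₀, 0] ε ×ˢ Metric.ball x ε)
            / N.campbellTagged.real (Metric.ball !₂[r₀, 0] ε ×ˢ Metric.ball x ε))
        (nhdsWithin 0 (Set.Ioi 0)) (nhds (p.h1 r₀ x))) ∧
    N.campbellBoth =
      N.campbellTagged.withDensity (fun z => ENNReal.ofReal (p.hAt z.1 z.2)) := by
  refine ⟨fun r₀ x hr hx => ?_, N.campbellBoth_eq_withDensity⟩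
  have hn : ‖(!₂[r₀, 0] : Coexistence.Plane)‖ = r₀ := by
    simp [EuclideanSpace.norm_eq, Real.sqrt_sq hr]
  have h : p.h1 r₀ x = p.hAt !₂[r₀, 0] x := by
    rw [Coexistence.Params.hAt, Coexistence.Params.h1, hn]
  rw [h]
  refine N.tendsto_campbell_div _ x ?_
  rw [hn]
  simpa using hx
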